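/- Let $n\ge 2$ and let $(X_i,\mu_i)$, $i=1,\dots,n$, be $\sigma$-finite measure spaces. Products carry the product measures. Let $H^{\mathrm d}$ denote the dual of a Hilbert space $H$, $\odot$ the algebraic tensor product, $H\otimes K$ the Hilbert space tensor product, and $\|\cdot\|_{\mathrm h}$ the Haagerup norm: for operator spaces $E_1,\dots,E_m$, $\|u\|_{\mathrm h}=\inf\|a^1\|\cdots\|a^m\|$ over all representations $u=\sum a^1_{1,i_1}\otimes a^2_{i_1,i_2}\otimes\dots\otimes a^m_{i_{m-1},1}$ with finite matrices $a^k$ over $E_k$ (with $a^1$ a row and $a^m$ a column). *Schur multipliers.* For $f\in L^2(X\times Y)$ let $T_f:L^2(X)\to L^2(Y)$, $(T_f\xi)(y)=\int_X f(x,y)\xi(x)\,dx$, put $\|f\|_{\mathrm{op}}=\|T_f\|$, and give $L^2(X\times Y)$ the matrix norms $\|(f_{ij})\|=\|(T_{f_{ji}})\|$. For $\varphi\in L^\infty(X_1\times\dots\times X_n)$ let $S_\varphi$ be the linear map from $L^2(X_1\times X_2)\odot\dots\odot L^2(X_{n-1}\times X_n)$ to $L^2(X_1\times X_n)$ with $$S_\varphi(f_1\otimes\dots\otimes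 f_{n-1})(x_1,x_n)=\int_{X_2\times\dots\times X_{n-1}}\varphi(x_1,\dots,x_n)f_1(x_1,x_2)\cdots f_{n-1}(x_{n-1},x_n)\,dx_2\cdots dx_{n-1}.$$ Then $\varphi$ is a *Schur multiplier* if there is $C>0$ with $\|S_\varphi(\Phi)\|_{\mathrm{op}}\le C\|\Phi\|_{\mathrm h}$ for all $\Phi$. *Operator multipliers.* For Hilbert spaces $H,K$ let $\theta$ map $H\otimes K$ to operators $H^{\mathrm d}\to K$ by $\theta(x\otimes y)(f)=f(x)y$, and map $H^{\mathrm d}\otimes K^{\mathrm d}=(H\otimes K)^{\mathrm d}$ to operators $H\to K^{\mathrm d}$ by $(\theta(g)x)(y)=g(x\otimes y)$; give these spaces the matrix norms $\|(\xi_{ij})\|=\|(\theta(\xi_{ji}))\|$. For Hilbert spaces $H_1,\dots,H_n$ let $\Gamma(H_1,\dots,H_n)$ be $(H_1\otimes H_2)\odot(H_2^{\mathrm d}\otimes H_3^{\mathrm d})\odot(H_3\otimes H_4)\odot\dots\odot(H_{n-1}\otimes H_n)$ if $n$ is even and $(H_1^{\mathrm d}\otimes H_2^{\mathrm d})\odot(H_2\otimes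 H_3)\odot\dots\odot(H_{n-1}\otimes H_n)$ if $n$ is odd. For $A\in B(H_1\otimes\dots\otimes H_n)$ define $S_A$ linearly on $\Gamma(H_1,\dots,H_n)$ as follows. If $n$ is even, $S_A(\xi_{12}\otimes g_{23}\otimes\xi_{34}\otimes\dots\otimes\xi_{n-1,n}):H_1^{\mathrm d}\to H_n$ is $\theta$ of the vector of $H_1\otimes H_n$ obtained by contracting $A(\xi_{12}\otimes\xi_{34}\otimes\dots\otimes\xi_{n-1,n})$ with the functionals $g_{23},g_{45},\dots,g_{n-2,n-1}$. If $n$ is odd, $S_A(g_{12}\otimes\xi_{23}\otimes\dots\otimes\xi_{n-1,n}):H_1\to H_n$ sends $x$ to the contraction of $A(x\otimes\xi_{23}\otimes\dots\otimes\xi_{n-1,n})$ with $g_{12},g_{34},\dots,g_{n-2,n-1}$. The operator $A$ is a *concrete multiplier* if there is $C>0$ with $\|S_A(\zeta)\|\le C\|\zeta\|_{\mathrm h}$ for all $\zeta\in\Gamma(H_1,\dots,H_n)$. For representations $\pi_i$ of C*-algebras $\mathcal A_i$ on $H_i$, an element $\varphi$ of the minimal tensor product $\mathcal A_1\otimes\dots\otimes\mathcal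 A_n$ is a *$\pi_1,\dots,\pi_n$-multiplier* if $(\pi_1\otimes\dots\otimes\pi_n)(\varphi)$ is a concrete multiplier. **Proposition.** Let $\pi_i$ be the representation of $L^\infty(X_i)$ on $L^2(X_i)$ by multiplication operators. The minimal tensor product $L^\infty(X_1)\otimes\dots\otimes L^\infty(X_n)$ embeds linearly and isometrically in $L^\infty(X_1\times\dots\times X_n)$ so that $a_1\otimes\dots\otimes a_n$ becomes the function $(x_1,\dots,x_n)\mapsto a_1(x_1)\cdots a_n(x_n)$. Under this identification, an element $\varphi\in L^\infty(X_1)\otimes\dots\otimes L^\infty(X_n)$ is a Schur multiplier if and only if it is a $\pi_1,\dots,\pi_n$-multiplier. -/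

import Mathlib

open MeasureTheory UniformSpace
open scoped ENNReal TensorProduct

noncomputable section

namespace OperatorMultiplier

universe u

/-- A complex Hilbert space, bundled. -/
structure HilbSp : Type (u + 1) where
  carrier : Type u
  [normed : NormedAddCommGroup carrier]
  [inner : InnerProductSpace ℂ carrier]
  [complete : CompleteSpace carrier]

instance : CoeSort HilbSp.{u} (Type u) := ⟨HilbSp.carrier⟩

attribute [instance] HilbSp.normed HilbSp.inner HilbSp.complete

namespace HilbSp

/-- The Hilbert space tensor product `H ⊗ K`. -/
abbrev tensor (H K : HilbSp.{u}) : HilbSp.{u} := ⟨Completion (H ⊗[ℂ] K)⟩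

end HilbSp

/-- The elementary tensor `x ⊗ y` as a continuous bilinear map `H × K → H ⊗ K`. -/
def tmulL (H K : HilbSp.{u}) : H →L[ℂ] K →L[ℂ] H.tensor K :=
  (ContinuousLinearMap.compL ℂ K (H ⊗[ℂ] K) (Completion (H ⊗[ℂ] K)) Completion.toComplL) ∘L
    TensorProduct.mkL ℂ H K

/-- The tensor product `A ⊗ B` of two bounded operators, `x ⊗ y ↦ A x ⊗ B y`. -/
def mapT {H H' K K' : HilbSp.{u}} (A : H →L[ℂ] H') (B : K →L[ℂ] K') :
    H.tensor K →L[ℂ] H'.tensor K' :=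
  (TensorProduct.mapL A B).completion

theorem completion_add' {E F : Type*} [NormedAddCommGroup E] [NormedSpace ℂ E]
    [NormedAddCommGroup F] [NormedSpace ℂ F] (f g : E →L[ℂ] F) :
    (f + g).completion = f.completion + g.completion := by
  refine ContinuousLinearMap.ext fun x => ?_
  induction x using Completion.induction_on with
  | hp => exact isClosed_eq (ContinuousLinearMap.continuous _) (ContinuousLinearMap.continuous _)
  | ih x => simp [Completion.coe_add]

theorem completion_smul' {E F : Type*} [NormedAddCommGroup E] [NormedSpace ℂ E]
    [NormedAddCommGroup F] [NormedSpace ℂ F] (c : ℂ) (f : E →L[ℂ] F) :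
    (c • f).completion = c • f.completion := by
  refine ContinuousLinearMap.ext fun x => ?_
  induction x using Completion.induction_on with
  | hp => exact isClosed_eq (ContinuousLinearMap.continuous _) (ContinuousLinearMap.continuous _)
  | ih x => simp [Completion.coe_smul]

theorem norm_mapT_le {H H' K K' : HilbSp.{u}} (A : H →L[ℂ] H') (B : K →L[ℂ] K') :
    ‖mapT A B‖ ≤ ‖A‖ * ‖B‖ := by
  refine ContinuousLinearMap.opNorm_le_bound _ (by positivity) fun x => ?_
  induction x using Completion.induction_on with
  | hp => exact isClosed_le (ContinuousLinearMap.continuous _).norm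
            (continuous_const.mul continuous_norm)
  | ih x =>
    rw [mapT, ContinuousLinearMap.completion_apply_coe, Completion.norm_coe, Completion.norm_coe]
    exact (ContinuousLinearMap.le_opNorm _ _).trans
      (mul_le_mul_of_nonneg_right (TensorProduct.norm_mapL_le A B) (norm_nonneg _))

/-- `(A, B) ↦ A ⊗ B` as a bilinear map. -/
def mapTₗ (H H' K K' : HilbSp.{u}) :
    (H →L[ℂ] H') →ₗ[ℂ] (K →L[ℂ] K') →ₗ[ℂ] (H.tensor K →L[ℂ] H'.tensor K') :=
  LinearMap.mk₂ ℂ mapT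
    (fun A A' B => by
      exact (congrArg _ (TensorProduct.mapL_add_left A A' B)).trans
        (completion_add' (TensorProduct.mapL A B) (TensorProduct.mapL A' B)))
    (fun c A B => by
      exact (congrArg _ (TensorProduct.mapL_smul_left c A B)).trans
        (completion_smul' c (TensorProduct.mapL A B)))
    (fun A B B' => by
      exact (congrArg _ (TensorProduct.mapL_add_right A B B')).trans
        (completion_add' (TensorProduct.mapL A B) (TensorProduct.mapL A B')))
    (fun c A B => by
      exact (congrArg _ (TensorProduct.mapL_smul_right c A B)).trans
        (completion_smul' c (TensorProduct.mapL A B)))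

/-- The slice map `f ⊗ id : H ⊗ K → K`, `x ⊗ y ↦ f(x) y`, on the algebraic tensor product. -/
def sliceL (H K : HilbSp.{u}) : StrongDual ℂ H →L[ℂ] (H ⊗[ℂ] K →L[ℂ] K) :=
  LinearMap.mkContinuous
    { toFun := fun f =>
        ((TensorProduct.lidIsometry ℂ K).toContinuousLinearEquiv : ℂ ⊗[ℂ] K →L[ℂ] K) ∘L
          ContinuousLinearMap.rTensor (𝕜 := ℂ) K f
      map_add' := fun f g => by ext; simp
      map_smul' := fun c f => by ext; simp }
    1 (fun f => by
      refine ContinuousLinearMap.opNorm_le_bound _ (by positivity) fun u => ?_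
      calc _ = ‖ContinuousLinearMap.rTensor (𝕜 := ℂ) K f u‖ :=
              (TensorProduct.lidIsometry ℂ K).norm_map _
        _ ≤ ‖ContinuousLinearMap.rTensor (𝕜 := ℂ) K f‖ * ‖u‖ :=
              ContinuousLinearMap.le_opNorm _ _
        _ ≤ 1 * ‖f‖ * ‖u‖ := by
              rw [one_mul]; gcongr; exact ContinuousLinearMap.norm_rTensor_le (G := K) f)

/-- The unitary `θ : H ⊗ K → C₂(Hᵈ, K)`, `θ (x ⊗ y) zᵈ = zᵈ(x) y`, where `Hᵈ` is the dual of `H`;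
its values are regarded here as bounded operators `Hᵈ → K`. -/
def theta (H K : HilbSp.{u}) : H.tensor K →L[ℂ] (StrongDual ℂ H →L[ℂ] K) :=
  (sliceL H K).flip.fromCompletion

/-- The map `θ` for the dual spaces: under the identification of `Hᵈ ⊗ Kᵈ` with `(H ⊗ K)ᵈ`, the
functional `g` corresponds to the operator `θ g : H → Kᵈ`, `(θ g x)(y) = g (x ⊗ y)`. -/
def thetaDual (H K : HilbSp.{u}) (g : StrongDual ℂ (H.tensor K)) :
    H →L[ℂ] StrongDual ℂ K :=
  (ContinuousLinearMap.compL ℂ K (H.tensor K) ℂ g) ∘L tmulL H K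

theorem tmulL_apply (H K : HilbSp.{u}) (x : H) (y : K) :
    tmulL H K x y = ((x ⊗ₜ[ℂ] y : H ⊗[ℂ] K) : Completion (H ⊗[ℂ] K)) := rfl

theorem theta_tmulL (H K : HilbSp.{u}) (x : H) (y : K) (f : StrongDual ℂ H) :
    theta H K (tmulL H K x y) f = f x • y := by
  rw [tmulL_apply]
  rw [theta, ContinuousLinearMap.fromCompletion_apply_coe]
  simp [sliceL]

/-! ### Tensor products of several Hilbert spaces -/

/-- The Hilbert space tensor product `H₀ ⊗ H₁ ⊗ ⋯ ⊗ Hₘ` of `m + 1` Hilbert spaces. -/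
def tens : (m : ℕ) → (Fin (m + 1) → HilbSp.{u}) → HilbSp.{u}
  | 0, H => H 0
  | m + 1, H => (H 0).tensor (tens m fun i => H i.succ)

/-- The operator `A₀ ⊗ A₁ ⊗ ⋯ ⊗ Aₘ`, multilinear in `(A₀, …, Aₘ)`. -/
def opTens : (m : ℕ) → (H : Fin (m + 1) → HilbSp.{u}) →
    MultilinearMap ℂ (fun i => H i →L[ℂ] H i) (tens m H →L[ℂ] tens m H)
  | 0, H =>
    { toFun := fun A => A 0
      map_update_add' := fun A i x y => by
        obtain rfl : i = 0 := Fin.fin_one_eq_zero i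
        simp; rfl
      map_update_smul' := fun A i c x => by
        obtain rfl : i = 0 := Fin.fin_one_eq_zero i
        simp; rfl }
  | m + 1, H =>
    LinearMap.uncurryLeft (M := fun i => H i →L[ℂ] H i)
      { toFun := fun A₀ =>
          (mapTₗ _ _ _ _ A₀).compMultilinearMap (opTens m fun i => H i.succ)
        map_add' := fun A B => by ext; simp; rfl
        map_smul' := fun c A => by ext; simp; rfl }

/-- For `v ∈ H ⊗ K`, the operator `w ↦ v ⊗ w` from `R` to `H ⊗ (K ⊗ R) = (H ⊗ K) ⊗ R`. -/
def insertL {H K : HilbSp.{u}} (R : HilbSp.{u}) (v : H.tensor K) :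
    R →L[ℂ] H.tensor (K.tensor R) :=
  LinearMap.mkContinuous
    { toFun := fun w => mapT (ContinuousLinearMap.id ℂ H) ((tmulL K R).flip w) v
      map_add' := fun w w' => by
        rw [map_add]
        exact congrArg (fun T => T v)
          (map_add (mapTₗ H H K (K.tensor R) (ContinuousLinearMap.id ℂ H)) _ _)
      map_smul' := fun c w => by
        rw [map_smul]
        exact congrArg (fun T => T v)
          (map_smul (mapTₗ H H K (K.tensor R) (ContinuousLinearMap.id ℂ H)) _ _) }
    (‖ContinuousLinearMap.id ℂ H‖ * ‖(tmulL K R).flip‖ * ‖v‖)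
    (fun w => by
      calc _ ≤ ‖mapT (ContinuousLinearMap.id ℂ H) ((tmulL K R).flip w)‖ * ‖v‖ :=
            ContinuousLinearMap.le_opNorm _ _
        _ ≤ (‖ContinuousLinearMap.id ℂ H‖ * (‖(tmulL K R).flip‖ * ‖w‖)) * ‖v‖ := by
            gcongr
            exact (norm_mapT_le _ _).trans (by gcongr; exact ContinuousLinearMap.le_opNorm _ _)
        _ = _ := by ring)

/-- For a functional `g` on `H ⊗ K`, the contraction `g ⊗ id : H ⊗ K ⊗ R → R`. It is the adjoint of
`w ↦ η ⊗ w`, where `η` is the vector with `g = ⟪η, ·⟫`. -/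
def contractL {H K : HilbSp.{u}} (R : HilbSp.{u}) (g : StrongDual ℂ (H.tensor K)) :
    H.tensor (K.tensor R) →L[ℂ] R :=
  (insertL R ((InnerProductSpace.toDual ℂ (H.tensor K)).symm g)).adjoint

theorem insertL_tmulL {H K : HilbSp.{u}} (R : HilbSp.{u}) (x : H) (y : K) (w : R) :
    insertL R (tmulL H K x y) w = tmulL H (K.tensor R) x (tmulL K R y w) := by
  change mapT (ContinuousLinearMap.id ℂ H) ((tmulL K R).flip w) (tmulL H K x y) = _
  rw [mapT, tmulL_apply, ContinuousLinearMap.completion_apply_coe]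
  rfl

theorem inner_tmulL {H K : HilbSp.{u}} (x x' : H) (y y' : K) :
    inner ℂ (tmulL H K x y) (tmulL H K x' y') = inner ℂ x x' * inner ℂ y y' := by
  rw [tmulL_apply, tmulL_apply, Completion.inner_coe, TensorProduct.inner_tmul]

theorem contractL_tmulL {H K : HilbSp.{u}} (R : HilbSp.{u}) (g : StrongDual ℂ (H.tensor K))
    (x : H) (y : K) (w : R) :
    contractL R g (tmulL H (K.tensor R) x (tmulL K R y w)) = g (tmulL H K x y) • w := by
  have key : ∀ (η : H.tensor K) (w' : R),
      inner ℂ (insertL R η w') (tmulL H (K.tensor R) x (tmulL K R y w)) =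
        inner ℂ η (tmulL H K x y) * inner ℂ w' w := by
    intro η w'
    change inner ℂ (mapT (ContinuousLinearMap.id ℂ H) ((tmulL K R).flip w') η) _ = _
    induction η using Completion.induction_on with
    | hp => exact isClosed_eq (by fun_prop) (by fun_prop)
    | ih v =>
      induction v using TensorProduct.induction_on with
      | zero => rw [Completion.coe_zero, map_zero, inner_zero_left, inner_zero_left, zero_mul]
      | add a b ha hb =>
        rw [Completion.coe_add, map_add, inner_add_left, inner_add_left, ha, hb, add_mul]
      | tmul a b =>
        change inner ℂ (insertL R (tmulL H K a b) w') _ = inner ℂ (tmulL H K a b) _ * _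
        rw [insertL_tmulL, inner_tmulL, inner_tmulL, inner_tmulL]
        ring
  refine ext_inner_left ℂ fun w' => ?_
  rw [contractL, ContinuousLinearMap.adjoint_inner_right, key, inner_smul_right,
    InnerProductSpace.toDual_symm_apply]

/-- For an even number `m + 1` of spaces, the vector `v₀ ⊗ v₂ ⊗ ⋯ ⊗ vₘ₋₁` of `H₀ ⊗ ⋯ ⊗ Hₘ`, where
`vⱼ ∈ Hⱼ ⊗ Hⱼ₊₁`. (The value for an odd number of spaces is never used.) -/
def pairVec : (m : ℕ) → (H : Fin (m + 1) → HilbSp.{u}) →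
    (∀ j : Fin m, (H j.castSucc).tensor (H j.succ)) → tens m H
  | 0, _, _ => 0
  | 1, _, v => v 0
  | m + 2, H, v =>
    insertL (tens m fun i => H i.succ.succ) (v 0)
      (pairVec m (fun i => H i.succ.succ) fun j => v j.succ.succ)

/-- For an odd number `m + 1` of spaces, the contraction
`g₀ ⊗ g₂ ⊗ ⋯ ⊗ gₘ₋₂ ⊗ id : H₀ ⊗ ⋯ ⊗ Hₘ → Hₘ`, where `gⱼ` is a functional on `Hⱼ ⊗ Hⱼ₊₁`.
(The value for an even number of spaces is never used.) -/
def pairContract : (m : ℕ) → (H : Fin (m + 1) → HilbSp.{u}) →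
    (∀ j : Fin m, StrongDual ℂ ((H j.castSucc).tensor (H j.succ))) →
      (tens m H →L[ℂ] H (Fin.last m))
  | 0, H, _ => ContinuousLinearMap.id ℂ (H 0)
  | 1, _, _ => 0
  | m + 2, H, g =>
    (pairContract m (fun i => H i.succ.succ) fun j => g j.succ.succ) ∘L
      contractL (tens m fun i => H i.succ.succ) (g 0)

/-! ### The Haagerup norm -/

/-- The operator `D^q → R^p` (Hilbert space direct sums) given by a `p × q` matrix of operators
`D → R`. -/
def matrixOp {D R : Type*} [NormedAddCommGroup D] [NormedSpace ℂ D] [NormedAddCommGroup R]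
    [NormedSpace ℂ R] {p q : ℕ} (a : Matrix (Fin p) (Fin q) (D →L[ℂ] R)) :
    PiLp 2 (fun _ : Fin q => D) →L[ℂ] PiLp 2 (fun _ : Fin p => R) :=
  ((PiLp.continuousLinearEquiv 2 ℂ fun _ : Fin p => R).symm :
      (Fin p → R) →L[ℂ] PiLp 2 (fun _ : Fin p => R)) ∘L
    ContinuousLinearMap.pi fun i => ∑ j, a i j ∘L PiLp.proj 2 (fun _ : Fin q => D) j

/-- For spaces `E₀, …, Eₘ₋₁` with matrix norms `nrm`, the Haagerup norm of `u ∈ E₀ ⊙ ⋯ ⊙ Eₘ₋₁`: the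
infimum of `‖a⁰‖ ⋯ ‖aᵐ⁻¹‖` over all representations `u = a⁰ ⊙ ⋯ ⊙ aᵐ⁻¹`, i.e.
`u = ∑ a⁰(i₀, i₁) ⊗ a¹(i₁, i₂) ⊗ ⋯ ⊗ aᵐ⁻¹(iₘ₋₁, iₘ)`, with matrices `aᵏ` of size `pₖ × pₖ₊₁` over
`Eₖ` and `p₀ = pₘ = 1`. -/
def haagerupNorm {m : ℕ} (E : Fin m → Type*) [∀ k, AddCommGroup (E k)] [∀ k, Module ℂ (E k)]
    (nrm : ∀ k {p q : ℕ}, Matrix (Fin p) (Fin q) (E k) → ℝ)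
    (u : PiTensorProduct ℂ E) : ℝ :=
  sInf {r : ℝ | ∃ (p : Fin (m + 1) → ℕ)
    (a : ∀ k : Fin m, Matrix (Fin (p k.castSucc)) (Fin (p k.succ)) (E k)),
    p 0 = 1 ∧ p (Fin.last m) = 1 ∧
    u = ∑ i : (∀ k : Fin (m + 1), Fin (p k)),
      PiTensorProduct.tprod ℂ (fun k : Fin m => a k (i k.castSucc) (i k.succ)) ∧
    r = ∏ k, nrm k (a k)}

/-! ### Concrete operator multipliers -/

/-- A tensor leg between `H` and `K`: an element of `H ⊗ K` (for `true`) or of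
`Hᵈ ⊗ Kᵈ = (H ⊗ K)ᵈ` (for `false`). -/
def Leg : Bool → HilbSp.{u} → HilbSp.{u} → Type u
  | true, H, K => H.tensor K
  | false, H, K => StrongDual ℂ (H.tensor K)

instance : ∀ b (H K : HilbSp.{u}), AddCommGroup (Leg b H K)
  | true, H, K => inferInstanceAs (AddCommGroup (H.tensor K))
  | false, H, K => inferInstanceAs (AddCommGroup (StrongDual ℂ (H.tensor K)))

instance : ∀ b (H K : HilbSp.{u}), Module ℂ (Leg b H K)
  | true, H, K => inferInstanceAs (Module ℂ (H.tensor K))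
  | false, H, K => inferInstanceAs (Module ℂ (StrongDual ℂ (H.tensor K)))

/-- The element of `H ⊗ K` given by a leg of the first kind (and `0` for the other kind). -/
def Leg.vec : ∀ {b} {H K : HilbSp.{u}}, Leg b H K → H.tensor K
  | true, _, _, z => z
  | false, _, _, _ => 0

/-- The element of `(H ⊗ K)ᵈ` given by a leg of the second kind (and `0` for the other kind). -/
def Leg.fn : ∀ {b} {H K : HilbSp.{u}}, Leg b H K → StrongDual ℂ (H.tensor K)
  | true, _, _, _ => 0
  | false, _, _, z => z

/-- The matrix norms of the opposite of the operator space structure that `H ⊗ K` (resp. `Hᵈ ⊗ Kᵈ`)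
inherits, through `θ`, from the bounded operators `Hᵈ → K` (resp. `H → Kᵈ`):
`‖(zᵢⱼ)‖ = ‖(θ zⱼᵢ)‖`. -/
def Leg.matNorm : ∀ {b} {H K : HilbSp.{u}} {p q : ℕ}, Matrix (Fin p) (Fin q) (Leg b H K) → ℝ
  | true, H, K, _, _, a => ‖matrixOp (Matrix.of fun i j => theta H K (a j i))‖
  | false, H, K, _, _, a => ‖matrixOp (Matrix.of fun i j => thetaDual H K (a j i))‖

/-- The kind of the `j`-th leg: the kinds alternate, and the last leg is in `Hₙ₋₁ ⊗ Hₙ`. -/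
def legKind {m : ℕ} (j : Fin m) : Bool := decide (Even (j.rev : ℕ))

/-- The `j`-th factor of `Γ(H₀, …, Hₘ)`. -/
abbrev GammaLeg {m : ℕ} (H : Fin (m + 1) → HilbSp.{u}) (j : Fin m) : Type u :=
  Leg (legKind j) (H j.castSucc) (H j.succ)

section

variable {k : ℕ} {H : Fin (k + 2) → HilbSp.{u}}

/-- The operator `S_φ(ζ) : H₀ᵈ → Hₖ₊₁` of an elementary tensor `ζ ∈ Γ(H₀, …, Hₖ₊₁)`, for an even
number of spaces. If `ζ = ξ₀₁ ⊗ η₁₂ᵈ ⊗ ξ₂₃ ⊗ ⋯ ⊗ ξₖ,ₖ₊₁`, the vector `φ (ξ₀₁ ⊗ ξ₂₃ ⊗ ⋯ ⊗ ξₖ,ₖ₊₁)` is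
contracted with `η₁₂ᵈ, η₃₄ᵈ, …`, and `θ` is applied to the resulting vector of `H₀ ⊗ Hₖ₊₁`. -/
def schurOpEven (φ : tens (k + 1) H →L[ℂ] tens (k + 1) H) (ζ : ∀ j, GammaLeg H j) :
    StrongDual ℂ (H 0) →L[ℂ] H (Fin.last (k + 1)) :=
  theta (H 0) (H (Fin.last (k + 1)))
    (mapT (ContinuousLinearMap.id ℂ (H 0))
      (pairContract k (fun i => H i.succ) fun j => (ζ j.succ).fn)
      (φ (pairVec (k + 1) H fun j => (ζ j).vec)))

/-- The operator `S_φ(ζ) : H₀ → Hₖ₊₁` of an elementary tensor `ζ ∈ Γ(H₀, …, Hₖ₊₁)`, for an odd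
number of spaces. If `ζ = η₀₁ᵈ ⊗ ξ₁₂ ⊗ η₂₃ᵈ ⊗ ⋯ ⊗ ξₖ,ₖ₊₁`, then `S_φ(ζ) x` is the contraction of
`φ (x ⊗ ξ₁₂ ⊗ ⋯ ⊗ ξₖ,ₖ₊₁)` with `η₀₁ᵈ, η₂₃ᵈ, …`. -/
def schurOpOdd (φ : tens (k + 1) H →L[ℂ] tens (k + 1) H) (ζ : ∀ j, GammaLeg H j) :
    H 0 →L[ℂ] H (Fin.last (k + 1)) :=
  pairContract (k + 1) H (fun j => (ζ j).fn) ∘L φ ∘L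
    (tmulL (H 0) (tens k fun i => H i.succ)).flip
      (pairVec k (fun i => H i.succ) fun j => (ζ j.succ).vec)

/-- The operator norm of `S_φ(ζ)`, where `ζ = ∑ᵣ ζᵣ` is a finite sum of elementary tensors and
`S_φ(ζ) = ∑ᵣ S_φ(ζᵣ)`. -/
def schurOpNorm (φ : tens (k + 1) H →L[ℂ] tens (k + 1) H) {s : ℕ}
    (ζ : Fin s → ∀ j, GammaLeg H j) : ℝ :=
  if Even (k + 2) then ‖∑ r, schurOpEven φ (ζ r)‖ else ‖∑ r, schurOpOdd φ (ζ r)‖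

/-- `φ ∈ B(H₀ ⊗ ⋯ ⊗ Hₖ₊₁)` is a concrete (operator) multiplier: for some `C > 0`,
`‖S_φ(ζ)‖ ≤ C ‖ζ‖_h` for each `ζ ∈ Γ(H₀, …, Hₖ₊₁)`. -/
def IsConcreteMultiplier (φ : tens (k + 1) H →L[ℂ] tens (k + 1) H) : Prop :=
  ∃ C : ℝ, 0 < C ∧ ∀ (s : ℕ) (ζ : Fin s → ∀ j, GammaLeg H j),
    schurOpNorm φ ζ ≤
      C * haagerupNorm (GammaLeg H) (fun _ => Leg.matNorm) (∑ r, PiTensorProduct.tprod ℂ (ζ r))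

end

/-! ### The minimal tensor product of C*-algebras -/

section

variable {m : ℕ} {A : Fin (m + 1) → Type u} [∀ i, NonUnitalCStarAlgebra (A i)]

/-- The map `π₀ ⊗ ⋯ ⊗ πₘ` on the algebraic tensor product `A₀ ⊙ ⋯ ⊙ Aₘ`. -/
def algRep {H : Fin (m + 1) → HilbSp.{u}} (π : ∀ i, A i →⋆ₙₐ[ℂ] (H i →L[ℂ] H i)) :
    PiTensorProduct ℂ A →ₗ[ℂ] (tens m H →L[ℂ] tens m H) :=
  PiTensorProduct.lift ((opTens m H).compLinearMap fun i =>
    { toFun := π i, map_add' := map_add (π i), map_smul' := map_smul (π i) })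

/-- The minimal C*-norm `sup ‖(π₀ ⊗ ⋯ ⊗ πₘ)(u)‖` on `A₀ ⊙ ⋯ ⊙ Aₘ`, the supremum being over all
families of representations `πᵢ` of `Aᵢ` on Hilbert spaces. -/
def minNorm (u : PiTensorProduct ℂ A) : ℝ :=
  sSup {r : ℝ | ∃ (H : Fin (m + 1) → HilbSp.{u}) (π : ∀ i, A i →⋆ₙₐ[ℂ] (H i →L[ℂ] H i)),
    r = ‖algRep π u‖}

theorem opTens_norm_le : ∀ (m : ℕ) (H : Fin (m + 1) → HilbSp.{u}) (B : ∀ i, H i →L[ℂ] H i),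
    ‖opTens m H B‖ ≤ ∏ i, ‖B i‖
  | 0, H, B => by simp [opTens]; exact le_refl _
  | m + 1, H, B => by
    rw [Fin.prod_univ_succ]
    refine (norm_mapT_le (B 0) (opTens m (fun i => H i.succ) fun i => B i.succ)).trans ?_
    gcongr
    exact opTens_norm_le m _ _

theorem minNorm_bdd (u : PiTensorProduct ℂ A) :
    BddAbove {r : ℝ | ∃ (H : Fin (m + 1) → HilbSp.{u}) (π : ∀ i, A i →⋆ₙₐ[ℂ] (H i →L[ℂ] H i)),
      r = ‖algRep π u‖} := by
  induction u using PiTensorProduct.induction_on with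
  | smul_tprod c a =>
    refine ⟨‖c‖ * ∏ i, ‖a i‖, ?_⟩
    rintro _ ⟨H, π, rfl⟩
    rw [map_smul, norm_smul]
    gcongr
    rw [algRep, PiTensorProduct.lift.tprod]
    refine (opTens_norm_le m H _).trans ?_
    gcongr with i
    exact NonUnitalStarAlgHom.norm_apply_le (π i) (a i)
  | add x y hx hy =>
    obtain ⟨c, hc⟩ := hx
    obtain ⟨d, hd⟩ := hy
    refine ⟨c + d, ?_⟩
    rintro _ ⟨H, π, rfl⟩
    rw [map_add]
    exact (norm_add_le _ _).trans (add_le_add (hc ⟨H, π, rfl⟩) (hd ⟨H, π, rfl⟩))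

theorem norm_algRep_le_minNorm {H : Fin (m + 1) → HilbSp.{u}}
    (π : ∀ i, A i →⋆ₙₐ[ℂ] (H i →L[ℂ] H i)) (u : PiTensorProduct ℂ A) :
    ‖algRep π u‖ ≤ minNorm u :=
  le_csSup (minNorm_bdd u) ⟨H, π, rfl⟩

theorem minNorm_nonneg (u : PiTensorProduct ℂ A) : 0 ≤ minNorm u :=
  Real.sSup_nonneg (by rintro _ ⟨H, π, rfl⟩; exact norm_nonneg _)

theorem minNorm_le {u : PiTensorProduct ℂ A} {c : ℝ} (hc : 0 ≤ c)
    (h : ∀ (H : Fin (m + 1) → HilbSp.{u}) (π : ∀ i, A i →⋆ₙₐ[ℂ] (H i →L[ℂ] H i)),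
      ‖algRep π u‖ ≤ c) : minNorm u ≤ c :=
  Real.sSup_le (by rintro _ ⟨H, π, rfl⟩; exact h H π) hc

variable (A) in
/-- The minimal C*-norm as a seminorm. -/
def minSeminorm : Seminorm ℂ (PiTensorProduct ℂ A) :=
  Seminorm.ofSMulLE minNorm
    (le_antisymm (minNorm_le le_rfl fun H π => by simp) (minNorm_nonneg _))
    (fun u v => minNorm_le (add_nonneg (minNorm_nonneg u) (minNorm_nonneg v)) fun H π => by
      rw [map_add]
      exact (norm_add_le _ _).trans
        (add_le_add (norm_algRep_le_minNorm π u) (norm_algRep_le_minNorm π v)))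
    (fun c u => minNorm_le (mul_nonneg (norm_nonneg c) (minNorm_nonneg u)) fun H π => by
      rw [map_smul, norm_smul]
      gcongr
      exact norm_algRep_le_minNorm π u)

variable (A) in
/-- The algebraic tensor product `A₀ ⊙ ⋯ ⊙ Aₘ`, equipped with the minimal C*-norm. -/
def AlgTensor : Type u := PiTensorProduct ℂ A

instance : AddCommGroup (AlgTensor A) := inferInstanceAs (AddCommGroup (PiTensorProduct ℂ A))

instance : Module ℂ (AlgTensor A) := inferInstanceAs (Module ℂ (PiTensorProduct ℂ A))

variable (A) in
/-- The identity map, regarding an element of `A₀ ⊙ ⋯ ⊙ Aₘ` as one of the normed space. -/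
def AlgTensor.of : PiTensorProduct ℂ A ≃ₗ[ℂ] AlgTensor A := LinearEquiv.refl ℂ (PiTensorProduct ℂ A)

instance : SeminormedAddCommGroup (AlgTensor A) :=
  AddGroupSeminorm.toSeminormedAddCommGroup
    ((minSeminorm A).comp (AlgTensor.of A).symm.toLinearMap).toAddGroupSeminorm

instance : NormedSpace ℂ (AlgTensor A) where
  norm_smul_le c u :=
    (map_smul_eq_mul ((minSeminorm A).comp (AlgTensor.of A).symm.toLinearMap) c u).le

variable (A) in
/-- The minimal tensor product `A₀ ⊗ ⋯ ⊗ Aₘ`: the completion of `A₀ ⊙ ⋯ ⊙ Aₘ` in the minimal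
C*-norm. -/
abbrev MinTensor : Type u := Completion (AlgTensor A)

/-- The elementary tensor `a₀ ⊗ ⋯ ⊗ aₘ` in the minimal tensor product. -/
def MinTensor.tprod (a : ∀ i, A i) : MinTensor A :=
  AlgTensor.of A (PiTensorProduct.tprod ℂ a)

/-- The representation `π₀ ⊗ ⋯ ⊗ πₘ` of the minimal tensor product, the continuous extension of
`a₀ ⊗ ⋯ ⊗ aₘ ↦ π₀(a₀) ⊗ ⋯ ⊗ πₘ(aₘ)`. -/
def tensorRep {H : Fin (m + 1) → HilbSp.{u}} (π : ∀ i, A i →⋆ₙₐ[ℂ] (H i →L[ℂ] H i)) :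
    MinTensor A →L[ℂ] (tens m H →L[ℂ] tens m H) :=
  ContinuousLinearMap.fromCompletion
    (LinearMap.mkContinuous (algRep π ∘ₗ (AlgTensor.of A).symm.toLinearMap) 1 fun u => by
      rw [one_mul]; exact norm_algRep_le_minNorm π _)

end

/-- `φ ∈ A₀ ⊗ ⋯ ⊗ Aₖ₊₁` is a `π₀, …, πₖ₊₁`-multiplier: `(π₀ ⊗ ⋯ ⊗ πₖ₊₁)(φ)` is a concrete
multiplier. -/
def IsMultiplier {k : ℕ} {A : Fin (k + 2) → Type u} [∀ i, NonUnitalCStarAlgebra (A i)]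
    {H : Fin (k + 2) → HilbSp.{u}} (π : ∀ i, A i →⋆ₙₐ[ℂ] (H i →L[ℂ] H i))
    (φ : MinTensor A) : Prop :=
  IsConcreteMultiplier (tensorRep π φ)

/-! ### The algebra `L^∞(μ)` and its representation on `L²(μ)` -/

section
variable {X : Type*} [MeasurableSpace X] {μ : Measure X}

instance : Mul (Lp ℂ ∞ μ) := ⟨fun f g => f • g⟩

theorem Linf.coeFn_mul (f g : Lp ℂ ∞ μ) : (f * g : Lp ℂ ∞ μ) =ᵐ[μ] fun x => f x * g x :=
  Lp.coeFn_lpSMul f g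

/-- `L^∞(μ)` with pointwise multiplication. -/
instance : NonUnitalNormedRing (Lp ℂ ∞ μ) :=
  { (inferInstance : NormedAddCommGroup (Lp ℂ ∞ μ)), (inferInstance : Mul (Lp ℂ ∞ μ)) with
    left_distrib := fun f g h => Lp.add_smul f g h
    right_distrib := fun f g h => Lp.smul_add f g h
    zero_mul := fun f => Lp.zero_smul ℂ ∞ f
    mul_zero := fun f => Lp.smul_zero ℂ ∞ f
    mul_assoc := fun f g h => by
      apply Lp.ext
      filter_upwards [Linf.coeFn_mul (f * g) h, Linf.coeFn_mul f g, Linf.coeFn_mul f (g * h),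
        Linf.coeFn_mul g h] with x h1 h2 h3 h4
      rw [h1, h2, h3, h4, mul_assoc]
    norm_mul_le := fun f g => Lp.norm_smul_le f g }

/-- The involution of `L^∞(μ)` is pointwise complex conjugation. -/
instance : StarRing (Lp ℂ ∞ μ) where
  star_involutive := star_involutive
  star_mul f g := by
    apply Lp.ext
    filter_upwards [Lp.coeFn_star (f * g), Linf.coeFn_mul f g, Linf.coeFn_mul (star g) (star f),
      Lp.coeFn_star f, Lp.coeFn_star g] with x h1 h2 h3 h4 h5
    rw [h1, h3, h4, h5, Pi.star_apply, h2, star_mul]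
    rfl
  star_add f g := by
    apply Lp.ext
    filter_upwards [Lp.coeFn_star (f + g), Lp.coeFn_add f g, Lp.coeFn_add (star f) (star g),
      Lp.coeFn_star f, Lp.coeFn_star g] with x h1 h2 h3 h4 h5
    rw [h1, h3, Pi.star_apply, h2, Pi.add_apply, Pi.add_apply, h4, h5, star_add]
    rfl

instance : NonUnitalCStarAlgebra (Lp ℂ ∞ μ) where
  smul_assoc c f g := Lp.smul_assoc c f g
  smul_comm c f g := Lp.smul_comm c f g
  star_smul c f := by
    apply Lp.ext
    filter_upwards [Lp.coeFn_star (c • f), Lp.coeFn_smul c f, Lp.coeFn_smul (star c) (star f),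
      Lp.coeFn_star f] with x h1 h2 h3 h4
    rw [h1, h3, Pi.star_apply, h2, Pi.smul_apply, Pi.smul_apply, h4, star_smul]
    rfl
  norm_mul_self_le f := by
    have h1 : eLpNorm f ∞ μ ^ 2 ≤ eLpNorm (star f * f : Lp ℂ ∞ μ) ∞ μ := by
      have h2 : eLpNorm f ∞ μ ≤ eLpNorm (star f * f : Lp ℂ ∞ μ) ∞ μ ^ (2⁻¹ : ℝ) := by
        rw [eLpNorm_exponent_top, eLpNorm_exponent_top]
        apply eLpNormEssSup_le_of_ae_enorm_bound
        filter_upwards [Linf.coeFn_mul (star f) f, Lp.coeFn_star f,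
          enorm_ae_le_eLpNormEssSup (star f * f : Lp ℂ ∞ μ) μ] with x h1 h2 h3
        rw [h1, h2, enorm_mul, Pi.star_apply, ← ofReal_norm (star (f x)), norm_star, ofReal_norm,
          ← pow_two] at h3
        calc ‖f x‖ₑ = (‖f x‖ₑ ^ 2) ^ (2⁻¹ : ℝ) := by
              rw [← ENNReal.rpow_natCast, ← ENNReal.rpow_mul]; norm_num
          _ ≤ _ := ENNReal.rpow_le_rpow h3 (by norm_num)
      calc _ ≤ (eLpNorm (star f * f : Lp ℂ ∞ μ) ∞ μ ^ (2⁻¹ : ℝ)) ^ 2 := by gcongr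
        _ = _ := by rw [← ENNReal.rpow_natCast, ← ENNReal.rpow_mul]; norm_num
    rw [Lp.norm_def, Lp.norm_def, ← pow_two, ← ENNReal.toReal_pow]
    exact ENNReal.toReal_mono (Lp.eLpNorm_ne_top _) h1

/-- The operator `M_a` of multiplication by `a ∈ L^∞(μ)` on `L²(μ)`. -/
def mulOp (a : Lp ℂ ∞ μ) : Lp ℂ 2 μ →L[ℂ] Lp ℂ 2 μ :=
  LinearMap.mkContinuous
    { toFun := fun ξ => a • ξ
      map_add' := fun ξ η => Lp.add_smul a ξ η
      map_smul' := fun c ξ => (Lp.smul_comm c a ξ).symm }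
    ‖a‖ fun ξ => Lp.norm_smul_le a ξ

theorem coeFn_mulOp (a : Lp ℂ ∞ μ) (ξ : Lp ℂ 2 μ) : mulOp a ξ =ᵐ[μ] fun x => a x * ξ x :=
  Lp.coeFn_lpSMul a ξ

variable (μ) in
/-- The canonical representation of `L^∞(μ)` on `L²(μ)` by multiplication operators. -/
def mulRep : Lp ℂ ∞ μ →⋆ₙₐ[ℂ] (Lp ℂ 2 μ →L[ℂ] Lp ℂ 2 μ) where
  toFun := mulOp
  map_smul' c a := ContinuousLinearMap.ext fun ξ => Lp.smul_assoc c a ξ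
  map_zero' := ContinuousLinearMap.ext fun ξ => Lp.zero_smul ℂ ∞ ξ
  map_add' a b := ContinuousLinearMap.ext fun ξ => Lp.smul_add a b ξ
  map_mul' a b := ContinuousLinearMap.ext fun ξ => by
    apply Lp.ext
    filter_upwards [coeFn_mulOp (a * b) ξ, coeFn_mulOp a (mulOp b ξ), coeFn_mulOp b ξ,
      Linf.coeFn_mul a b] with x h1 h2 h3 h4
    change mulOp (a * b) ξ x = mulOp a (mulOp b ξ) x
    rw [h1, h2, h3, h4, mul_assoc]
  map_star' a := by
    rw [ContinuousLinearMap.star_eq_adjoint, ContinuousLinearMap.eq_adjoint_iff]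
    intro ξ η
    rw [L2.inner_def, L2.inner_def]
    apply integral_congr_ae
    filter_upwards [coeFn_mulOp (star a) ξ, coeFn_mulOp a η, Lp.coeFn_star a] with x h1 h2 h3
    rw [h1, h2, h3]
    simp
    ring
end

/-! ### Multidimensional Schur multipliers -/

section
variable {X Y : Type*} [MeasurableSpace X] [MeasurableSpace Y] {μ : Measure X} {ν : Measure Y}
  [SigmaFinite μ] [SigmaFinite ν]

theorem kernel_lintegral_le (f : Lp ℂ 2 (μ.prod ν)) (ξ : Lp ℂ 2 μ) :
    ∫⁻ y, (∫⁻ x, ‖f (x, y) * ξ x‖ₑ ∂μ) ^ (2 : ℝ) ∂ν ≤ (‖f‖ₑ * ‖ξ‖ₑ) ^ (2 : ℝ) := by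
  have hf := (Lp.stronglyMeasurable f).measurable
  have hξ := (Lp.stronglyMeasurable ξ).measurable
  have e1 : ‖f‖ₑ ^ (2 : ℝ) = ∫⁻ y, ∫⁻ x, ‖f (x, y)‖ₑ ^ (2 : ℝ) ∂μ ∂ν := by
    rw [Lp.enorm_def, eLpNorm_eq_lintegral_rpow_enorm_toReal (by norm_num) (by norm_num),
      ← ENNReal.rpow_mul, lintegral_prod_symm' _ (by fun_prop)]
    norm_num
  have e2 : ‖ξ‖ₑ ^ (2 : ℝ) = ∫⁻ x, ‖ξ x‖ₑ ^ (2 : ℝ) ∂μ := by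
    rw [Lp.enorm_def, eLpNorm_eq_lintegral_rpow_enorm_toReal (by norm_num) (by norm_num),
      ← ENNReal.rpow_mul]
    norm_num
  rw [ENNReal.mul_rpow_of_nonneg _ _ (by norm_num), e1, e2, ← lintegral_mul_const _ (by fun_prop)]
  gcongr with y
  have h := ENNReal.lintegral_mul_le_Lp_mul_Lq μ Real.HolderConjugate.two_two
    (f := fun x => ‖f (x, y)‖ₑ) (g := fun x => ‖ξ x‖ₑ) (by fun_prop) (by fun_prop)
  calc (∫⁻ x, ‖f (x, y) * ξ x‖ₑ ∂μ) ^ (2 : ℝ)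
      = (∫⁻ x, ((fun x => ‖f (x, y)‖ₑ) * fun x => ‖ξ x‖ₑ) x ∂μ) ^ (2 : ℝ) := by
        simp [enorm_mul]
    _ ≤ _ := ENNReal.rpow_le_rpow h (by norm_num)
    _ = _ := by
        rw [ENNReal.mul_rpow_of_nonneg _ _ (by norm_num), ← ENNReal.rpow_mul, ← ENNReal.rpow_mul]
        norm_num

theorem kernel_eLpNorm_le (f : Lp ℂ 2 (μ.prod ν)) (ξ : Lp ℂ 2 μ) :
    eLpNorm (fun y => ∫ x, f (x, y) * ξ x ∂μ) 2 ν ≤ ‖f‖ₑ * ‖ξ‖ₑ := by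
  rw [eLpNorm_eq_lintegral_rpow_enorm_toReal (by norm_num) (by norm_num)]
  have : (∫⁻ y, ‖∫ x, f (x, y) * ξ x ∂μ‖ₑ ^ (2 : ℝ) ∂ν) ≤ (‖f‖ₑ * ‖ξ‖ₑ) ^ (2 : ℝ) := by
    refine le_trans ?_ (kernel_lintegral_le f ξ)
    gcongr with y
    exact enorm_integral_le_lintegral_enorm _
  calc _ ≤ ((‖f‖ₑ * ‖ξ‖ₑ) ^ (2 : ℝ)) ^ (1 / (2 : ℝ)) := by
        simpa using ENNReal.rpow_le_rpow this (by norm_num : (0 : ℝ) ≤ 1 / 2)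
    _ = _ := by rw [← ENNReal.rpow_mul]; norm_num

theorem kernel_memLp (f : Lp ℂ 2 (μ.prod ν)) (ξ : Lp ℂ 2 μ) :
    MemLp (fun y => ∫ x, f (x, y) * ξ x ∂μ) 2 ν := by
  refine ⟨?_, (kernel_eLpNorm_le f ξ).trans_lt (by finiteness)⟩
  have hf := (Lp.stronglyMeasurable f)
  have hξ := (Lp.stronglyMeasurable ξ)
  exact (StronglyMeasurable.integral_prod_right' (f := fun p : Y × X => f (p.2, p.1) * ξ p.2)
    ((hf.comp_measurable measurable_swap).mul (hξ.comp_measurable measurable_snd))).aestronglyMeasurable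

theorem kernel_integrable (f : Lp ℂ 2 (μ.prod ν)) (ξ : Lp ℂ 2 μ) :
    ∀ᵐ y ∂ν, Integrable (fun x => f (x, y) * ξ x) μ := by
  have hf := (Lp.stronglyMeasurable f)
  have hξ := (Lp.stronglyMeasurable ξ)
  have hm : Measurable fun p : Y × X => ‖f (p.2, p.1) * ξ p.2‖ₑ :=
    ((hf.measurable.comp measurable_swap).mul (hξ.measurable.comp measurable_snd)).enorm
  have h : ∫⁻ y, (∫⁻ x, ‖f (x, y) * ξ x‖ₑ ∂μ) ^ (2 : ℝ) ∂ν ≠ ∞ :=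
    ((kernel_lintegral_le f ξ).trans_lt
      (ENNReal.rpow_lt_top_of_nonneg (by norm_num) (by finiteness))).ne
  filter_upwards [ae_lt_top (hm.lintegral_prod_right'.pow_const _) h] with y hy
  refine ⟨((hf.comp_measurable (measurable_id.prodMk measurable_const)).mul hξ).aestronglyMeasurable, ?_⟩
  rw [ENNReal.rpow_lt_top_iff_of_pos (by norm_num)] at hy
  exact hy

theorem ae_ae_swap {p : X × Y → Prop} (h : ∀ᵐ z ∂μ.prod ν, p z) :
    ∀ᵐ y ∂ν, ∀ᵐ x ∂μ, p (x, y) := by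
  have h' : ∀ᵐ z ∂ν.prod μ, p z.swap :=
    Measure.measurePreserving_swap.quasiMeasurePreserving.ae h
  exact Measure.ae_ae_of_ae_prod h'

/-- The Hilbert–Schmidt operator `T_f : L²(μ) → L²(ν)` with kernel `f ∈ L²(μ × ν)`,
`(T_f ξ)(y) = ∫ f(x, y) ξ(x) dμ(x)`. -/
def kernelOp (f : Lp ℂ 2 (μ.prod ν)) : Lp ℂ 2 μ →L[ℂ] Lp ℂ 2 ν :=
  LinearMap.mkContinuous
    { toFun := fun ξ => (kernel_memLp f ξ).toLp fun y => ∫ x, f (x, y) * ξ x ∂μ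
      map_add' := fun ξ η => by
        rw [← MemLp.toLp_add]
        apply MemLp.toLp_congr
        filter_upwards [kernel_integrable f ξ, kernel_integrable f η] with y h1 h2
        rw [Pi.add_apply, ← integral_add h1 h2]
        apply integral_congr_ae
        filter_upwards [Lp.coeFn_add ξ η] with x hx
        rw [hx, Pi.add_apply, mul_add]
      map_smul' := fun c ξ => by
        rw [RingHom.id_apply, ← MemLp.toLp_const_smul]
        apply MemLp.toLp_congr
        refine Filter.Eventually.of_forall fun y => ?_
        rw [Pi.smul_apply, ← integral_smul]
        apply integral_congr_ae
        filter_upwards [Lp.coeFn_smul c ξ] with x hx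
        rw [hx, Pi.smul_apply, smul_eq_mul, smul_eq_mul]
        ring }
    ‖f‖ fun ξ => by
      refine (Lp.norm_toLp _ (kernel_memLp f ξ)).trans_le ?_
      refine (ENNReal.toReal_mono (by finiteness) (kernel_eLpNorm_le f ξ)).trans_eq ?_
      simp [ENNReal.toReal_mul]

theorem coeFn_kernelOp (f : Lp ℂ 2 (μ.prod ν)) (ξ : Lp ℂ 2 μ) :
    kernelOp f ξ =ᵐ[ν] fun y => ∫ x, f (x, y) * ξ x ∂μ :=
  MemLp.coeFn_toLp (kernel_memLp f ξ)

end

section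

variable {k : ℕ} {X : Fin (k + 2) → Type u}

/-- The point `(x₀, y₁, …, yₖ, xₖ₊₁)` of `X₀ × ⋯ × Xₖ₊₁`. -/
def fillIn (x₀ : X 0) (y : ∀ i : Fin k, X i.castSucc.succ) (x₁ : X (Fin.last (k + 1))) :
    ∀ i, X i :=
  Fin.cons x₀ (Fin.snoc (α := fun i : Fin (k + 1) => X i.succ) y x₁)

variable [∀ i, MeasurableSpace (X i)] (μ : ∀ i, Measure (X i))

/-- `S_φ(f₀, …, fₖ)(x₀, xₖ₊₁) = ∫ φ(x₀, …, xₖ₊₁) f₀(x₀, x₁) f₁(x₁, x₂) ⋯ fₖ(xₖ, xₖ₊₁) dx₁ ⋯ dxₖ`. -/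
def schurKernel (φ : Lp ℂ ∞ (Measure.pi μ))
    (f : ∀ j : Fin (k + 1), Lp ℂ 2 ((μ j.castSucc).prod (μ j.succ)))
    (p : X 0 × X (Fin.last (k + 1))) : ℂ :=
  ∫ y : (∀ i : Fin k, X i.castSucc.succ),
    φ (fillIn p.1 y p.2) *
      ∏ j : Fin (k + 1), f j (fillIn p.1 y p.2 j.castSucc, fillIn p.1 y p.2 j.succ)
    ∂(Measure.pi fun i : Fin k => μ i.castSucc.succ)

/-- `φ ∈ L^∞(X₀ × ⋯ × Xₖ₊₁)` is a Schur multiplier: for some `C > 0`, `‖S_φ(Φ)‖_op ≤ C ‖Φ‖_h` for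
each `Φ = ∑ᵣ f₀ʳ ⊗ ⋯ ⊗ fₖʳ` in `L²(X₀ × X₁) ⊙ ⋯ ⊙ L²(Xₖ × Xₖ₊₁)`. Here
`S_φ(Φ) = ∑ᵣ S_φ(f₀ʳ, …, fₖʳ)` belongs to `L²(X₀ × Xₖ₊₁)`, its operator norm is that of the
associated Hilbert–Schmidt operator, and the `L²`-spaces carry the opposite of the operator space
structure coming from `f ↦ T_f`, i.e. `‖(fᵢⱼ)‖ = ‖(T_{fⱼᵢ})‖`. -/
def IsSchurMultiplier [∀ i, SigmaFinite (μ i)] (φ : Lp ℂ ∞ (Measure.pi μ)) : Prop :=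
  ∃ C : ℝ, 0 < C ∧
    ∀ (s : ℕ) (f : Fin s → ∀ j : Fin (k + 1), Lp ℂ 2 ((μ j.castSucc).prod (μ j.succ))),
      ∃ h : Lp ℂ 2 ((μ 0).prod (μ (Fin.last (k + 1)))),
        h =ᵐ[(μ 0).prod (μ (Fin.last (k + 1)))] (fun p => ∑ r, schurKernel μ φ (f r) p) ∧
        ‖kernelOp h‖ ≤
          C * haagerupNorm (fun j : Fin (k + 1) => Lp ℂ 2 ((μ j.castSucc).prod (μ j.succ)))
            (fun _ _ _ a => ‖matrixOp (Matrix.of fun i j => kernelOp (a j i))‖)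
            (∑ r, PiTensorProduct.tprod ℂ (f r))

end

/-- The Hilbert space `L²(μ)`. -/
abbrev l2Sp {X : Type u} [MeasurableSpace X] (μ : Measure X) : HilbSp.{u} := ⟨Lp ℂ 2 μ⟩

end OperatorMultiplier

end

open OperatorMultiplier

/-!
Two statements are proved: the minimal norm on `L^∞(X₀) ⊙ ⋯ ⊙ L^∞(Xₘ)` is the norm of the
associated function of several variables, and, for a function `φ` in the minimal tensor product, the
Schur multiplier map and the operator multiplier map of `φ` coincide under isometric
identifications of their domains and ranges.

*The minimal norm.* Every element of the algebraic tensor product is a limit of elements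
`∑ᵣ (φ r 0 ∘ g₀) ⊗ ⋯ ⊗ (φ r m ∘ gₘ)`, where the measurable functions `gᵢ` have finitely many values
(`stepFn_induction`). Such an element is constant on each of the cells where `gᵢ = vᵢ` for all `i`.
In any representation it becomes a combination of mutually orthogonal projections, one for each
cell, which vanish for cells of measure zero, so its norm is at most the largest absolute value on
cells of positive measure (`norm_algRep_stepTensor_le`); the `L^∞`-norm is equal to that value.
Conversely, on the spaces `L²(Xᵢ)` the values on cells of positive measure are
eigenvalues, with eigenvectors the elementary tensors of indicator functions
(`norm_stepValue_le_norm_algRep`). By continuity, the minimal norm is the `L^∞`-norm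
(`minNorm_eq_norm_prodLin`), and `minEmbed` is the resulting isometry.

*The multipliers.* The bilinear pairing `∫ ξ η` identifies `L²(X)` with its dual (`pairing`), and
`L²(X) ⊗ L²(Y)` is `L²(X × Y)` (`tensorL2`). Under these identifications both `θ` and its dual
version take a kernel `f` to the operator `T_f` (`theta_pairing`, `thetaDual_legFn`). Hence each
tensor leg is `L²(Xⱼ × Xⱼ₊₁)` with its matrix norms (`matNorm_legEquiv`), and the Haagerup norms
agree. For an elementary tensor `φ = a₀ ⊗ ⋯ ⊗ aₖ₊₁`, both multiplier maps take `f₀ ⊗ ⋯ ⊗ fₖ` to the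
composition `M_{aₖ₊₁} T_{fₖ} M_{aₖ} ⋯ T_{f₀} M_{a₀}`: on the Schur side by Fubini's theorem
(`kernelOp_schurLp_prodLinf`), on the operator side by induction on the number of spaces in steps of
two (`evenE_mulOp`, `oddE_mulOp`). Both maps are continuous in `φ`, the Schur side by the
Cauchy–Schwarz inequality (`schurLp`), so they agree on the whole minimal tensor product
(`schurOpEven_legs`, `schurOpOdd_legs`).
-/

noncomputable section

namespace OperatorMultiplier

universe u

/-! ### Contractions and the map `theta` -/

/-- A closed additive property of vectors of `H ⊗ K` holds everywhere if it holds for elementary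
tensors. -/
theorem tensor_induction {H K : HilbSp.{u}} {p : H.tensor K → Prop} (hc : IsClosed {w | p w})
    (h0 : p 0) (hadd : ∀ v w, p v → p w → p (v + w)) (ht : ∀ x y, p (tmulL H K x y))
    (w : H.tensor K) : p w := by
  induction w using Completion.induction_on with
  | hp => exact hc
  | ih v =>
    induction v using TensorProduct.induction_on with
    | zero => exact h0
    | add a b ha hb => rw [Completion.coe_add]; exact hadd _ _ ha hb
    | tmul a b => exact ht a b

theorem tensor_ext {H K : HilbSp.{u}} {E : Type*} [NormedAddCommGroup E] [NormedSpace ℂ E]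
    {S T : H.tensor K →L[ℂ] E} (h : ∀ x y, S (tmulL H K x y) = T (tmulL H K x y)) : S = T := by
  refine ContinuousLinearMap.ext fun w => ?_
  induction w using tensor_induction with
  | hc => exact isClosed_eq S.continuous T.continuous
  | h0 => simp
  | hadd v w hv hw => rw [map_add, map_add, hv, hw]
  | ht x y => exact h x y

theorem mapT_tmulL {H H' K K' : HilbSp.{u}} (A : H →L[ℂ] H') (B : K →L[ℂ] K') (x : H) (y : K) :
    mapT A B (tmulL H K x y) = tmulL H' K' (A x) (B y) := by
  rw [mapT, tmulL_apply, ContinuousLinearMap.completion_apply_coe]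
  rfl

theorem mapT_mapT {H H' H'' K K' K'' : HilbSp.{u}} (A' : H' →L[ℂ] H'') (B' : K' →L[ℂ] K'')
    (A : H →L[ℂ] H') (B : K →L[ℂ] K') (w : H.tensor K) :
    mapT A' B' (mapT A B w) = mapT (A' ∘L A) (B' ∘L B) w :=
  congrArg (fun T => T w) (tensor_ext (S := mapT A' B' ∘L mapT A B) (T := mapT (A' ∘L A) (B' ∘L B))
    fun x y => by
      change mapT A' B' (mapT A B (tmulL H K x y)) = _
      rw [mapT_tmulL, mapT_tmulL, mapT_tmulL]
      rfl)

theorem mapT_id {H K : HilbSp.{u}} (z : H.tensor K) :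
    mapT (ContinuousLinearMap.id ℂ H) (ContinuousLinearMap.id ℂ K) z = z :=
  congrArg (fun T => T z) (tensor_ext (S := mapT (ContinuousLinearMap.id ℂ H)
    (ContinuousLinearMap.id ℂ K)) (T := ContinuousLinearMap.id ℂ _) fun x y => mapT_tmulL _ _ x y)

theorem norm_tmulL {H K : HilbSp.{u}} (x : H) (y : K) : ‖tmulL H K x y‖ = ‖x‖ * ‖y‖ := by
  rw [tmulL_apply, Completion.norm_coe, TensorProduct.norm_tmul]

theorem theta_mapT {H H' K K' : HilbSp.{u}} (A : H →L[ℂ] H') (B : K →L[ℂ] K') (w : H.tensor K)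
    (f : StrongDual ℂ H') : theta H' K' (mapT A B w) f = B (theta H K w (f ∘L A)) := by
  refine congrArg (fun T => T w) (tensor_ext (S := (theta H' K').flip f ∘L mapT A B)
    (T := B ∘L (theta H K).flip (f ∘L A)) fun x y => ?_)
  change theta H' K' (mapT A B (tmulL H K x y)) f = B (theta H K (tmulL H K x y) (f ∘L A))
  rw [mapT_tmulL, theta_tmulL, theta_tmulL, map_smul]
  rfl

theorem thetaDual_apply {H K : HilbSp.{u}} (g : StrongDual ℂ (H.tensor K)) (x : H) (y : K) :
    thetaDual H K g x y = g (tmulL H K x y) := rfl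

theorem contractL_tmulL_left {H K : HilbSp.{u}} (R : HilbSp.{u}) (g : StrongDual ℂ (H.tensor K))
    (x : H) (w : K.tensor R) :
    contractL R g (tmulL H (K.tensor R) x w) = theta K R w (thetaDual H K g x) := by
  refine congrArg (fun T => T w) (tensor_ext (S := contractL R g ∘L tmulL H (K.tensor R) x)
    (T := (theta K R).flip (thetaDual H K g x)) fun y r => ?_)
  change contractL R g (tmulL H (K.tensor R) x (tmulL K R y r)) =
    theta K R (tmulL K R y r) (thetaDual H K g x)
  rw [contractL_tmulL, theta_tmulL, thetaDual_apply]

/-! ### The pairing of `L²(μ)` with itself and the identification of `L²(μ) ⊗ L²(ν)` -/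

section

variable {X : Type*} [MeasurableSpace X] {μ : Measure X}

variable (μ) in
/-- Complex conjugation on `L²(μ)`. -/
def conjL2 : Lp ℂ 2 μ ≃ₗᵢ⋆[ℂ] Lp ℂ 2 μ where
  toFun := star
  invFun := star
  left_inv := star_star
  right_inv := star_star
  map_add' f g := by
    apply Lp.ext
    filter_upwards [Lp.coeFn_star (f + g), Lp.coeFn_add f g, Lp.coeFn_add (star f) (star g),
      Lp.coeFn_star f, Lp.coeFn_star g] with x h1 h2 h3 h4 h5
    rw [h1, h3, Pi.star_apply, h2, Pi.add_apply, Pi.add_apply, h4, h5, star_add]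
    rfl
  map_smul' c f := by
    apply Lp.ext
    filter_upwards [Lp.coeFn_star (c • f), Lp.coeFn_smul c f, Lp.coeFn_smul (star c) (star f),
      Lp.coeFn_star f] with x h1 h2 h3 h4
    rw [h1, starRingEnd_apply, h3, Pi.star_apply, h2, Pi.smul_apply,
      Pi.smul_apply, h4, star_smul]
    rfl
  norm_map' f := by
    change ‖star f‖ = ‖f‖
    rw [Lp.norm_def, Lp.norm_def]
    congr 1
    refine eLpNorm_congr_norm_ae ?_
    filter_upwards [Lp.coeFn_star f] with x hx
    rw [hx, Pi.star_apply, norm_star]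

variable (μ) in
/-- The linear isometry of `L²(μ)` onto its dual given by the bilinear pairing
`(ξ, η) ↦ ∫ ξ η dμ`. -/
def pairing : Lp ℂ 2 μ ≃ₗᵢ[ℂ] StrongDual ℂ (Lp ℂ 2 μ) :=
  (conjL2 μ).trans (InnerProductSpace.toDual ℂ (Lp ℂ 2 μ))

theorem pairing_apply (ξ η : Lp ℂ 2 μ) : pairing μ ξ η = ∫ x, ξ x * η x ∂μ := by
  change inner ℂ (star ξ) η = _
  rw [L2.inner_def]
  apply integral_congr_ae
  filter_upwards [Lp.coeFn_star ξ] with x hx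
  rw [hx]
  simp [mul_comm]

/-- Multiplication operators are symmetric for the bilinear pairing. -/
theorem pairing_mulOp (a : Lp ℂ ∞ μ) (ξ : Lp ℂ 2 μ) :
    pairing μ ξ ∘L mulOp a = pairing μ (mulOp a ξ) := by
  ext η
  rw [ContinuousLinearMap.comp_apply, pairing_apply, pairing_apply]
  apply integral_congr_ae
  filter_upwards [coeFn_mulOp a ξ, coeFn_mulOp a η] with x h1 h2
  rw [h1, h2]
  ring

end

section

variable {X Y : Type*} [MeasurableSpace X] [MeasurableSpace Y] {μ : Measure X} {ν : Measure Y}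

theorem memLp_two_mul_prod (ξ : Lp ℂ 2 μ) (η : Lp ℂ 2 ν) :
    MemLp (fun p : X × Y => ξ p.1 * η p.2) 2 (μ.prod ν) := by
  have hξ := Lp.stronglyMeasurable ξ
  have hη := Lp.stronglyMeasurable η
  have hm : AEStronglyMeasurable (fun p : X × Y => ξ p.1 * η p.2) (μ.prod ν) :=
    ((hξ.comp_measurable measurable_fst).mul
      (hη.comp_measurable measurable_snd)).aestronglyMeasurable
  rw [memLp_two_iff_integrable_sq_norm hm]
  have h := ((memLp_two_iff_integrable_sq_norm hξ.aestronglyMeasurable).1 (Lp.memLp ξ)).mul_prod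
    ((memLp_two_iff_integrable_sq_norm hη.aestronglyMeasurable).1 (Lp.memLp η))
  simpa only [norm_mul, mul_pow] using h

/-- The function `(x, y) ↦ ξ(x) η(y)` as an element of `L²(μ × ν)`. -/
def prodL2 (ξ : Lp ℂ 2 μ) (η : Lp ℂ 2 ν) : Lp ℂ 2 (μ.prod ν) :=
  (memLp_two_mul_prod ξ η).toLp _

theorem coeFn_prodL2 (ξ : Lp ℂ 2 μ) (η : Lp ℂ 2 ν) :
    prodL2 ξ η =ᵐ[μ.prod ν] fun p => ξ p.1 * η p.2 := MemLp.coeFn_toLp _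

/-- `prodL2` as a bilinear map. -/
def prodL2ₗ (μ : Measure X) (ν : Measure Y) [SigmaFinite μ] [SigmaFinite ν] :
    Lp ℂ 2 μ →ₗ[ℂ] Lp ℂ 2 ν →ₗ[ℂ] Lp ℂ 2 (μ.prod ν) :=
  LinearMap.mk₂ ℂ prodL2
    (fun ξ ξ' η => by
      apply Lp.ext
      filter_upwards [coeFn_prodL2 (ξ + ξ') η, Lp.coeFn_add (prodL2 ξ η) (prodL2 ξ' η),
        coeFn_prodL2 ξ η, coeFn_prodL2 ξ' η,
        Measure.quasiMeasurePreserving_fst.ae (Lp.coeFn_add ξ ξ')] with p h1 h2 h3 h4 h5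
      rw [h1, h2, Pi.add_apply, h3, h4, h5, Pi.add_apply, add_mul])
    (fun c ξ η => by
      apply Lp.ext
      filter_upwards [coeFn_prodL2 (c • ξ) η, Lp.coeFn_smul c (prodL2 ξ η), coeFn_prodL2 ξ η,
        Measure.quasiMeasurePreserving_fst.ae (Lp.coeFn_smul c ξ)] with p h1 h2 h3 h5
      rw [h1, h2, Pi.smul_apply, h3, h5, Pi.smul_apply, smul_mul_assoc])
    (fun ξ η η' => by
      apply Lp.ext
      filter_upwards [coeFn_prodL2 ξ (η + η'), Lp.coeFn_add (prodL2 ξ η) (prodL2 ξ η'),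
        coeFn_prodL2 ξ η, coeFn_prodL2 ξ η',
        Measure.quasiMeasurePreserving_snd.ae (Lp.coeFn_add η η')] with p h1 h2 h3 h4 h5
      rw [h1, h2, Pi.add_apply, h3, h4, h5, Pi.add_apply, mul_add])
    (fun c ξ η => by
      apply Lp.ext
      filter_upwards [coeFn_prodL2 ξ (c • η), Lp.coeFn_smul c (prodL2 ξ η), coeFn_prodL2 ξ η,
        Measure.quasiMeasurePreserving_snd.ae (Lp.coeFn_smul c η)] with p h1 h2 h3 h5
      rw [h1, h2, Pi.smul_apply, h3, h5, Pi.smul_apply, mul_smul_comm])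

variable [SigmaFinite μ] [SigmaFinite ν]

theorem inner_prodL2 (ξ ξ' : Lp ℂ 2 μ) (η η' : Lp ℂ 2 ν) :
    inner ℂ (prodL2 ξ η) (prodL2 ξ' η') = inner ℂ ξ ξ' * inner ℂ η η' := by
  rw [L2.inner_def, L2.inner_def, L2.inner_def, ← integral_prod_mul]
  apply integral_congr_ae
  filter_upwards [coeFn_prodL2 ξ η, coeFn_prodL2 ξ' η'] with p h1 h2
  rw [h1, h2]
  simp
  ring

/-- Product functions span a dense subspace of `L²(μ × ν)`: rectangles of finite measure form a
π-system that generates the product σ-algebra. -/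
theorem eq_zero_of_inner_prodL2_eq_zero (f : Lp ℂ 2 (μ.prod ν))
    (h : ∀ ξ η, inner ℂ (prodL2 ξ η) f = (0 : ℂ)) : f = 0 := by
  have hrect : ∀ (S : Set X) (T : Set Y), MeasurableSet S → MeasurableSet T → μ S ≠ ∞ →
      ν T ≠ ∞ → ∫ p in S ×ˢ T, f p ∂μ.prod ν = 0 := by
    intro S T hS hT hμ hν
    rw [← h (indicatorConstLp 2 hS hμ 1) (indicatorConstLp 2 hT hν 1), L2.inner_def,
      ← integral_indicator (hS.prod hT)]
    apply integral_congr_ae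
    filter_upwards [coeFn_prodL2 (indicatorConstLp 2 hS hμ (1 : ℂ)) (indicatorConstLp 2 hT hν 1),
      Measure.quasiMeasurePreserving_fst.ae (indicatorConstLp_coeFn (p := 2) (hs := hS) (hμs := hμ)
        (c := (1 : ℂ))),
      Measure.quasiMeasurePreserving_snd.ae (indicatorConstLp_coeFn (p := 2) (hs := hT) (hμs := hν)
        (c := (1 : ℂ)))] with p h1 h2 h3
    rw [h1, h2, h3]
    by_cases hx : p.1 ∈ S <;> by_cases hy : p.2 ∈ T <;> simp [Set.indicator, hx, hy]
  have hrestr : ∀ n, f =ᵐ[(μ.prod ν).restrict (spanningSets μ n ×ˢ spanningSets ν n)] 0 := by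
    intro n
    set S := spanningSets μ n
    set T := spanningSets ν n
    have hS : MeasurableSet S := measurableSet_spanningSets μ n
    have hT : MeasurableSet T := measurableSet_spanningSets ν n
    have hμ : μ S ≠ ∞ := (measure_spanningSets_lt_top μ n).ne
    have hν : ν T ≠ ∞ := (measure_spanningSets_lt_top ν n).ne
    have hfin : (μ.prod ν) (S ×ˢ T) ≠ ∞ := by
      rw [Measure.prod_prod]; exact ENNReal.mul_ne_top hμ hν
    have : IsFiniteMeasure ((μ.prod ν).restrict (S ×ˢ T)) := ⟨by simpa using hfin.lt_top⟩
    have hint : Integrable f ((μ.prod ν).restrict (S ×ˢ T)) :=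
      ((Lp.memLp f).restrict _).integrable (by norm_num)
    refine hint.ae_eq_zero_of_forall_setIntegral_eq_zero fun E hE _ => ?_
    induction E, hE using MeasurableSpace.induction_on_inter
      (generateFrom_prod (α := X) (β := Y)).symm isPiSystem_prod with
    | empty => simp
    | basic E hE =>
      obtain ⟨A, hA, B, hB, rfl⟩ := hE
      have hA : MeasurableSet A := hA
      have hB : MeasurableSet B := hB
      rw [Measure.restrict_restrict (hA.prod hB), Set.prod_inter_prod]
      exact hrect _ _ (hA.inter hS) (hB.inter hT)
        (measure_ne_top_of_subset Set.inter_subset_right hμ)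
        (measure_ne_top_of_subset Set.inter_subset_right hν)
    | compl E hE ih =>
      have := integral_add_compl hE hint
      rw [ih (measure_lt_top _ _), zero_add] at this
      rw [this]
      exact hrect S T hS hT hμ hν
    | iUnion F hd hm ih =>
      rw [integral_iUnion hm hd hint.integrableOn]
      simp [fun i => ih i (measure_lt_top _ _)]
  apply Lp.ext
  refine Filter.EventuallyEq.trans ?_ (Lp.coeFn_zero ℂ 2 _).symm
  have hU : ⋃ n, spanningSets μ n ×ˢ spanningSets ν n = Set.univ := by
    rw [Set.iUnion_prod_of_monotone (monotone_spanningSets μ) (monotone_spanningSets ν),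
      iUnion_spanningSets, iUnion_spanningSets, Set.univ_prod_univ]
  have h2 := (ae_restrict_iUnion_iff (μ := μ.prod ν)
    (fun n => spanningSets μ n ×ˢ spanningSets ν n) (fun p => f p = 0)).2 hrestr
  rw [hU, Measure.restrict_univ] at h2
  exact h2

end

section

variable {X Y : Type u} [MeasurableSpace X] [MeasurableSpace Y] (μ : Measure X) (ν : Measure Y)
  [SigmaFinite μ] [SigmaFinite ν]

/-- The isometry of `L²(μ) ⊙ L²(ν)` into `L²(μ × ν)`. -/
def algTensorL2 : (l2Sp μ ⊗[ℂ] l2Sp ν) →ₗᵢ[ℂ] Lp ℂ 2 (μ.prod ν) :=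
  (TensorProduct.lift (prodL2ₗ μ ν)).isometryOfInner fun u v => by
    induction u using TensorProduct.induction_on with
    | zero => simp
    | add a b ha hb => rw [map_add, inner_add_left, inner_add_left, ha, hb]
    | tmul a b =>
      induction v using TensorProduct.induction_on with
      | zero => simp
      | add c d hc hd => rw [map_add, inner_add_right, inner_add_right, hc, hd]
      | tmul c d =>
        rw [TensorProduct.inner_tmul, TensorProduct.lift.tmul, TensorProduct.lift.tmul]
        exact inner_prodL2 a c b d

/-- The isometry of `L²(μ) ⊗ L²(ν)` into `L²(μ × ν)`. -/
def tensorL2ᵢ : (l2Sp μ).tensor (l2Sp ν) →ₗᵢ[ℂ] Lp ℂ 2 (μ.prod ν) where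
  toLinearMap := ((algTensorL2 μ ν).toContinuousLinearMap.fromCompletion).toLinearMap
  norm_map' w := by
    change ‖(algTensorL2 μ ν).toContinuousLinearMap.fromCompletion w‖ = ‖w‖
    induction w using Completion.induction_on with
    | hp => exact isClosed_eq (ContinuousLinearMap.continuous _).norm continuous_norm
    | ih v =>
      rw [ContinuousLinearMap.fromCompletion_apply_coe, Completion.norm_coe]
      exact (algTensorL2 μ ν).norm_map v

theorem tensorL2ᵢ_tmulL (ξ : Lp ℂ 2 μ) (η : Lp ℂ 2 ν) :
    tensorL2ᵢ μ ν (tmulL (l2Sp μ) (l2Sp ν) ξ η) = prodL2 ξ η := by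
  change (algTensorL2 μ ν).toContinuousLinearMap.fromCompletion _ = _
  rw [tmulL_apply, ContinuousLinearMap.fromCompletion_apply_coe]
  rfl

/-- The unitary of `L²(μ) ⊗ L²(ν)` onto `L²(μ × ν)` that takes `ξ ⊗ η` to `ξ(x) η(y)`. -/
def tensorL2 : (l2Sp μ).tensor (l2Sp ν) ≃ₗᵢ[ℂ] Lp ℂ 2 (μ.prod ν) :=
  LinearIsometryEquiv.ofSurjective (tensorL2ᵢ μ ν) (by
    have hc : IsComplete (Set.range (tensorL2ᵢ μ ν)) :=
      (tensorL2ᵢ μ ν).isometry.isUniformInducing.isComplete_range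
    have : CompleteSpace (LinearMap.range (tensorL2ᵢ μ ν).toLinearMap) :=
      completeSpace_coe_iff_isComplete.2 hc
    refine (LinearMap.range_eq_top (f := (tensorL2ᵢ μ ν).toLinearMap)).1 ?_
    rw [← Submodule.orthogonal_eq_bot_iff, Submodule.eq_bot_iff]
    intro f hf
    refine eq_zero_of_inner_prodL2_eq_zero f fun ξ η => ?_
    rw [← tensorL2ᵢ_tmulL]
    exact (Submodule.mem_orthogonal _ _).1 hf _ ⟨_, rfl⟩)

theorem tensorL2_tmulL (ξ : Lp ℂ 2 μ) (η : Lp ℂ 2 ν) :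
    tensorL2 μ ν (tmulL (l2Sp μ) (l2Sp ν) ξ η) = prodL2 ξ η := tensorL2ᵢ_tmulL μ ν ξ η

end

/-! ### Hilbert–Schmidt operators with a kernel in `L²(μ × ν)` -/

section

variable {X Y : Type*} [MeasurableSpace X] [MeasurableSpace Y] {μ : Measure X} {ν : Measure Y}
  [SigmaFinite μ] [SigmaFinite ν]

theorem norm_kernelOp_le (f : Lp ℂ 2 (μ.prod ν)) : ‖kernelOp f‖ ≤ ‖f‖ :=
  LinearMap.mkContinuous_norm_le _ (norm_nonneg _) _

variable (μ ν) in
/-- The map `f ↦ T_f` as a continuous linear map. -/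
def kernelOpL : Lp ℂ 2 (μ.prod ν) →L[ℂ] (Lp ℂ 2 μ →L[ℂ] Lp ℂ 2 ν) :=
  LinearMap.mkContinuous
    { toFun := kernelOp
      map_add' := fun f g => by
        ext1 ξ
        apply Lp.ext
        filter_upwards [coeFn_kernelOp (f + g) ξ, coeFn_kernelOp f ξ, coeFn_kernelOp g ξ,
          Lp.coeFn_add (kernelOp f ξ) (kernelOp g ξ), kernel_integrable f ξ,
          kernel_integrable g ξ, ae_ae_swap (Lp.coeFn_add f g)] with y h1 h2 h3 h4 h5 h6 h7
        rw [add_apply, h1, h4, Pi.add_apply, h2, h3, ← integral_add h5 h6]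
        apply integral_congr_ae
        filter_upwards [h7] with x hx
        rw [hx, Pi.add_apply, add_mul]
      map_smul' := fun c f => by
        ext1 ξ
        apply Lp.ext
        filter_upwards [coeFn_kernelOp (c • f) ξ, coeFn_kernelOp f ξ,
          Lp.coeFn_smul c (kernelOp f ξ), ae_ae_swap (Lp.coeFn_smul c f)] with y h1 h2 h4 h7
        rw [smul_apply, h1, RingHom.id_apply, h4, Pi.smul_apply, h2,
          ← integral_smul]
        apply integral_congr_ae
        filter_upwards [h7] with x hx
        rw [hx, Pi.smul_apply, smul_mul_assoc] }
    1 fun f => by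
      rw [one_mul]
      exact norm_kernelOp_le f

theorem kernelOp_prodL2 (ξ ξ' : Lp ℂ 2 μ) (η : Lp ℂ 2 ν) :
    kernelOp (prodL2 ξ η) ξ' = pairing μ ξ' ξ • η := by
  apply Lp.ext
  filter_upwards [coeFn_kernelOp (prodL2 ξ η) ξ', Lp.coeFn_smul (pairing μ ξ' ξ) η,
    ae_ae_swap (coeFn_prodL2 ξ η)] with y h1 h2 h3
  rw [h1, h2, Pi.smul_apply, pairing_apply, smul_eq_mul, ← integral_mul_const]
  apply integral_congr_ae
  filter_upwards [h3] with x hx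
  rw [hx]
  ring

theorem pairing_prodL2 (f : Lp ℂ 2 (μ.prod ν)) (ξ : Lp ℂ 2 μ) (η : Lp ℂ 2 ν) :
    pairing (μ.prod ν) f (prodL2 ξ η) = pairing ν (kernelOp f ξ) η := by
  rw [pairing_apply, pairing_apply]
  have hint : Integrable (fun p => f p * prodL2 ξ η p) (μ.prod ν) :=
    (Lp.memLp f).integrable_mul (Lp.memLp (prodL2 ξ η))
  rw [integral_prod_symm _ hint]
  apply integral_congr_ae
  filter_upwards [coeFn_kernelOp f ξ, ae_ae_swap (coeFn_prodL2 ξ η)] with y h1 h2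
  rw [h1, ← integral_mul_const]
  apply integral_congr_ae
  filter_upwards [h2] with x hx
  rw [hx]
  ring

end

section

variable {X Y : Type u} [MeasurableSpace X] [MeasurableSpace Y] {μ : Measure X} {ν : Measure Y}
  [SigmaFinite μ] [SigmaFinite ν]

/-- Under the identifications `pairing` and `tensorL2`, `theta` is the map from kernels to
operators. -/
theorem theta_pairing (w : (l2Sp μ).tensor (l2Sp ν)) (ξ : Lp ℂ 2 μ) :
    theta (l2Sp μ) (l2Sp ν) w (pairing μ ξ) = kernelOp (tensorL2 μ ν w) ξ := by
  refine congrArg (fun T => T w) (tensor_ext (S := (theta (l2Sp μ) (l2Sp ν)).flip (pairing μ ξ))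
    (T := (kernelOpL μ ν).flip ξ ∘L
      ((tensorL2 μ ν).toContinuousLinearEquiv : _ →L[ℂ] Lp ℂ 2 (μ.prod ν))) fun x y => ?_)
  change theta (l2Sp μ) (l2Sp ν) (tmulL _ _ x y) (pairing μ ξ) =
    kernelOp (tensorL2 μ ν (tmulL (l2Sp μ) (l2Sp ν) x y)) ξ
  rw [theta_tmulL, tensorL2_tmulL, kernelOp_prodL2]

/-- The functional on `L²(μ) ⊗ L²(ν)` of integration against `f ∈ L²(μ × ν)`. -/
def legFn : Lp ℂ 2 (μ.prod ν) ≃ₗ[ℂ] StrongDual ℂ ((l2Sp μ).tensor (l2Sp ν)) :=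
  (pairing (μ.prod ν)).toLinearEquiv ≪≫ₗ
    ((tensorL2 μ ν).symm.toContinuousLinearEquiv.arrowCongr
      (ContinuousLinearEquiv.refl ℂ ℂ)).toLinearEquiv

/-- Under the identifications `pairing` and `legFn`, `thetaDual` is the map from kernels to
operators. -/
theorem thetaDual_legFn (f : Lp ℂ 2 (μ.prod ν)) (ξ : Lp ℂ 2 μ) :
    thetaDual (l2Sp μ) (l2Sp ν) (legFn f) ξ = pairing ν (kernelOp f ξ) := by
  ext η
  rw [← pairing_prodL2, ← tensorL2_tmulL, thetaDual_apply]
  rfl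

end

/-! ### Operator multiplier maps at elementary tensors -/

/-- The type of vectors of a Hilbert space, as a function of the bundled space. The definitions
`El`, `CL`, `Dl`, `Fn` and `tensorSp` name the types and spaces in the recursion over `tens`. Two
such types are compared through their arguments, without unfolding the normed space structures of
iterated tensor products, and equalities of bundled spaces can be substituted in them. -/
def El (T : HilbSp.{u}) : Type u := T

/-- The bounded operators between two Hilbert spaces. -/
def CL (T E : HilbSp.{u}) : Type u := T →L[ℂ] E

/-- The dual of a Hilbert space. -/
def Dl (T : HilbSp.{u}) : Type u := StrongDual ℂ T

/-- The dual of the tensor product of two Hilbert spaces. -/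
def Fn (H K : HilbSp.{u}) : Type u := StrongDual ℂ (H.tensor K)

/-- The Hilbert space tensor product. -/
def tensorSp (H K : HilbSp.{u}) : HilbSp.{u} := H.tensor K

section

variable {H H' K K' R T T' T'' E : HilbSp.{u}}

/-- The value of an operator at a vector. -/
def CL.app (A : CL T E) (x : El T) : El E := (show T →L[ℂ] E from A) x

/-- The composition of two operators. -/
def CL.comp (A : CL T' E) (B : CL T T') : CL T E :=
  ContinuousLinearMap.comp (show T' →L[ℂ] E from A) (show T →L[ℂ] T' from B)

/-- The identity operator. -/
def CL.id (T : HilbSp.{u}) : CL T T := ContinuousLinearMap.id ℂ T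

/-- The composition of a functional and an operator. -/
def Dl.comp (f : Dl T) (A : CL T T) : Dl T :=
  ContinuousLinearMap.comp (show StrongDual ℂ T from f) (show T →L[ℂ] T from A)

/-- The elementary tensor of two vectors. -/
def tmulE (x : El H) (y : El K) : El (tensorSp H K) := tmulL H K x y

/-- The tensor product of two operators. -/
def mapE (A : CL H H') (B : CL K K') (w : El (tensorSp H K)) : El (tensorSp H' K') := mapT A B w

/-- The operator `theta w`. -/
def thetaE (w : El (tensorSp H K)) (f : Dl H) : El K := theta H K w f

/-- The operator `thetaDual g`. -/
def thetaDualE (g : Fn H K) (x : El H) : Dl K := thetaDual H K g x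

/-- The vector `v ⊗ w` of `H ⊗ (K ⊗ R)`. -/
def insertE (v : El (tensorSp H K)) (w : El R) : El (tensorSp H (tensorSp K R)) := insertL R v w

/-- The contraction `g ⊗ id`. -/
def contractE (R : HilbSp.{u}) (g : Fn H K) : CL (tensorSp H (tensorSp K R)) R := contractL R g

theorem CL.app_comp (A : CL T' E) (B : CL T T') (x : El T) : (A.comp B).app x = A.app (B.app x) :=
  rfl

theorem mapE_id (z : El (tensorSp H K)) : mapE (CL.id H) (CL.id K) z = z := mapT_id z

theorem mapE_tmulE (A : CL H H') (B : CL K K') (x : El H) (y : El K) :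
    mapE A B (tmulE x y) = tmulE (A.app x) (B.app y) := mapT_tmulL A B x y

theorem thetaE_mapE (A : CL H H) (B : CL K K') (w : El (tensorSp H K)) (f : Dl H) :
    thetaE (mapE A B w) f = B.app (thetaE w (f.comp A)) := theta_mapT A B w f

theorem thetaE_insertE (v : El (tensorSp H K)) (w : El R) (f : Dl H) :
    thetaE (insertE v w) f = tmulE (thetaE v f) w :=
  theta_mapT (ContinuousLinearMap.id ℂ H) ((tmulL K R).flip w) v f

theorem app_contractE_tmulE (g : Fn H K) (x : El H) (w : El (tensorSp K R)) :
    (contractE R g).app (tmulE x w) = thetaE w (thetaDualE g x) := contractL_tmulL_left R g x w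

/-- The identity map between two Hilbert spaces that are equal. -/
def castE (h : T = T') (x : El T) : El T' := h ▸ x

theorem castE_of_heq (h : T = T') {x : El T} {x' : El T'} (hx : HEq x' x) : castE h x = x' := by
  subst h
  exact (eq_of_heq hx).symm

theorem app_castE_of_heq (h : T = T') {A : CL T E} {A' : CL T' E} (hA : HEq A' A) (z : El T) :
    A'.app (castE h z) = A.app z := by
  subst h
  rw [eq_of_heq hA]
  rfl

theorem app_castE_eq_castE_app (h : T = T') {B : CL T T} {B' : CL T' T'} (hB : HEq B' B)
    (z : El T) : B'.app (castE h z) = castE h (B.app z) := by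
  subst h
  rw [eq_of_heq hB]
  rfl

theorem castE_symm_castE (h : T = T') (z : El T) : castE h.symm (castE h z) = z := by
  subst h
  rfl

/-- Contracting `x ⊗ w` with `g` in its first two factors is applying `theta w` to the functional
`thetaDual g x`. The spaces `T' = K ⊗ T` and `T'' = H ⊗ T'` are given by equations. -/
theorem app_castE_tmulE (h : tensorSp K T = T') (h' : tensorSp H T' = T'') (g : Fn H K)
    (P : CL T E) (Q : CL T'' E)
    (hQ : ∀ z, Q.app (castE ((congrArg (tensorSp H) h).trans h') z) =
      P.app ((contractE T g).app z)) (x : El H) (w : El T') :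
    Q.app (castE h' (tmulE x w)) =
      thetaE (mapE (CL.id K) P (castE h.symm w)) (thetaDualE g x) := by
  subst h h'
  refine (hQ _).trans ?_
  rw [app_contractE_tmulE, thetaE_mapE]
  rfl

/-- Applying `A ⊗ B ⊗ C` to `v ⊗ w`, then an operator `Q` to all factors but the first, and then
`theta` at `f`, amounts to applying `Q` to the elementary tensor of `B (theta v (f ∘ A))` and
`C w`. -/
theorem thetaE_castE_insertE (h : tensorSp K T = T') (h' : tensorSp H T' = T'') {A : CL H H}
    {B : CL K K} {C : CL T T} {C' : CL T' T'} {C'' : CL T'' T''}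
    (hC' : ∀ z, C'.app (castE h z) = castE h (mapE B C z))
    (hC'' : ∀ z, C''.app (castE h' z) = castE h' (mapE A C' z)) (v : El (tensorSp H K))
    (w : El T) {u : El T''} (hu : u = castE ((congrArg (tensorSp H) h).trans h') (insertE v w))
    (Q : CL T' E) (f : Dl H) :
    thetaE (mapE (CL.id H) Q (castE h'.symm (C''.app u))) f =
      Q.app (castE h (tmulE (B.app (thetaE v (f.comp A))) (C.app w))) := by
  subst h h' hu
  have e1 : C''.app (insertE v w) = mapE A C' (insertE v w) := hC'' (insertE v w)
  have e2 : ∀ z, C'.app z = mapE B C z := hC'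
  change thetaE (mapE (CL.id H) Q (C''.app (insertE v w))) f = Q.app (tmulE _ _)
  rw [e1, thetaE_mapE, thetaE_mapE, e2, thetaE_insertE, mapE_tmulE]
  rfl

end

theorem CL.comp_heq {T T₀ T' E : HilbSp.{u}} (h : T₀ = T) {P : CL T' E} {L : CL T T'}
    {L₀ : CL T₀ T'} (hL : HEq L L₀) : HEq (CL.comp P L) (CL.comp P L₀) := by
  subst h
  rw [eq_of_heq hL]

theorem tens_succ (m : ℕ) (H : Fin (m + 2) → HilbSp.{u}) :
    tensorSp (H 0) (tens m fun i => H i.succ) = tens (m + 1) H := (tens.eq_2 m H).symm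

theorem tens_add_two (m : ℕ) (H : Fin (m + 3) → HilbSp.{u}) :
    tensorSp (H 0) (tensorSp (H (Fin.succ 0)) (tens m fun i => H i.succ.succ)) = tens (m + 2) H :=
  (congrArg (tensorSp (H 0)) (tens_succ m fun i => H i.succ)).trans (tens_succ (m + 1) H)

/-- The tensor product of a family of operators. -/
def opTensE (m : ℕ) (H : Fin (m + 1) → HilbSp.{u}) (A : ∀ i, CL (H i) (H i)) :
    CL (tens m H) (tens m H) := opTens m H A

/-- `pairVec` for families of vectors of type `El`. -/
def pairVecE (m : ℕ) (H : Fin (m + 1) → HilbSp.{u})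
    (v : ∀ j : Fin m, El (tensorSp (H j.castSucc) (H j.succ))) : El (tens m H) := pairVec m H v

/-- `pairContract` for families of functionals of type `Fn`. -/
def pairContractE (m : ℕ) (H : Fin (m + 1) → HilbSp.{u})
    (g : ∀ j : Fin m, Fn (H j.castSucc) (H j.succ)) : CL (tens m H) (H (Fin.last m)) :=
  pairContract m H g

/-- The first vector of a family indexed by pairs of adjacent spaces. -/
def headVec {m : ℕ} {H : Fin (m + 2) → HilbSp.{u}}
    (v : ∀ j : Fin (m + 1), El (tensorSp (H j.castSucc) (H j.succ))) :
    El (tensorSp (H 0) (H (Fin.succ 0))) := v 0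

/-- The first functional of a family indexed by pairs of adjacent spaces. -/
def headFn {m : ℕ} {H : Fin (m + 2) → HilbSp.{u}}
    (g : ∀ j : Fin (m + 1), Fn (H j.castSucc) (H j.succ)) : Fn (H 0) (H (Fin.succ 0)) := g 0

theorem app_opTensE_castE (m : ℕ) (H : Fin (m + 2) → HilbSp.{u}) (A : ∀ i, CL (H i) (H i))
    (z : El (tensorSp (H 0) (tens m fun i => H i.succ))) :
    (opTensE (m + 1) H A).app (castE (tens_succ m H) z) =
      castE (tens_succ m H) (mapE (A 0) (opTensE m (fun i => H i.succ) fun i => A i.succ) z) := by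
  refine app_castE_eq_castE_app (tens_succ m H)
    (B := show CL _ _ from mapT (A 0) (opTens m (fun i => H i.succ) fun i => A i.succ)) ?_ z
  exact HEq.rfl

section

-- The recursion equations below hold by unfolding `pairVec` and `pairContract` only.
attribute [local irreducible] insertL contractL tensorSp

theorem pairVec_add_two (m : ℕ) (H : Fin (m + 3) → HilbSp.{u})
    (v : ∀ j : Fin (m + 2), (H j.castSucc).tensor (H j.succ)) :
    @HEq (El (tens (m + 2) H)) (pairVec (m + 2) H v)
      (El ((H 0).tensor ((H (Fin.succ 0)).tensor (tens m fun i => H i.succ.succ))))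
      (insertL (tens m fun i => H i.succ.succ) (v 0)
        (pairVec m (fun i => H i.succ.succ) fun j => v j.succ.succ)) := HEq.rfl

theorem pairContract_add_two (m : ℕ) (H : Fin (m + 3) → HilbSp.{u})
    (g : ∀ j : Fin (m + 2), StrongDual ℂ ((H j.castSucc).tensor (H j.succ))) :
    @Eq (CL (tens (m + 2) H) (H (Fin.last (m + 2)))) (pairContract (m + 2) H g)
      (CL.comp (T := tens (m + 2) H) (T' := tens m fun i => H i.succ.succ)
        (E := H (Fin.last (m + 2)))
        (pairContract m (fun i => H i.succ.succ) fun j => g j.succ.succ)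
        (contractL (tens m fun i => H i.succ.succ) (g 0))) := (rfl)

end

theorem contractE_heq (m : ℕ) (H : Fin (m + 3) → HilbSp.{u})
    (g : ∀ j : Fin (m + 2), StrongDual ℂ ((H j.castSucc).tensor (H j.succ))) :
    @HEq (CL (tens (m + 2) H) (tens m fun i => H i.succ.succ))
      (contractL (tens m fun i => H i.succ.succ) (g 0))
      (CL (tensorSp (H 0) (tensorSp (H (Fin.succ 0)) (tens m fun i => H i.succ.succ)))
        (tens m fun i => H i.succ.succ))
      (contractE (tens m fun i => H i.succ.succ) (headFn g)) :=
  HEq.rfl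

theorem pairVecE_add_two (m : ℕ) (H : Fin (m + 3) → HilbSp.{u})
    (v : ∀ j : Fin (m + 2), El (tensorSp (H j.castSucc) (H j.succ))) :
    pairVecE (m + 2) H v = castE (tens_add_two m H)
      (insertE (headVec v) (pairVecE m (fun i => H i.succ.succ) fun j => v j.succ.succ)) :=
  (castE_of_heq (tens_add_two m H) (pairVec_add_two m H v)).symm

theorem app_pairContractE_castE (m : ℕ) (H : Fin (m + 3) → HilbSp.{u})
    (g : ∀ j : Fin (m + 2), Fn (H j.castSucc) (H j.succ))
    (z : El (tensorSp (H 0) (tensorSp (H (Fin.succ 0)) (tens m fun i => H i.succ.succ)))) :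
    (pairContractE (m + 2) H g).app (castE (tens_add_two m H) z) =
      (pairContractE m (fun i => H i.succ.succ) fun j => g j.succ.succ).app
        ((contractE (tens m fun i => H i.succ.succ) (headFn g)).app z) := by
  have h : @HEq (CL (tens (m + 2) H) (H (Fin.last (m + 2)))) (pairContractE (m + 2) H g)
      (CL (tensorSp (H 0) (tensorSp (H (Fin.succ 0)) (tens m fun i => H i.succ.succ)))
        (H (Fin.last (m + 2))))
      (CL.comp (T' := tens m fun i => H i.succ.succ) (E := H (Fin.last (m + 2)))
        (pairContractE m (fun i => H i.succ.succ) fun j => g j.succ.succ)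
        (contractE (tens m fun i => H i.succ.succ) (headFn g))) :=
    (heq_of_eq (pairContract_add_two m H g)).trans
      (CL.comp_heq (tens_add_two m H) (contractE_heq m H g))
  exact (app_castE_of_heq (tens_add_two m H) h z).trans (CL.app_comp _ _ z)

section

variable {k : ℕ}

/-- The operator `S_φ` of an elementary tensor, for an even number of spaces, in terms of a vector
and a functional for each pair of adjacent spaces, of which only every other one is used. -/
def evenE (H : Fin (k + 2) → HilbSp.{u}) (φ : CL (tens (k + 1) H) (tens (k + 1) H))
    (v : ∀ j : Fin (k + 1), El (tensorSp (H j.castSucc) (H j.succ)))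
    (g : ∀ j : Fin (k + 1), Fn (H j.castSucc) (H j.succ)) (f : Dl (H 0)) :
    El (H (Fin.last (k + 1))) :=
  thetaE (mapE (CL.id (H 0)) (pairContractE k (fun i => H i.succ) fun j => g j.succ)
    (castE (tens_succ k H).symm (φ.app (pairVecE (k + 1) H v)))) f

/-- The operator `S_φ` of an elementary tensor, for an odd number of spaces, in terms of a vector
and a functional for each pair of adjacent spaces, of which only every other one is used. -/
def oddE (H : Fin (k + 2) → HilbSp.{u}) (φ : CL (tens (k + 1) H) (tens (k + 1) H))
    (v : ∀ j : Fin (k + 1), El (tensorSp (H j.castSucc) (H j.succ)))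
    (g : ∀ j : Fin (k + 1), Fn (H j.castSucc) (H j.succ)) (x : El (H 0)) :
    El (H (Fin.last (k + 1))) :=
  (pairContractE (k + 1) H g).app (φ.app (castE (tens_succ k H)
    (tmulE x (pairVecE k (fun i => H i.succ) fun j => v j.succ))))

theorem app_pairContractE_tmulE (H : Fin (k + 3) → HilbSp.{u})
    (g : ∀ j : Fin (k + 2), Fn (H j.castSucc) (H j.succ))
    (x : El (H 0)) (w : El (tens (k + 1) fun i => H i.succ)) :
    (pairContractE (k + 2) H g).app (castE (tens_succ (k + 1) H) (tmulE x w)) =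
      thetaE (mapE (CL.id (H (Fin.succ 0)))
          (pairContractE k (fun i => H i.succ.succ) fun j => g j.succ.succ)
          (castE (tens_succ k fun i => H i.succ).symm w))
        (thetaDualE (headFn g) x) :=
  app_castE_tmulE (tens_succ k fun i => H i.succ) (tens_succ (k + 1) H) (headFn g)
    (pairContractE k (fun i => H i.succ.succ) fun j => g j.succ.succ) (pairContractE (k + 2) H g)
    (app_pairContractE_castE k H g) x w

theorem evenE_zero (H : Fin 2 → HilbSp.{u}) (A : ∀ i, CL (H i) (H i))
    (v : ∀ j : Fin 1, El (tensorSp (H j.castSucc) (H j.succ)))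
    (g : ∀ j : Fin 1, Fn (H j.castSucc) (H j.succ)) (f : Dl (H 0)) :
    evenE H (opTensE 1 H A) v g f =
      (A (Fin.succ 0)).app (thetaE (headVec v) (f.comp (A 0))) := by
  have h : pairVecE 1 H v = castE (T := tensorSp (H 0) (tens 0 fun i => H i.succ))
      (tens_succ 0 H) (headVec v) := (castE_of_heq (tens_succ 0 H) HEq.rfl).symm
  have h2 := app_opTensE_castE 0 H A (headVec v)
  have h3 : castE (tens_succ 0 H).symm ((opTensE 1 H A).app (pairVecE 1 H v)) =
      mapE (A 0) (A (Fin.succ 0)) (headVec v) := by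
    rw [h]
    exact (congrArg (castE (tens_succ 0 H).symm) h2).trans (castE_symm_castE _ _)
  have h4 : evenE H (opTensE 1 H A) v g f =
      thetaE (mapE (CL.id (H 0)) (CL.id (H (Fin.succ 0)))
        (castE (tens_succ 0 H).symm ((opTensE 1 H A).app (pairVecE 1 H v)))) f := (rfl)
  refine h4.trans ((congrArg (fun z => thetaE (mapE (CL.id (H 0)) (CL.id (H (Fin.succ 0))) z) f)
    h3).trans ?_)
  rw [mapE_id, thetaE_mapE]

/-- The recursion by two spaces for elementary tensors of operators: the first two legs act on the
functional `f` as `theta` of a vector followed by `thetaDual` of a functional. -/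
theorem evenE_opTensE (H : Fin (k + 4) → HilbSp.{u}) (A : ∀ i, CL (H i) (H i))
    (v : ∀ j : Fin (k + 3), El (tensorSp (H j.castSucc) (H j.succ)))
    (g : ∀ j : Fin (k + 3), Fn (H j.castSucc) (H j.succ)) (f : Dl (H 0)) :
    evenE H (opTensE (k + 3) H A) v g f =
      evenE (fun i => H i.succ.succ) (opTensE (k + 1) _ fun i => A i.succ.succ)
        (fun j => v j.succ.succ) (fun j => g j.succ.succ)
        (thetaDualE (headFn (H := fun i => H i.succ) fun j => g j.succ)
          ((A (Fin.succ 0)).app (thetaE (headVec v) (f.comp (A 0))))) := by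
  unfold evenE
  exact (thetaE_castE_insertE (tens_succ (k + 1) fun i => H i.succ) (tens_succ (k + 2) H)
    (app_opTensE_castE (k + 1) (fun i => H i.succ) fun i => A i.succ)
    (app_opTensE_castE (k + 2) H A) (headVec v)
    (pairVecE (k + 1) (fun i => H i.succ.succ) fun j => v j.succ.succ)
    (pairVecE_add_two (k + 1) H v)
    (pairContractE (k + 2) (fun i => H i.succ) fun j => g j.succ) f).trans
    (app_pairContractE_tmulE (fun i => H i.succ) (fun j => g j.succ) _ _)

/-- With an odd number of spaces the first leg is a functional, and what remains is the case of an
even number of spaces. -/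
theorem oddE_opTensE (H : Fin (k + 3) → HilbSp.{u}) (A : ∀ i, CL (H i) (H i))
    (v : ∀ j : Fin (k + 2), El (tensorSp (H j.castSucc) (H j.succ)))
    (g : ∀ j : Fin (k + 2), Fn (H j.castSucc) (H j.succ)) (x : El (H 0)) :
    oddE H (opTensE (k + 2) H A) v g x =
      evenE (fun i => H i.succ) (opTensE (k + 1) _ fun i => A i.succ)
        (fun j => v j.succ) (fun j => g j.succ) (thetaDualE (headFn g) ((A 0).app x)) := by
  unfold oddE evenE
  rw [app_opTensE_castE, mapE_tmulE]
  exact app_pairContractE_tmulE H g _ _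

theorem schurOpEven_eq_evenE {H : Fin (k + 2) → HilbSp.{u}}
    (φ : tens (k + 1) H →L[ℂ] tens (k + 1) H) (ζ : ∀ j, GammaLeg H j) (f : StrongDual ℂ (H 0)) :
    @Eq (El (H (Fin.last (k + 1)))) (schurOpEven φ ζ f)
      (evenE H φ (fun j => (ζ j).vec) (fun j => (ζ j).fn) f) := by
  have h : castE (tens_succ k H).symm (CL.app φ (pairVecE (k + 1) H fun j => (ζ j).vec)) =
      φ (pairVec (k + 1) H fun j => (ζ j).vec) := castE_of_heq (tens_succ k H).symm HEq.rfl
  exact (congrArg (fun z => thetaE (mapE (CL.id (H 0))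
    (pairContractE k (fun i => H i.succ) fun j => (ζ j.succ).fn) z) f) h).symm

theorem schurOpOdd_eq_oddE {H : Fin (k + 2) → HilbSp.{u}}
    (φ : tens (k + 1) H →L[ℂ] tens (k + 1) H) (ζ : ∀ j, GammaLeg H j) (x : H 0) :
    @Eq (El (H (Fin.last (k + 1)))) (schurOpOdd φ ζ x)
      (oddE H φ (fun j => (ζ j).vec) (fun j => (ζ j).fn) x) := by
  have h : castE (tens_succ k H) (tmulE x
      (pairVecE k (fun i => H i.succ) fun j => (ζ j.succ).vec)) =
      tmulL (H 0) (tens k fun i => H i.succ) x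
        (pairVec k (fun i => H i.succ) fun j => (ζ j.succ).vec) :=
    castE_of_heq (tens_succ k H) HEq.rfl
  exact (congrArg (fun z => (pairContractE (k + 1) H fun j => (ζ j).fn).app (CL.app φ z)) h).symm

end

/-! ### Compositions of Hilbert–Schmidt and multiplication operators -/

/-- The composition `M_{aₖ₊₁} T_{fₖ} M_{aₖ} ⋯ M_{a₁} T_{f₀} M_{a₀}`. It is the common value of the
two multiplier maps at the elementary tensor `a₀ ⊗ ⋯ ⊗ aₖ₊₁`. -/
def compOp : (k : ℕ) → {X : Fin (k + 2) → Type u} → [∀ i, MeasurableSpace (X i)] →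
    (μ : ∀ i, Measure (X i)) → [∀ i, SigmaFinite (μ i)] → (∀ i, Lp ℂ ∞ (μ i)) →
    (∀ j : Fin (k + 1), Lp ℂ 2 ((μ j.castSucc).prod (μ j.succ))) →
    (Lp ℂ 2 (μ 0) →L[ℂ] Lp ℂ 2 (μ (Fin.last (k + 1))))
  | 0, _, _, _, _, a, f => mulOp (a 1) ∘L kernelOp (f 0) ∘L mulOp (a 0)
  | k + 1, _, _, μ, _, a, f =>
    compOp k (fun i => μ i.succ) (fun i => a i.succ) (fun j => f j.succ) ∘L
      kernelOp (f 0) ∘L mulOp (a 0)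

section

variable {X Y : Type u} [MeasurableSpace X] [MeasurableSpace Y] {μ : Measure X} {ν : Measure Y}
  [SigmaFinite μ] [SigmaFinite ν]

/-- The vector `v` of `L²(μ) ⊗ L²(ν)` corresponds to `f ∈ L²(μ × ν)`. -/
def IsVecOf (v : El (tensorSp (l2Sp μ) (l2Sp ν))) (f : Lp ℂ 2 (μ.prod ν)) : Prop :=
  tensorL2 μ ν v = f

/-- The functional `g` on `L²(μ) ⊗ L²(ν)` is integration against `f ∈ L²(μ × ν)`. -/
def IsFnOf (g : Fn (l2Sp μ) (l2Sp ν)) (f : Lp ℂ 2 (μ.prod ν)) : Prop := g = legFn f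

theorem thetaE_pairing_mulOp {v : El (tensorSp (l2Sp μ) (l2Sp ν))} {f : Lp ℂ 2 (μ.prod ν)}
    (h : IsVecOf v f) (a : Lp ℂ ∞ μ) (ξ : Lp ℂ 2 μ) :
    thetaE v (Dl.comp (T := l2Sp μ) (pairing μ ξ) (mulOp a)) = kernelOp f (mulOp a ξ) := by
  have e : theta (l2Sp μ) (l2Sp ν) v (pairing μ ξ ∘L mulOp a) = kernelOp f (mulOp a ξ) := by
    rw [pairing_mulOp, ← show tensorL2 μ ν v = f from h]
    exact theta_pairing v _
  exact e

theorem thetaDualE_eq_pairing {g : Fn (l2Sp μ) (l2Sp ν)} {f : Lp ℂ 2 (μ.prod ν)}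
    (h : IsFnOf g f) (ξ : Lp ℂ 2 μ) :
    thetaDualE (H := l2Sp μ) (K := l2Sp ν) g ξ = pairing ν (kernelOp f ξ) := by
  obtain rfl : g = legFn f := h
  exact thetaDual_legFn f ξ

end

/-- For an elementary tensor of multiplication operators and an even number of spaces, the operator
multiplier map is a composition of Hilbert–Schmidt and multiplication operators. -/
theorem evenE_mulOp (n : ℕ) : ∀ {k : ℕ} (_ : k = n + n) {X : Fin (k + 2) → Type u}
    [∀ i, MeasurableSpace (X i)] (μ : ∀ i, Measure (X i)) [∀ i, SigmaFinite (μ i)]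
    (a : ∀ i, Lp ℂ ∞ (μ i)) (f : ∀ j : Fin (k + 1), Lp ℂ 2 ((μ j.castSucc).prod (μ j.succ)))
    (v : ∀ j : Fin (k + 1), El (tensorSp (l2Sp (μ j.castSucc)) (l2Sp (μ j.succ))))
    (g : ∀ j : Fin (k + 1), Fn (l2Sp (μ j.castSucc)) (l2Sp (μ j.succ)))
    (_ : ∀ j : Fin (k + 1), Even (j : ℕ) → IsVecOf (v j) (f j))
    (_ : ∀ j : Fin (k + 1), ¬ Even (j : ℕ) → IsFnOf (g j) (f j)) (ξ : Lp ℂ 2 (μ 0)),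
    evenE (fun i => l2Sp (μ i)) (opTensE (k + 1) (fun i => l2Sp (μ i)) fun i => mulOp (a i)) v g
      (pairing (μ 0) ξ) = compOp k μ a f ξ := by
  induction n with
  | zero =>
    rintro _ rfl X _ μ _ a f v g hv hg ξ
    refine (evenE_zero (fun i => l2Sp (μ i)) (fun i => mulOp (a i)) v g _).trans ?_
    exact congrArg
      (CL.app (T := l2Sp (μ (Fin.succ 0))) (E := l2Sp (μ (Fin.succ 0))) (mulOp (a (Fin.succ 0))))
      (thetaE_pairing_mulOp (μ := μ 0) (ν := μ (Fin.succ 0)) (hv 0 (by simp)) (a 0) ξ)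
  | succ n ih =>
    intro k hk X _ μ _ a f v g hv hg ξ
    obtain ⟨k, rfl⟩ : ∃ k', k = k' + 2 := ⟨n + n, by omega⟩
    have ih' := ih (k := k) (by omega)
      (fun i => μ i.succ.succ) (fun i => a i.succ.succ) (fun j => f j.succ.succ)
      (fun j => v j.succ.succ) (fun j => g j.succ.succ)
      (fun j hj => hv _ (by simpa [parity_simps] using hj))
      (fun j hj => hg _ (by simpa [parity_simps] using hj))
      (kernelOp (f (Fin.succ 0)) (mulOp (a (Fin.succ 0)) (kernelOp (f 0) (mulOp (a 0) ξ))))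
    refine (evenE_opTensE (fun i => l2Sp (μ i)) (fun i => mulOp (a i)) v g _).trans ?_
    have h2 : thetaE (headVec (H := fun i => l2Sp (μ i)) v)
        (Dl.comp (T := l2Sp (μ 0)) (pairing (μ 0) ξ) (mulOp (a 0))) =
          kernelOp (f 0) (mulOp (a 0) ξ) :=
      thetaE_pairing_mulOp (μ := μ 0) (ν := μ (Fin.succ 0)) (hv 0 (by simp)) (a 0) ξ
    have h3 : IsFnOf (g (Fin.succ 0)) (f (Fin.succ 0)) := hg _ (by simp)
    have h4 : thetaDualE (headFn (H := fun i => l2Sp (μ i.succ)) fun j => g j.succ)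
        (CL.app (T := l2Sp (μ (Fin.succ 0))) (E := l2Sp (μ (Fin.succ 0))) (mulOp (a (Fin.succ 0)))
          (thetaE (headVec (H := fun i => l2Sp (μ i)) v)
            (Dl.comp (T := l2Sp (μ 0)) (pairing (μ 0) ξ) (mulOp (a 0))))) =
          pairing (μ (Fin.succ (Fin.succ 0))) (kernelOp (f (Fin.succ 0))
            (mulOp (a (Fin.succ 0)) (kernelOp (f 0) (mulOp (a 0) ξ)))) := by
      rw [h2]
      exact thetaDualE_eq_pairing h3 _
    exact (congrArg (evenE (fun i => l2Sp (μ i.succ.succ))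
      (opTensE (k + 1) (fun i => l2Sp (μ i.succ.succ)) fun i => mulOp (a i.succ.succ))
      (fun j => v j.succ.succ) fun j => g j.succ.succ) h4).trans ih'

/-- For an elementary tensor of multiplication operators and an odd number of spaces, the operator
multiplier map is a composition of Hilbert–Schmidt and multiplication operators. -/
theorem oddE_mulOp {k : ℕ} (hk : Even k) {X : Fin (k + 3) → Type u}
    [∀ i, MeasurableSpace (X i)] (μ : ∀ i, Measure (X i)) [∀ i, SigmaFinite (μ i)]
    (a : ∀ i, Lp ℂ ∞ (μ i)) (f : ∀ j : Fin (k + 2), Lp ℂ 2 ((μ j.castSucc).prod (μ j.succ)))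
    (v : ∀ j : Fin (k + 2), El (tensorSp (l2Sp (μ j.castSucc)) (l2Sp (μ j.succ))))
    (g : ∀ j : Fin (k + 2), Fn (l2Sp (μ j.castSucc)) (l2Sp (μ j.succ)))
    (hv : ∀ j : Fin (k + 2), ¬ Even (j : ℕ) → IsVecOf (v j) (f j))
    (hg : ∀ j : Fin (k + 2), Even (j : ℕ) → IsFnOf (g j) (f j)) (ξ : Lp ℂ 2 (μ 0)) :
    oddE (fun i => l2Sp (μ i)) (opTensE (k + 2) (fun i => l2Sp (μ i)) fun i => mulOp (a i)) v g ξ =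
      compOp (k + 1) μ a f ξ := by
  obtain ⟨n, hn⟩ := hk
  have h := evenE_mulOp n hn (fun i => μ i.succ) (fun i => a i.succ)
    (fun j => f j.succ) (fun j => v j.succ) (fun j => g j.succ)
    (fun j hj => hv _ (by simpa [parity_simps] using hj))
    (fun j hj => hg _ (by simpa [parity_simps] using hj))
    (kernelOp (f 0) (mulOp (a 0) ξ))
  have h3 : IsFnOf (g 0) (f 0) := hg _ (by simp)
  have h4 : thetaDualE (headFn (H := fun i => l2Sp (μ i)) g) (mulOp (a 0) ξ) =
      pairing _ (kernelOp (f 0) (mulOp (a 0) ξ)) :=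
    thetaDualE_eq_pairing h3 _
  refine (oddE_opTensE (fun i => l2Sp (μ i)) (fun i => mulOp (a i)) v g ξ).trans ?_
  exact (congrArg (evenE (fun i => l2Sp (μ i.succ))
    (opTensE (k + 1) (fun i => l2Sp (μ i.succ)) fun i => mulOp (a i.succ))
    (fun j => v j.succ) fun j => g j.succ) h4).trans h

/-! ### Integration over the inner variables -/

section

variable {n : ℕ} {α : Fin (n + 1) → Type*} [∀ i, MeasurableSpace (α i)]

theorem measurable_cons_pi :
    Measurable fun p : α 0 × (∀ i : Fin n, α i.succ) => (Fin.cons p.1 p.2 : ∀ i, α i) := by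
  refine measurable_pi_lambda _ fun i => ?_
  induction i using Fin.cases with
  | zero => exact measurable_fst
  | succ i => exact (measurable_pi_apply i).comp measurable_snd

theorem measurePreserving_cons_pi (μ : ∀ i, Measure (α i)) [∀ i, SigmaFinite (μ i)] :
    MeasurePreserving (fun p : α 0 × (∀ i : Fin n, α i.succ) => (Fin.cons p.1 p.2 : ∀ i, α i))
      ((μ 0).prod (Measure.pi fun i => μ i.succ)) (Measure.pi μ) := by
  refine ⟨measurable_cons_pi, (Measure.pi_eq fun s hs => ?_).symm⟩
  rw [Measure.map_apply measurable_cons_pi (MeasurableSet.univ_pi hs)]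
  have : (fun p : α 0 × (∀ i : Fin n, α (Fin.succ i)) => (Fin.cons p.1 p.2 : ∀ i, α i)) ⁻¹'
      (Set.univ.pi s) = s 0 ×ˢ Set.univ.pi fun i : Fin n => s i.succ := by
    ext p
    simp [Set.mem_pi, Fin.forall_fin_succ]
  rw [this, Measure.prod_prod, Measure.pi_pi, Fin.prod_univ_succ]

end

section

variable {k : ℕ} {X : Fin (k + 2) → Type u}

theorem fillIn_zero (x : X 0) (y : ∀ i : Fin k, X i.castSucc.succ) (z : X (Fin.last (k + 1))) :
    fillIn x y z 0 = x := rfl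

theorem fillIn_castSucc_succ (x : X 0) (y : ∀ i : Fin k, X i.castSucc.succ)
    (z : X (Fin.last (k + 1))) (i : Fin k) : fillIn x y z i.castSucc.succ = y i :=
  Fin.snoc_castSucc (α := fun i : Fin (k + 1) => X i.succ) z y i

theorem fillIn_last (x : X 0) (y : ∀ i : Fin k, X i.castSucc.succ) (z : X (Fin.last (k + 1))) :
    fillIn x y z (Fin.last (k + 1)) = z :=
  Fin.snoc_last (α := fun i : Fin (k + 1) => X i.succ) z y

/-- A point with its first inner coordinate split off. -/
theorem fillIn_cons {X : Fin (k + 3) → Type u} (x : X 0) (y₀ : X (Fin.succ 0))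
    (y : ∀ i : Fin k, X i.castSucc.succ.succ) (z : X (Fin.last (k + 2))) :
    fillIn (k := k + 1) x (Fin.cons y₀ y) z =
      Fin.cons x (fillIn (X := fun i => X i.succ) y₀ y z) := by
  funext i
  induction i using Fin.cases with
  | zero => rfl
  | succ i =>
    change _ = fillIn (X := fun i => X i.succ) y₀ y z i
    induction i using Fin.cases with
    | zero => exact fillIn_castSucc_succ (k := k + 1) x (Fin.cons y₀ y) z 0
    | succ i =>
      induction i using Fin.lastCases with
      | last =>
        exact (fillIn_last (k := k + 1) x (Fin.cons y₀ y) z).trans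
          (fillIn_last (X := fun i => X i.succ) y₀ y z).symm
      | cast i =>
        exact (fillIn_castSucc_succ (k := k + 1) x (Fin.cons y₀ y) z i.succ).trans
          (fillIn_castSucc_succ (X := fun i => X i.succ) y₀ y z i).symm

variable [∀ i, MeasurableSpace (X i)]

theorem measurable_fillIn :
    Measurable fun q : (X 0 × X (Fin.last (k + 1))) × (∀ i : Fin k, X i.castSucc.succ) =>
      fillIn q.1.1 q.2 q.1.2 := by
  refine measurable_pi_lambda _ fun i => ?_
  induction i using Fin.cases with
  | zero => exact measurable_fst.comp measurable_fst
  | succ i =>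
    induction i using Fin.lastCases with
    | last =>
      simp only [Fin.succ_last, fillIn_last]
      exact measurable_snd.comp measurable_fst
    | cast i =>
      simp only [fillIn_castSucc_succ]
      exact (measurable_pi_apply i).comp measurable_snd

variable (μ : ∀ i, Measure (X i)) [∀ i, SigmaFinite (μ i)]

/-- The measure on `X₀ × ⋯ × Xₖ₊₁`, with the first and the last coordinate split off. -/
theorem measurePreserving_fillIn :
    MeasurePreserving (fun q : (X 0 × X (Fin.last (k + 1))) × (∀ i : Fin k, X i.castSucc.succ) =>
      fillIn q.1.1 q.2 q.1.2)
      (((μ 0).prod (μ (Fin.last (k + 1)))).prod (Measure.pi fun i : Fin k => μ i.castSucc.succ))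
      (Measure.pi μ) := by
  refine ⟨measurable_fillIn, (Measure.pi_eq fun s hs => ?_).symm⟩
  rw [Measure.map_apply measurable_fillIn (MeasurableSet.univ_pi hs)]
  have : (fun q : (X 0 × X (Fin.last (k + 1))) × (∀ i : Fin k, X i.castSucc.succ) =>
      fillIn q.1.1 q.2 q.1.2) ⁻¹' (Set.univ.pi s) =
        (s 0 ×ˢ s (Fin.last (k + 1))) ×ˢ Set.univ.pi fun i : Fin k => s i.castSucc.succ := by
    ext q
    simp only [Set.mem_preimage, Set.mem_pi, Set.mem_univ, true_imp_iff, Set.mem_prod]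
    rw [Fin.forall_fin_succ, Fin.forall_fin_succ']
    simp only [Fin.succ_last, fillIn_last, fillIn_castSucc_succ, fillIn_zero]
    tauto
  rw [this, Measure.prod_prod, Measure.prod_prod, Measure.pi_pi, Fin.prod_univ_succ,
    Fin.prod_univ_castSucc, Fin.succ_last, mul_assoc, mul_comm (μ (Fin.last (k + 1)) _)]

end

section

variable {k : ℕ} {X : Fin (k + 2) → Type u} [∀ i, MeasurableSpace (X i)]
  (μ : ∀ i, Measure (X i)) [∀ i, SigmaFinite (μ i)]

/-- The product of the values of functions `Fⱼ` of two adjacent variables along a point. -/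
def pathProd {M : Type*} [CommMonoid M] (F : ∀ j : Fin (k + 1), X j.castSucc × X j.succ → M)
    (x : ∀ i, X i) : M := ∏ j : Fin (k + 1), F j (x j.castSucc, x j.succ)

theorem pathProd_cons {M : Type*} [CommMonoid M] {X : Fin (k + 3) → Type u}
    (F : ∀ j : Fin (k + 2), X j.castSucc × X j.succ → M) (x₀ : X 0)
    (x : ∀ i : Fin (k + 2), X i.succ) :
    pathProd F (Fin.cons x₀ x) =
      F 0 (x₀, x 0) * pathProd (X := fun i => X i.succ) (fun j => F j.succ) x := by
  rw [pathProd, Fin.prod_univ_succ]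
  rfl

theorem measurable_pathProd {M : Type*} [CommMonoid M] [MeasurableSpace M] [MeasurableMul₂ M]
    {F : ∀ j : Fin (k + 1), X j.castSucc × X j.succ → M} (hF : ∀ j, Measurable (F j)) :
    Measurable (pathProd F) := by
  unfold pathProd
  exact Finset.measurable_fun_prod _ fun j _ => (hF j).comp (by fun_prop)

/-- The iterated composition of nonnegative kernels. -/
def pathLint (F : ∀ j : Fin (k + 1), X j.castSucc × X j.succ → ℝ≥0∞)
    (p : X 0 × X (Fin.last (k + 1))) : ℝ≥0∞ :=
  ∫⁻ y : (∀ i : Fin k, X i.castSucc.succ), pathProd F (fillIn p.1 y p.2)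
    ∂(Measure.pi fun i : Fin k => μ i.castSucc.succ)

theorem measurable_pathLint {F : ∀ j : Fin (k + 1), X j.castSucc × X j.succ → ℝ≥0∞}
    (hF : ∀ j, Measurable (F j)) : Measurable (pathLint μ F) :=
  ((measurable_pathProd hF).comp measurable_fillIn).lintegral_prod_right'

/-- The integral over the first inner variable carried out last. -/
theorem pathLint_succ {X : Fin (k + 3) → Type u} [∀ i, MeasurableSpace (X i)]
    (μ : ∀ i, Measure (X i)) [∀ i, SigmaFinite (μ i)]
    {F : ∀ j : Fin (k + 2), X j.castSucc × X j.succ → ℝ≥0∞} (hF : ∀ j, Measurable (F j))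
    (p : X 0 × X (Fin.last (k + 2))) :
    pathLint (k := k + 1) μ F p = ∫⁻ y, F 0 (p.1, y) *
      pathLint (fun i => μ i.succ) (fun j => F j.succ) (y, p.2) ∂(μ (Fin.succ 0)) := by
  have hm : Measurable fun y : (∀ i : Fin (k + 1), X i.castSucc.succ) =>
      pathProd F (fillIn p.1 y p.2) :=
    (measurable_pathProd hF).comp (measurable_fillIn.comp (measurable_const.prodMk measurable_id))
  refine ((measurePreserving_cons_pi fun i : Fin (k + 1) => μ i.castSucc.succ).lintegral_comp
    hm).symm.trans ((lintegral_prod _ (hm.comp measurable_cons_pi).aemeasurable).trans ?_)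
  refine lintegral_congr fun y₀ => ?_
  rw [pathLint, ← lintegral_const_mul]
  · refine lintegral_congr fun y => ?_
    exact (congrArg (pathProd F) (fillIn_cons p.1 y₀ y p.2)).trans (pathProd_cons F _ _)
  · exact (measurable_pathProd (X := fun i => X i.succ) fun j => hF j.succ).comp
      (measurable_fillIn.comp (measurable_const.prodMk measurable_id))

end

/-! ### The kernel of a Schur multiplier map -/

theorem ae_enorm_coeFn_le {Y : Type*} [MeasurableSpace Y] {ν : Measure Y} (φ : Lp ℂ ∞ ν) :
    ∀ᵐ x ∂ν, ‖φ x‖ₑ ≤ ‖φ‖ₑ := by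
  rw [Lp.enorm_def, eLpNorm_exponent_top]
  exact enorm_ae_le_eLpNormEssSup φ _

theorem lintegral_mul_rpow_two_le {Y : Type*} [MeasurableSpace Y] (ν : Measure Y)
    {f g : Y → ℝ≥0∞} (hf : Measurable f) (hg : Measurable g) :
    (∫⁻ y, f y * g y ∂ν) ^ (2 : ℝ) ≤ (∫⁻ y, f y ^ (2 : ℝ) ∂ν) * ∫⁻ y, g y ^ (2 : ℝ) ∂ν := by
  have h := ENNReal.lintegral_mul_le_Lp_mul_Lq ν Real.HolderConjugate.two_two hf.aemeasurable
    hg.aemeasurable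
  refine (ENNReal.rpow_le_rpow (z := 2) h (by norm_num)).trans_eq ?_
  rw [ENNReal.mul_rpow_of_nonneg _ _ (by norm_num), ← ENNReal.rpow_mul, ← ENNReal.rpow_mul]
  norm_num

/-- The `L²`-norm of a composition of nonnegative kernels is at most the product of the `L²`-norms,
by the Cauchy–Schwarz inequality in each inner variable. -/
theorem lintegral_pathLint_rpow_two_le : ∀ {k : ℕ} {X : Fin (k + 2) → Type u}
    [∀ i, MeasurableSpace (X i)] (μ : ∀ i, Measure (X i)) [∀ i, SigmaFinite (μ i)]
    {F : ∀ j : Fin (k + 1), X j.castSucc × X j.succ → ℝ≥0∞} (_ : ∀ j, Measurable (F j)),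
    ∫⁻ p, pathLint μ F p ^ (2 : ℝ) ∂((μ 0).prod (μ (Fin.last (k + 1)))) ≤
      ∏ j : Fin (k + 1), ∫⁻ q, F j q ^ (2 : ℝ) ∂((μ j.castSucc).prod (μ j.succ)) := by
  intro k
  induction k with
  | zero =>
    intro X _ μ _ F hF
    rw [Fin.prod_univ_one]
    refine le_of_eq (lintegral_congr fun p => ?_)
    have h : pathLint μ F p = F 0 p := by
      rw [pathLint, Measure.pi_of_empty, lintegral_dirac']
      · rw [pathProd, Fin.prod_univ_one]
        rfl
      · exact (measurable_pathProd hF).comp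
          (measurable_fillIn.comp (measurable_const.prodMk measurable_id))
    rw [h]
  | succ k ih =>
    intro X _ μ _ F hF
    have hN : Measurable (pathLint (fun i => μ i.succ) fun j => F j.succ) :=
      measurable_pathLint (fun i => μ i.succ) fun j => hF j.succ
    have hF0 : Measurable (F 0) := hF 0
    have h1 : ∀ p : X 0 × X (Fin.last (k + 2)), pathLint (k := k + 1) μ F p ^ (2 : ℝ) ≤
        (∫⁻ y, F 0 (p.1, y) ^ (2 : ℝ) ∂(μ (Fin.succ 0))) *
          ∫⁻ y, pathLint (fun i => μ i.succ) (fun j => F j.succ) (y, p.2) ^ (2 : ℝ)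
            ∂(μ (Fin.succ 0)) := by
      intro p
      rw [pathLint_succ μ hF]
      exact lintegral_mul_rpow_two_le _ (hF0.comp (measurable_const.prodMk measurable_id))
        (hN.comp (measurable_id.prodMk measurable_const))
    refine (lintegral_mono h1).trans ?_
    have m1 : Measurable fun x => ∫⁻ y, F 0 (x, y) ^ (2 : ℝ) ∂(μ (Fin.succ 0)) :=
      (hF0.pow_const 2).lintegral_prod_right'
    have m2 : Measurable fun z => ∫⁻ y, pathLint (fun i => μ i.succ) (fun j => F j.succ)
        (y, z) ^ (2 : ℝ) ∂(μ (Fin.succ 0)) := (hN.pow_const 2).lintegral_prod_left'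
    refine (lintegral_prod_mul m1.aemeasurable m2.aemeasurable).trans_le ?_
    rw [Fin.prod_univ_succ]
    gcongr
    · exact (lintegral_prod _ (hF0.pow_const 2).aemeasurable).symm.le
    · refine (lintegral_prod_symm' _ (hN.pow_const 2)).symm.le.trans ?_
      exact ih (fun i => μ i.succ) fun j => hF j.succ

section

variable {k : ℕ} {X : Fin (k + 2) → Type u} [∀ i, MeasurableSpace (X i)]
  (μ : ∀ i, Measure (X i))

theorem measurable_pathProd_coeFn
    (f : ∀ j : Fin (k + 1), Lp ℂ 2 ((μ j.castSucc).prod (μ j.succ))) :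
    Measurable (pathProd fun j => (f j : X j.castSucc × X j.succ → ℂ)) :=
  measurable_pathProd fun j => (Lp.stronglyMeasurable (f j)).measurable

theorem enorm_pathProd (f : ∀ j : Fin (k + 1), Lp ℂ 2 ((μ j.castSucc).prod (μ j.succ)))
    (x : ∀ i, X i) : ‖pathProd (fun j => (f j : X j.castSucc × X j.succ → ℂ)) x‖ₑ =
      pathProd (fun j q => ‖f j q‖ₑ) x := by
  simp only [pathProd, ← ofReal_norm, norm_prod]
  exact ENNReal.ofReal_prod_of_nonneg fun _ _ => norm_nonneg _

theorem stronglyMeasurable_schurIntegrand (φ : Lp ℂ ∞ (Measure.pi μ))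
    (f : ∀ j : Fin (k + 1), Lp ℂ 2 ((μ j.castSucc).prod (μ j.succ))) :
    StronglyMeasurable fun x => φ x *
      pathProd (fun j => (f j : X j.castSucc × X j.succ → ℂ)) x :=
  (Lp.stronglyMeasurable φ).mul (measurable_pathProd_coeFn μ f).stronglyMeasurable

variable [∀ i, SigmaFinite (μ i)]

theorem lintegral_pathLint_coeFn_le
    (f : ∀ j : Fin (k + 1), Lp ℂ 2 ((μ j.castSucc).prod (μ j.succ))) :
    ∫⁻ p, pathLint μ (fun j q => ‖f j q‖ₑ) p ^ (2 : ℝ) ∂((μ 0).prod (μ (Fin.last (k + 1)))) ≤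
      (∏ j, ‖f j‖ₑ) ^ (2 : ℝ) := by
  refine (lintegral_pathLint_rpow_two_le μ fun j =>
    (Lp.stronglyMeasurable (f j)).measurable.enorm).trans_eq ?_
  rw [← ENNReal.prod_rpow_of_nonneg (by norm_num)]
  refine Finset.prod_congr rfl fun j _ => ?_
  rw [Lp.enorm_def, eLpNorm_eq_lintegral_rpow_enorm_toReal (by norm_num) (by norm_num),
    ← ENNReal.rpow_mul]
  norm_num

theorem pathLint_coeFn_lt_top
    (f : ∀ j : Fin (k + 1), Lp ℂ 2 ((μ j.castSucc).prod (μ j.succ))) :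
    ∀ᵐ p ∂((μ 0).prod (μ (Fin.last (k + 1)))), pathLint μ (fun j q => ‖f j q‖ₑ) p < ∞ := by
  have hm : Measurable (pathLint μ fun j q => ‖f j q‖ₑ) :=
    measurable_pathLint μ fun j => (Lp.stronglyMeasurable (f j)).measurable.enorm
  have h := ((lintegral_pathLint_coeFn_le μ f).trans_lt (ENNReal.rpow_lt_top_of_nonneg (by norm_num)
    (ENNReal.prod_ne_top fun _ _ => enorm_ne_top))).ne
  filter_upwards [ae_lt_top (hm.pow_const _) h] with p hp
  rwa [ENNReal.rpow_lt_top_iff_of_pos (by norm_num)] at hp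

/-- A property of almost every point of `X₀ × ⋯ × Xₖ₊₁` holds, for almost all end points, for almost
all inner coordinates. -/
theorem ae_fillIn {p : (∀ i, X i) → Prop} (h : ∀ᵐ x ∂Measure.pi μ, p x) :
    ∀ᵐ q ∂((μ 0).prod (μ (Fin.last (k + 1)))),
      ∀ᵐ y ∂(Measure.pi fun i : Fin k => μ i.castSucc.succ), p (fillIn q.1 y q.2) :=
  Measure.ae_ae_of_ae_prod ((measurePreserving_fillIn μ).quasiMeasurePreserving.ae h)

theorem lintegral_schurKernel_le (φ : Lp ℂ ∞ (Measure.pi μ))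
    (f : ∀ j : Fin (k + 1), Lp ℂ 2 ((μ j.castSucc).prod (μ j.succ))) :
    ∀ᵐ p ∂((μ 0).prod (μ (Fin.last (k + 1)))),
      ∫⁻ y : (∀ i : Fin k, X i.castSucc.succ), ‖φ (fillIn p.1 y p.2) *
        pathProd (fun j => (f j : X j.castSucc × X j.succ → ℂ)) (fillIn p.1 y p.2)‖ₑ
          ∂(Measure.pi fun i : Fin k => μ i.castSucc.succ) ≤
        ‖φ‖ₑ * pathLint μ (fun j q => ‖f j q‖ₑ) p := by
  filter_upwards [ae_fillIn μ (ae_enorm_coeFn_le φ)] with p hp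
  rw [pathLint, ← lintegral_const_mul' _ _ enorm_ne_top]
  refine lintegral_mono_ae ?_
  filter_upwards [hp] with y hy
  rw [enorm_mul, enorm_pathProd]
  gcongr

theorem integrable_schurIntegrand (φ : Lp ℂ ∞ (Measure.pi μ))
    (f : ∀ j : Fin (k + 1), Lp ℂ 2 ((μ j.castSucc).prod (μ j.succ))) :
    ∀ᵐ p ∂((μ 0).prod (μ (Fin.last (k + 1)))),
      Integrable (fun y : (∀ i : Fin k, X i.castSucc.succ) => φ (fillIn p.1 y p.2) *
        pathProd (fun j => (f j : X j.castSucc × X j.succ → ℂ)) (fillIn p.1 y p.2))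
          (Measure.pi fun i : Fin k => μ i.castSucc.succ) := by
  filter_upwards [lintegral_schurKernel_le μ φ f, pathLint_coeFn_lt_top μ f] with p h1 h2
  refine ⟨((stronglyMeasurable_schurIntegrand μ φ f).comp_measurable (measurable_fillIn.comp
    (measurable_const.prodMk measurable_id))).aestronglyMeasurable, h1.trans_lt ?_⟩
  finiteness

theorem eLpNorm_schurKernel_le (φ : Lp ℂ ∞ (Measure.pi μ))
    (f : ∀ j : Fin (k + 1), Lp ℂ 2 ((μ j.castSucc).prod (μ j.succ))) :
    eLpNorm (schurKernel μ φ f) 2 ((μ 0).prod (μ (Fin.last (k + 1)))) ≤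
      (∏ j, ‖f j‖ₑ) * ‖φ‖ₑ := by
  rw [eLpNorm_eq_lintegral_rpow_enorm_toReal (by norm_num) (by norm_num)]
  have h : ∫⁻ p, ‖schurKernel μ φ f p‖ₑ ^ (2 : ℝ) ∂((μ 0).prod (μ (Fin.last (k + 1)))) ≤
      ((∏ j, ‖f j‖ₑ) * ‖φ‖ₑ) ^ (2 : ℝ) := by
    rw [mul_comm, ENNReal.mul_rpow_of_nonneg _ _ (by norm_num)]
    refine le_trans ?_ (mul_le_mul_right (lintegral_pathLint_coeFn_le μ f) _)
    rw [← lintegral_const_mul' _ _ (ENNReal.rpow_ne_top_of_nonneg (by norm_num) enorm_ne_top)]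
    refine lintegral_mono_ae ?_
    filter_upwards [lintegral_schurKernel_le μ φ f] with p hp
    rw [← ENNReal.mul_rpow_of_nonneg _ _ (by norm_num)]
    exact ENNReal.rpow_le_rpow ((enorm_integral_le_lintegral_enorm _).trans hp) (by norm_num)
  calc _ ≤ (((∏ j, ‖f j‖ₑ) * ‖φ‖ₑ) ^ (2 : ℝ)) ^ (1 / (2 : ℝ)) := by
        simpa using ENNReal.rpow_le_rpow h (by norm_num : (0 : ℝ) ≤ 1 / 2)
    _ = _ := by rw [← ENNReal.rpow_mul]; norm_num

theorem memLp_schurKernel (φ : Lp ℂ ∞ (Measure.pi μ))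
    (f : ∀ j : Fin (k + 1), Lp ℂ 2 ((μ j.castSucc).prod (μ j.succ))) :
    MemLp (schurKernel μ φ f) 2 ((μ 0).prod (μ (Fin.last (k + 1)))) := by
  refine ⟨StronglyMeasurable.aestronglyMeasurable ?_, (eLpNorm_schurKernel_le μ φ f).trans_lt
    (ENNReal.mul_lt_top (ENNReal.prod_lt_top fun _ _ => enorm_lt_top) enorm_lt_top)⟩
  exact ((stronglyMeasurable_schurIntegrand μ φ f).comp_measurable
    measurable_fillIn).integral_prod_right'

/-- The kernel `S_φ(f₀, …, fₖ)`, as a continuous linear function of `φ ∈ L^∞`. -/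
def schurLp (f : ∀ j : Fin (k + 1), Lp ℂ 2 ((μ j.castSucc).prod (μ j.succ))) :
    Lp ℂ ∞ (Measure.pi μ) →L[ℂ] Lp ℂ 2 ((μ 0).prod (μ (Fin.last (k + 1)))) :=
  LinearMap.mkContinuous
    { toFun := fun φ => (memLp_schurKernel μ φ f).toLp
      map_add' := fun φ ψ => by
        rw [← MemLp.toLp_add]
        apply MemLp.toLp_congr
        filter_upwards [integrable_schurIntegrand μ φ f, integrable_schurIntegrand μ ψ f,
          ae_fillIn μ (Lp.coeFn_add φ ψ)] with p h1 h2 h3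
        refine Eq.trans ?_ (integral_add h1 h2)
        apply integral_congr_ae
        filter_upwards [h3] with y hy
        rw [hy, Pi.add_apply, ← add_mul]
      map_smul' := fun c φ => by
        rw [RingHom.id_apply, ← MemLp.toLp_const_smul]
        apply MemLp.toLp_congr
        filter_upwards [ae_fillIn μ (Lp.coeFn_smul c φ)] with p h3
        refine Eq.trans ?_ (integral_smul c _)
        apply integral_congr_ae
        filter_upwards [h3] with y hy
        rw [hy, Pi.smul_apply, ← smul_mul_assoc] }
    (∏ j, ‖f j‖) fun φ => by
      refine (Lp.norm_toLp _ (memLp_schurKernel μ φ f)).trans_le ?_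
      refine (ENNReal.toReal_mono (ENNReal.mul_ne_top (ENNReal.prod_ne_top fun _ _ => enorm_ne_top)
        enorm_ne_top) (eLpNorm_schurKernel_le μ φ f)).trans_eq ?_
      simp [ENNReal.toReal_mul, ENNReal.toReal_prod]

theorem coeFn_schurLp (φ : Lp ℂ ∞ (Measure.pi μ))
    (f : ∀ j : Fin (k + 1), Lp ℂ 2 ((μ j.castSucc).prod (μ j.succ))) :
    schurLp μ f φ =ᵐ[(μ 0).prod (μ (Fin.last (k + 1)))] schurKernel μ φ f :=
  MemLp.coeFn_toLp (memLp_schurKernel μ φ f)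

end

/-! ### Product functions in `L^∞` -/

section

variable {ι : Type*} [Fintype ι] {X : ι → Type*} [∀ i, MeasurableSpace (X i)]
  (μ : ∀ i, Measure (X i)) [∀ i, SigmaFinite (μ i)]

theorem ae_pi_of_ae {i : ι} {p : X i → Prop} (h : ∀ᵐ x ∂μ i, p x) : ∀ᵐ x ∂Measure.pi μ, p (x i) :=
  (Measure.quasiMeasurePreserving_eval μ i).ae h

theorem memLp_top_prod (a : ∀ i, Lp ℂ ∞ (μ i)) :
    MemLp (fun x : ∀ i, X i => ∏ i, a i (x i)) ∞ (Measure.pi μ) := by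
  have hm : StronglyMeasurable fun x : ∀ i, X i => ∏ i, a i (x i) :=
    Finset.stronglyMeasurable_fun_prod _ fun i _ =>
      (Lp.stronglyMeasurable (a i)).comp_measurable (measurable_pi_apply i)
  refine memLp_top_of_bound hm.aestronglyMeasurable (∏ i, ‖a i‖) ?_
  filter_upwards [ae_all_iff.2 fun i => ae_pi_of_ae μ (ae_enorm_coeFn_le (a i))] with x hx
  rw [norm_prod]
  gcongr with i
  exact enorm_le_iff_norm_le.1 (hx i)

/-- The function `x ↦ ∏ᵢ aᵢ(xᵢ)` as an element of `L^∞`, multilinear in `a`. -/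
def prodLinf [DecidableEq ι] :
    MultilinearMap ℂ (fun i => Lp ℂ ∞ (μ i)) (Lp ℂ ∞ (Measure.pi μ)) where
  toFun a := (memLp_top_prod μ a).toLp
  map_update_add' a i b c := by
    rw [← MemLp.toLp_add]
    apply MemLp.toLp_congr
    filter_upwards [ae_pi_of_ae μ (Lp.coeFn_add b c)] with x hx
    have h : ∀ d, ∏ j, (Function.update a i d j) (x j) = d (x i) * ∏ j ∈ {i}ᶜ, a j (x j) := by
      intro d
      rw [Fintype.prod_eq_mul_prod_compl i, Function.update_self]
      congr 1
      refine Finset.prod_congr rfl fun j hj => ?_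
      rw [Function.update_of_ne (by simpa using hj)]
    rw [Pi.add_apply]
    convert add_mul (b (x i)) (c (x i)) (∏ j ∈ {i}ᶜ, a j (x j)) using 1
    · convert h (b + c) using 2
      exact hx.symm
    · convert congrArg₂ (· + ·) (h b) (h c)
  map_update_smul' a i r b := by
    rw [← MemLp.toLp_const_smul]
    apply MemLp.toLp_congr
    filter_upwards [ae_pi_of_ae μ (Lp.coeFn_smul r b)] with x hx
    have h : ∀ d, ∏ j, (Function.update a i d j) (x j) = d (x i) * ∏ j ∈ {i}ᶜ, a j (x j) := by
      intro d
      rw [Fintype.prod_eq_mul_prod_compl i, Function.update_self]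
      congr 1
      refine Finset.prod_congr rfl fun j hj => ?_
      rw [Function.update_of_ne (by simpa using hj)]
    rw [Pi.smul_apply]
    convert smul_mul_assoc r (b (x i)) (∏ j ∈ {i}ᶜ, a j (x j)) using 1
    · convert h (r • b) using 2
      exact hx.symm
    · convert congrArg (r • ·) (h b)

variable [DecidableEq ι]

theorem coeFn_prodLinf (a : ∀ i, Lp ℂ ∞ (μ i)) :
    prodLinf μ a =ᵐ[Measure.pi μ] fun x => ∏ i, a i (x i) :=
  MemLp.coeFn_toLp (memLp_top_prod μ a)

end

/-! ### Kernels of compositions -/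

section

variable {X Y Z : Type*} [MeasurableSpace X] [MeasurableSpace Y] [MeasurableSpace Z]
  {μ : Measure X} {ν : Measure Y} {ρ : Measure Z} [SigmaFinite μ] [SigmaFinite ν] [SigmaFinite ρ]

/-- The section `x ↦ f(x, y) η(x) g(y, z)` is integrable for almost every `z`. -/
theorem ae_integrable_kernel_mul (f : Lp ℂ 2 (μ.prod ν)) (g : Lp ℂ 2 (ν.prod ρ)) (η : Lp ℂ 2 μ) :
    ∀ᵐ z ∂ρ, Integrable (fun q : X × Y => f q * η q.1 * g (q.2, z)) (μ.prod ν) := by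
  have hf := Lp.stronglyMeasurable f
  have hg := Lp.stronglyMeasurable g
  have hη := Lp.stronglyMeasurable η
  have hfη : StronglyMeasurable fun q : X × Y => f q * η q.1 :=
    hf.mul (hη.comp_measurable measurable_fst)
  have h1 : ∫⁻ z, ∫⁻ y, ‖g (y, z)‖ₑ ^ (2 : ℝ) ∂ν ∂ρ ≠ ∞ := by
    rw [← lintegral_prod_symm' _ (hg.measurable.enorm.pow_const 2)]
    have := Lp.eLpNorm_ne_top g
    rw [eLpNorm_eq_lintegral_rpow_enorm_toReal (by norm_num) (by norm_num)] at this
    intro h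
    apply this
    simp only [ENNReal.toReal_ofNat]
    rw [h]
    simp
  have h2 : ∫⁻ y, (∫⁻ x, ‖f (x, y) * η x‖ₑ ∂μ) ^ (2 : ℝ) ∂ν ≠ ∞ :=
    ((kernel_lintegral_le f η).trans_lt
      (ENNReal.rpow_lt_top_of_nonneg (by norm_num) (by finiteness))).ne
  have hm : Measurable fun y => ∫⁻ x, ‖f (x, y) * η x‖ₑ ∂μ :=
    hfη.measurable.enorm.lintegral_prod_left'
  filter_upwards [ae_lt_top (hg.measurable.enorm.pow_const 2).lintegral_prod_left' h1] with z hz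
  have hgz : StronglyMeasurable fun y => g (y, z) :=
    hg.comp_measurable (measurable_id.prodMk measurable_const)
  have hF : StronglyMeasurable fun q : X × Y => f q * η q.1 * g (q.2, z) :=
    hfη.mul (hgz.comp_measurable measurable_snd)
  refine ⟨hF.aestronglyMeasurable, ?_⟩
  rw [HasFiniteIntegral, lintegral_prod_symm' _ hF.measurable.enorm]
  have h3 : ∫⁻ y, ∫⁻ x, ‖f (x, y) * η x * g (y, z)‖ₑ ∂μ ∂ν =
      ∫⁻ y, (∫⁻ x, ‖f (x, y) * η x‖ₑ ∂μ) * ‖g (y, z)‖ₑ ∂ν := by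
    refine lintegral_congr fun y => ?_
    rw [← lintegral_mul_const' _ _ enorm_ne_top]
    exact lintegral_congr fun x => enorm_mul _ _
  rw [h3]
  have h4 := (lintegral_mul_rpow_two_le ν hm hgz.measurable.enorm).trans_lt
    (ENNReal.mul_lt_top h2.lt_top hz)
  rwa [ENNReal.rpow_lt_top_iff_of_pos (by norm_num)] at h4

/-- The kernel of a composition of Hilbert–Schmidt operators, by Fubini's theorem. -/
theorem kernelOp_eq_comp (a : Lp ℂ ∞ μ) (f : Lp ℂ 2 (μ.prod ν)) (g : Lp ℂ 2 (ν.prod ρ))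
    (h : Lp ℂ 2 (μ.prod ρ))
    (hh : ∀ᵐ p ∂μ.prod ρ, h p = a p.1 * ∫ y, f (p.1, y) * g (y, p.2) ∂ν) :
    kernelOp h = kernelOp g ∘L kernelOp f ∘L mulOp a := by
  ext1 ξ
  change _ = kernelOp g (kernelOp f (mulOp a ξ))
  apply Lp.ext
  filter_upwards [coeFn_kernelOp h ξ, coeFn_kernelOp g (kernelOp f (mulOp a ξ)), ae_ae_swap hh,
    ae_integrable_kernel_mul f g (mulOp a ξ)] with z h1 h2 h3 h4
  rw [h1, h2]
  calc ∫ x, h (x, z) * ξ x ∂μ = ∫ x, ∫ y, f (x, y) * mulOp a ξ x * g (y, z) ∂ν ∂μ := by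
        apply integral_congr_ae
        filter_upwards [h3, coeFn_mulOp a ξ] with x hx hx'
        rw [hx, hx', mul_right_comm, ← integral_const_mul]
        congr 1 with y
        ring
    _ = ∫ y, ∫ x, f (x, y) * mulOp a ξ x * g (y, z) ∂μ ∂ν := integral_integral_swap h4
    _ = _ := by
        apply integral_congr_ae
        filter_upwards [coeFn_kernelOp f (mulOp a ξ)] with y hy
        rw [hy, integral_mul_const, mul_comm]

theorem kernelOp_eq_comp_of_ae (a : Lp ℂ ∞ μ) (f : Lp ℂ 2 (μ.prod ν)) (g : Lp ℂ 2 (ν.prod ρ))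
    (h : Lp ℂ 2 (μ.prod ρ)) (G : Y × Z → ℂ) (hg : g =ᵐ[ν.prod ρ] G)
    (hh : ∀ᵐ p ∂μ.prod ρ, h p = a p.1 * ∫ y, f (p.1, y) * G (y, p.2) ∂ν) :
    kernelOp h = kernelOp g ∘L kernelOp f ∘L mulOp a := by
  refine kernelOp_eq_comp a f g h ?_
  filter_upwards [hh, Measure.quasiMeasurePreserving_snd.ae (ae_ae_swap hg)] with p h1 h2
  rw [h1]
  refine congrArg (a p.1 * ·) (integral_congr_ae ?_)
  filter_upwards [h2] with y hy
  rw [hy]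

theorem kernelOp_eq_mulOp_comp (a : Lp ℂ ∞ μ) (b : Lp ℂ ∞ ν) (f h : Lp ℂ 2 (μ.prod ν))
    (hh : ∀ᵐ p ∂μ.prod ν, h p = a p.1 * b p.2 * f p) :
    kernelOp h = mulOp b ∘L kernelOp f ∘L mulOp a := by
  ext1 ξ
  change _ = mulOp b (kernelOp f (mulOp a ξ))
  apply Lp.ext
  filter_upwards [coeFn_kernelOp h ξ, coeFn_mulOp b (kernelOp f (mulOp a ξ)), ae_ae_swap hh,
    coeFn_kernelOp f (mulOp a ξ)] with z h1 h2 h3 h4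
  rw [h1, h2, h4, ← integral_const_mul]
  apply integral_congr_ae
  filter_upwards [h3, coeFn_mulOp a ξ] with x hx hx'
  rw [hx, hx']
  ring

end

/-! ### Schur multiplier maps at elementary tensors -/

section

variable {k : ℕ} {X : Fin (k + 2) → Type u} [∀ i, MeasurableSpace (X i)]
  (μ : ∀ i, Measure (X i))

/-- The integrand of `schurKernel` for the function `x ↦ ∏ᵢ aᵢ(xᵢ)`. -/
def elemIntegrand (a : ∀ i, Lp ℂ ∞ (μ i))
    (f : ∀ j : Fin (k + 1), Lp ℂ 2 ((μ j.castSucc).prod (μ j.succ))) (x : ∀ i, X i) : ℂ :=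
  (∏ i, a i (x i)) * pathProd (fun j => (f j : X j.castSucc × X j.succ → ℂ)) x

/-- `schurKernel` for the function `x ↦ ∏ᵢ aᵢ(xᵢ)`. -/
def elemKernel (a : ∀ i, Lp ℂ ∞ (μ i))
    (f : ∀ j : Fin (k + 1), Lp ℂ 2 ((μ j.castSucc).prod (μ j.succ)))
    (p : X 0 × X (Fin.last (k + 1))) : ℂ :=
  ∫ y : (∀ i : Fin k, X i.castSucc.succ), elemIntegrand μ a f (fillIn p.1 y p.2)
    ∂(Measure.pi fun i : Fin k => μ i.castSucc.succ)

theorem stronglyMeasurable_elemIntegrand (a : ∀ i, Lp ℂ ∞ (μ i))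
    (f : ∀ j : Fin (k + 1), Lp ℂ 2 ((μ j.castSucc).prod (μ j.succ))) :
    StronglyMeasurable (elemIntegrand μ a f) :=
  (Finset.stronglyMeasurable_fun_prod _ fun i _ =>
    (Lp.stronglyMeasurable (a i)).comp_measurable (measurable_pi_apply i)).mul
      (measurable_pathProd_coeFn μ f).stronglyMeasurable

theorem elemIntegrand_cons {X : Fin (k + 3) → Type u} [∀ i, MeasurableSpace (X i)]
    (μ : ∀ i, Measure (X i)) (a : ∀ i, Lp ℂ ∞ (μ i))
    (f : ∀ j : Fin (k + 2), Lp ℂ 2 ((μ j.castSucc).prod (μ j.succ))) (x₀ : X 0)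
    (x : ∀ i : Fin (k + 2), X i.succ) :
    elemIntegrand μ a f (Fin.cons x₀ x) = a 0 x₀ * (f 0 (x₀, x 0) *
      elemIntegrand (fun i => μ i.succ) (fun i => a i.succ) (fun j => f j.succ) x) := by
  have h := pathProd_cons (fun j => (f j : X j.castSucc × X j.succ → ℂ)) x₀ x
  rw [elemIntegrand, h, Fin.prod_univ_succ, elemIntegrand]
  simp only [Fin.cons_zero, Fin.cons_succ]
  ring

variable [∀ i, SigmaFinite (μ i)]

/-- The integral over the first inner variable carried out last. The integrability of the whole
integrand is needed for Fubini's theorem. -/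
theorem elemKernel_succ {X : Fin (k + 3) → Type u} [∀ i, MeasurableSpace (X i)]
    (μ : ∀ i, Measure (X i)) [∀ i, SigmaFinite (μ i)] (a : ∀ i, Lp ℂ ∞ (μ i))
    (f : ∀ j : Fin (k + 2), Lp ℂ 2 ((μ j.castSucc).prod (μ j.succ)))
    (p : X 0 × X (Fin.last (k + 2)))
    (hp : Integrable (fun y : (∀ i : Fin (k + 1), X i.castSucc.succ) =>
      elemIntegrand μ a f (fillIn p.1 y p.2))
        (Measure.pi fun i : Fin (k + 1) => μ i.castSucc.succ)) :
    elemKernel (k := k + 1) μ a f p = a 0 p.1 * ∫ y, f 0 (p.1, y) *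
      elemKernel (fun i => μ i.succ) (fun i => a i.succ) (fun j => f j.succ) (y, p.2)
        ∂(μ (Fin.succ 0)) := by
  have mp := measurePreserving_cons_pi fun i : Fin (k + 1) => μ i.castSucc.succ
  have hi := (mp.integrable_comp hp.aestronglyMeasurable).2 hp
  have e1 := integral_map (μ := (μ (Fin.castSucc 0).succ).prod
    (Measure.pi fun i : Fin k => μ i.succ.castSucc.succ)) mp.measurable.aemeasurable
    (mp.map_eq.symm ▸ hp.aestronglyMeasurable)
  rw [mp.map_eq] at e1
  refine e1.trans ((integral_prod _ hi).trans ?_)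
  rw [← integral_const_mul]
  refine integral_congr_ae (Filter.Eventually.of_forall fun y₀ => ?_)
  change ∫ y, elemIntegrand μ a f (fillIn (k := k + 1) p.1 (Fin.cons y₀ y) p.2) ∂_ =
    _ * (_ * ∫ y, _ ∂_)
  rw [← integral_const_mul, ← integral_const_mul]
  refine integral_congr_ae (Filter.Eventually.of_forall fun y => ?_)
  exact (congrArg (elemIntegrand μ a f) (fillIn_cons p.1 y₀ y p.2)).trans
    (elemIntegrand_cons μ a f _ _)

theorem schurKernel_prodLinf (a : ∀ i, Lp ℂ ∞ (μ i))
    (f : ∀ j : Fin (k + 1), Lp ℂ 2 ((μ j.castSucc).prod (μ j.succ))) :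
    schurKernel μ (prodLinf μ a) f =ᵐ[(μ 0).prod (μ (Fin.last (k + 1)))] elemKernel μ a f := by
  filter_upwards [ae_fillIn μ (coeFn_prodLinf μ a)] with p hp
  apply integral_congr_ae
  filter_upwards [hp] with y hy
  rw [hy]
  rfl

theorem coeFn_schurLp_prodLinf (a : ∀ i, Lp ℂ ∞ (μ i))
    (f : ∀ j : Fin (k + 1), Lp ℂ 2 ((μ j.castSucc).prod (μ j.succ))) :
    schurLp μ f (prodLinf μ a) =ᵐ[(μ 0).prod (μ (Fin.last (k + 1)))] elemKernel μ a f :=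
  (coeFn_schurLp μ (prodLinf μ a) f).trans (schurKernel_prodLinf μ a f)

theorem integrable_elemIntegrand (a : ∀ i, Lp ℂ ∞ (μ i))
    (f : ∀ j : Fin (k + 1), Lp ℂ 2 ((μ j.castSucc).prod (μ j.succ))) :
    ∀ᵐ p ∂((μ 0).prod (μ (Fin.last (k + 1)))),
      Integrable (fun y : (∀ i : Fin k, X i.castSucc.succ) =>
        elemIntegrand μ a f (fillIn p.1 y p.2))
          (Measure.pi fun i : Fin k => μ i.castSucc.succ) := by
  filter_upwards [integrable_schurIntegrand μ (prodLinf μ a) f,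
    ae_fillIn μ (coeFn_prodLinf μ a)] with p h1 h2
  refine h1.congr ?_
  filter_upwards [h2] with y hy
  rw [hy]
  rfl

end

/-- For a product function `φ`, the operator with kernel `S_φ(f₀, …, fₖ)` is a composition of
Hilbert–Schmidt and multiplication operators. -/
theorem kernelOp_schurLp_prodLinf : ∀ {k : ℕ} {X : Fin (k + 2) → Type u}
    [∀ i, MeasurableSpace (X i)] (μ : ∀ i, Measure (X i)) [∀ i, SigmaFinite (μ i)]
    (a : ∀ i, Lp ℂ ∞ (μ i)) (f : ∀ j : Fin (k + 1), Lp ℂ 2 ((μ j.castSucc).prod (μ j.succ))),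
    kernelOp (schurLp μ f (prodLinf μ a)) = compOp k μ a f := by
  intro k
  induction k with
  | zero =>
    intro X _ μ _ a f
    refine kernelOp_eq_mulOp_comp (a 0) (a 1) (f 0) _ ?_
    filter_upwards [coeFn_schurLp μ (prodLinf μ a) f, schurKernel_prodLinf μ a f] with p h1 h2
    rw [h1, h2, elemKernel, Measure.pi_of_empty, integral_dirac']
    · rw [elemIntegrand, pathProd, Fin.prod_univ_one, Fin.prod_univ_two]
      rfl
    · exact (stronglyMeasurable_elemIntegrand μ a f).comp_measurable
        (measurable_fillIn.comp (measurable_const.prodMk measurable_id))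
  | succ k ih =>
    intro X _ μ _ a f
    have ih' := ih (fun i => μ i.succ) (fun i => a i.succ) fun j => f j.succ
    rw [compOp, ← ih']
    have h := coeFn_schurLp_prodLinf (fun i => μ i.succ) (fun i => a i.succ) fun j => f j.succ
    refine kernelOp_eq_comp_of_ae (a 0) (f 0) _ _ _ h ?_
    filter_upwards [coeFn_schurLp_prodLinf μ a f, integrable_elemIntegrand μ a f] with p h1 h2
    exact h1.trans (elemKernel_succ μ a f p h2)

/-! ### Tensor products of operators and vectors -/

theorem adjoint_mapT {H H' K K' : HilbSp.{u}} (A : H →L[ℂ] H') (B : K →L[ℂ] K') :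
    (mapT A B).adjoint = mapT A.adjoint B.adjoint := by
  refine ((ContinuousLinearMap.eq_adjoint_iff _ _).2 fun w z => ?_).symm
  induction w using tensor_induction with
  | hc => exact isClosed_eq (by fun_prop) (by fun_prop)
  | h0 => simp
  | hadd v w hv hw => rw [map_add, inner_add_left, hv, hw, inner_add_left]
  | ht x y =>
    induction z using tensor_induction with
    | hc => exact isClosed_eq (by fun_prop) (by fun_prop)
    | h0 => simp
    | hadd v w hv hw => rw [map_add, inner_add_right, hv, hw, inner_add_right]
    | ht x' y' =>
      rw [mapT_tmulL, mapT_tmulL, inner_tmulL, inner_tmulL, ContinuousLinearMap.adjoint_inner_left,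
        ContinuousLinearMap.adjoint_inner_left]

theorem opTens_comp : ∀ (m : ℕ) (H : Fin (m + 1) → HilbSp.{u}) (A B : ∀ i, H i →L[ℂ] H i),
    opTens m H A ∘L opTens m H B = opTens m H fun i => A i ∘L B i
  | 0, _, _, _ => rfl
  | m + 1, H, A, B => by
    refine ContinuousLinearMap.ext fun w => (mapT_mapT _ _ _ _ w).trans ?_
    exact congrArg (fun T => mapT (A 0 ∘L B 0) T w)
      (opTens_comp m (fun i => H i.succ) (fun i => A i.succ) fun i => B i.succ)

theorem adjoint_opTens : ∀ (m : ℕ) (H : Fin (m + 1) → HilbSp.{u}) (A : ∀ i, H i →L[ℂ] H i),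
    (opTens m H A).adjoint = opTens m H fun i => (A i).adjoint
  | 0, _, _ => rfl
  | m + 1, H, A =>
    (adjoint_mapT (A 0) (opTens m (fun i => H i.succ) fun i => A i.succ)).trans
      (congrArg (mapT (A 0).adjoint) (adjoint_opTens m (fun i => H i.succ) fun i => A i.succ))

/-- The elementary tensor `x₀ ⊗ x₁ ⊗ ⋯ ⊗ xₘ`. -/
def vecTens : (m : ℕ) → (H : Fin (m + 1) → HilbSp.{u}) → (∀ i, H i) → tens m H
  | 0, _, x => x 0
  | m + 1, H, x => tmulL (H 0) (tens m fun i => H i.succ) (x 0)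
      (vecTens m (fun i => H i.succ) fun i => x i.succ)

theorem opTens_vecTens : ∀ (m : ℕ) (H : Fin (m + 1) → HilbSp.{u}) (A : ∀ i, H i →L[ℂ] H i)
    (x : ∀ i, H i), opTens m H A (vecTens m H x) = vecTens m H fun i => A i (x i)
  | 0, _, _, _ => rfl
  | m + 1, H, A, x =>
    (mapT_tmulL (A 0) (opTens m (fun i => H i.succ) fun i => A i.succ) (x 0) _).trans
      (congrArg (tmulL (H 0) (tens m fun i => H i.succ) (A 0 (x 0)))
        (opTens_vecTens m (fun i => H i.succ) (fun i => A i.succ) fun i => x i.succ))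

theorem norm_vecTens : ∀ (m : ℕ) (H : Fin (m + 1) → HilbSp.{u}) (x : ∀ i, H i),
    ‖vecTens m H x‖ = ∏ i, ‖x i‖
  | 0, H, x => by rw [Fin.prod_univ_one]; rfl
  | m + 1, H, x => by
    rw [Fin.prod_univ_succ, ← norm_vecTens m (fun i => H i.succ) fun i => x i.succ]
    exact norm_tmulL (H := H 0) (K := tens m fun i => H i.succ) _ _

theorem tmulL_smul_smul {H K : HilbSp.{u}} (c d : ℂ) (x : H) (y : K) :
    tmulL H K (c • x) (d • y) = (c * d) • tmulL H K x y := by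
  rw [map_smul, map_smul, smul_apply, smul_smul, mul_comm]

theorem vecTens_smul : ∀ (m : ℕ) (H : Fin (m + 1) → HilbSp.{u}) (c : Fin (m + 1) → ℂ)
    (x : ∀ i, H i), vecTens m H (fun i => c i • x i) = (∏ i, c i) • vecTens m H x
  | 0, H, c, x => by rw [Fin.prod_univ_one]; rfl
  | m + 1, H, c, x => by
    rw [Fin.prod_univ_succ]
    exact (congrArg (tmulL (H 0) (tens m fun i => H i.succ) (c 0 • x 0))
      (vecTens_smul m (fun i => H i.succ) (fun i => c i.succ) fun i => x i.succ)).trans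
        (tmulL_smul_smul _ _ _ _)

/-! ### Step functions -/

section

variable {X : Type*} [MeasurableSpace X] {κ : Type*} [Fintype κ] [MeasurableSpace κ]
  [MeasurableSingletonClass κ] (μ : Measure X) {g : X → κ}

theorem memLp_stepFn (hg : Measurable g) (φ : κ → ℂ) : MemLp (fun x => φ (g x)) ∞ μ :=
  memLp_top_of_bound ((measurable_of_finite φ).comp hg).aestronglyMeasurable ‖φ‖
    (Filter.Eventually.of_forall fun _ => norm_le_pi_norm φ _)

variable (hg : Measurable g)

/-- The function `φ ∘ g` as an element of `L^∞`, where `g` takes finitely many values. -/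
def stepFn (φ : κ → ℂ) : Lp ℂ ∞ μ := (memLp_stepFn μ hg φ).toLp

theorem coeFn_stepFn (φ : κ → ℂ) : stepFn μ hg φ =ᵐ[μ] fun x => φ (g x) :=
  MemLp.coeFn_toLp (memLp_stepFn μ hg φ)

theorem stepFn_add (φ ψ : κ → ℂ) : stepFn μ hg (φ + ψ) = stepFn μ hg φ + stepFn μ hg ψ := rfl

theorem stepFn_smul (c : ℂ) (φ : κ → ℂ) : stepFn μ hg (c • φ) = c • stepFn μ hg φ := rfl

/-- `stepFn` as a linear map. -/
def stepFnₗ : (κ → ℂ) →ₗ[ℂ] Lp ℂ ∞ μ where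
  toFun := stepFn μ hg
  map_add' := stepFn_add μ hg
  map_smul' := stepFn_smul μ hg

theorem stepFn_mul (φ ψ : κ → ℂ) : stepFn μ hg φ * stepFn μ hg ψ = stepFn μ hg (φ * ψ) := by
  apply Lp.ext
  filter_upwards [Linf.coeFn_mul (stepFn μ hg φ) (stepFn μ hg ψ), coeFn_stepFn μ hg φ,
    coeFn_stepFn μ hg ψ, coeFn_stepFn μ hg (φ * ψ)] with x h1 h2 h3 h4
  rw [h1, h2, h3, h4, Pi.mul_apply]

theorem star_stepFn (φ : κ → ℂ) : star (stepFn μ hg φ) = stepFn μ hg (star φ) := by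
  apply Lp.ext
  filter_upwards [Lp.coeFn_star (stepFn μ hg φ), coeFn_stepFn μ hg φ,
    coeFn_stepFn μ hg (star φ)] with x h1 h2 h3
  rw [h1, h3, Pi.star_apply, h2, Pi.star_apply]

/-- If `g = v` on a set of positive measure, the operators `M_{φ ∘ g}` have a common nonzero
eigenvector, with eigenvalues `φ v`. -/
theorem exists_mulOp_stepFn_eq_smul [SigmaFinite μ] {v : κ} (hv : μ (g ⁻¹' {v}) ≠ 0) :
    ∃ ξ : Lp ℂ 2 μ, ξ ≠ 0 ∧ ∀ φ, mulOp (stepFn μ hg φ) ξ = φ v • ξ := by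
  obtain ⟨E, hE, hEm, h0, hlt⟩ :=
    Measure.exists_subset_measure_lt_top (hg (measurableSet_singleton v)) (pos_iff_ne_zero.2 hv)
  refine ⟨indicatorConstLp 2 hE hlt.ne 1, ?_, fun φ => ?_⟩
  · rw [Ne, ← norm_eq_zero, norm_indicatorConstLp (by norm_num) (by norm_num)]
    simp only [norm_one, one_mul]
    exact (Real.rpow_pos_of_pos (ENNReal.toReal_pos h0.ne' hlt.ne) _).ne'
  · apply Lp.ext
    filter_upwards [coeFn_mulOp (stepFn μ hg φ) (indicatorConstLp 2 hE hlt.ne 1),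
      coeFn_stepFn μ hg φ,
      indicatorConstLp_coeFn (p := 2) (hs := hE) (hμs := hlt.ne) (c := (1 : ℂ)),
      Lp.coeFn_smul (φ v) (indicatorConstLp 2 hE hlt.ne (1 : ℂ))] with x h1 h2 h3 h4
    rw [h1, h2, h4, Pi.smul_apply, h3]
    by_cases hx : x ∈ E
    · rw [show g x = v from hEm hx]
      rfl
    · simp [Set.indicator_of_notMem hx]

variable [DecidableEq κ]

theorem stepFn_eq_sum (φ : κ → ℂ) :
    stepFn μ hg φ = ∑ v, φ v • stepFn μ hg (Pi.single v 1) := by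
  have h : φ = ∑ v, φ v • (Pi.single v 1 : κ → ℂ) := by
    ext w
    simp [Pi.single_apply]
  conv_lhs => rw [h]
  change stepFnₗ μ hg _ = ∑ v, φ v • stepFnₗ μ hg _
  rw [map_sum]
  simp only [map_smul]

theorem stepFn_single_eq_zero {v : κ} (hv : μ (g ⁻¹' {v}) = 0) :
    stepFn μ hg (Pi.single v 1) = 0 := by
  apply Lp.ext
  filter_upwards [coeFn_stepFn μ hg (Pi.single v 1), Lp.coeFn_zero ℂ ∞ μ,
    measure_eq_zero_iff_ae_notMem.1 hv] with x h1 h2 h3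
  rw [h1, h2, Pi.single_eq_of_ne h3]
  rfl

end

/-! ### The minimal norm on tensor products of `L^∞`-spaces -/

/-- A combination of mutually orthogonal projections has norm at most the largest coefficient. -/
theorem norm_sum_smul_le_of_orthogonal {B : Type*} [NonUnitalCStarAlgebra B] {Λ : Type*}
    [Fintype Λ] [DecidableEq Λ] (Q : Λ → B) (hs : ∀ v, star (Q v) = Q v)
    (hm : ∀ v w, Q v * Q w = if v = w then Q v else 0) (c : Λ → ℂ) :
    ‖∑ v, c v • Q v‖ ≤ ‖c‖ := by
  let Ψ : (Λ → ℂ) →⋆ₙₐ[ℂ] B :=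
    { toFun := fun c => ∑ v, c v • Q v
      map_smul' := fun a c => by simp [Finset.smul_sum, smul_smul]
      map_zero' := by simp
      map_add' := fun c d => by simp [add_smul, Finset.sum_add_distrib]
      map_mul' := fun c d => by
        simp [Finset.sum_mul, Finset.mul_sum, smul_mul_assoc, mul_smul_comm, hm, smul_smul,
          mul_comm]
      map_star' := fun c => by simp [star_sum, hs] }
  exact NonUnitalStarAlgHom.norm_apply_le Ψ c

theorem norm_Linf_le {Y : Type*} [MeasurableSpace Y] {ν : Measure Y} {f : Lp ℂ ∞ ν} {C : ℝ}
    (hC : 0 ≤ C) (h : ∀ᵐ y ∂ν, ‖f y‖ ≤ C) : ‖f‖ ≤ C := by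
  rw [Lp.norm_def, eLpNorm_exponent_top]
  exact ENNReal.toReal_le_of_le_ofReal hC (eLpNormEssSup_le_of_ae_bound h)

theorem ae_norm_coeFn_le {Y : Type*} [MeasurableSpace Y] {ν : Measure Y} (f : Lp ℂ ∞ ν) :
    ∀ᵐ y ∂ν, ‖f y‖ ≤ ‖f‖ :=
  (ae_enorm_coeFn_le f).mono fun _ => enorm_le_iff_norm_le.1

theorem algRep_tprod {m : ℕ} {A : Fin (m + 1) → Type u} [∀ i, NonUnitalCStarAlgebra (A i)]
    {H : Fin (m + 1) → HilbSp.{u}} (π : ∀ i, A i →⋆ₙₐ[ℂ] (H i →L[ℂ] H i)) (a : ∀ i, A i) :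
    algRep π (PiTensorProduct.tprod ℂ a) = opTens m H fun i => π i (a i) := by
  rw [algRep, PiTensorProduct.lift.tprod]
  rfl

section

variable {m : ℕ} {X : Fin (m + 1) → Type u} [∀ i, MeasurableSpace (X i)] (μ : ∀ i, Measure (X i))
  {κ : Type*} [Fintype κ] [MeasurableSpace κ] [MeasurableSingletonClass κ]
  {g : ∀ i, X i → κ} (hg : ∀ i, Measurable (g i))

/-- The element `∑ᵣ (φ r 0 ∘ g₀) ⊗ ⋯ ⊗ (φ r m ∘ gₘ)` of the algebraic tensor product of the spaces
`L^∞(Xᵢ)`. -/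
def stepTensor {N : ℕ} (φ : Fin N → Fin (m + 1) → κ → ℂ) :
    PiTensorProduct ℂ fun i => Lp ℂ ∞ (μ i) :=
  ∑ r, PiTensorProduct.tprod ℂ fun i => stepFn (μ i) (hg i) (φ r i)

/-- The value of the function given by `stepTensor` on the set where `gᵢ = vᵢ` for all `i`. -/
def stepValue {N : ℕ} (φ : Fin N → Fin (m + 1) → κ → ℂ) (v : Fin (m + 1) → κ) : ℂ :=
  ∑ r, ∏ i, φ r i (v i)

section

variable [DecidableEq κ]

/-- The projection `⊗ᵢ πᵢ(1_{gᵢ = vᵢ})`. -/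
def cellProj {H : Fin (m + 1) → HilbSp.{u}} (π : ∀ i, Lp ℂ ∞ (μ i) →⋆ₙₐ[ℂ] (H i →L[ℂ] H i))
    (v : Fin (m + 1) → κ) : tens m H →L[ℂ] tens m H :=
  opTens m H fun i => π i (stepFn (μ i) (hg i) (Pi.single (v i) 1))

variable {H : Fin (m + 1) → HilbSp.{u}} (π : ∀ i, Lp ℂ ∞ (μ i) →⋆ₙₐ[ℂ] (H i →L[ℂ] H i))

theorem star_cellProj (v : Fin (m + 1) → κ) :
    star (cellProj μ hg π v) = cellProj μ hg π v := by
  rw [ContinuousLinearMap.star_eq_adjoint, cellProj, adjoint_opTens]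
  congr 1
  ext1 i
  rw [← ContinuousLinearMap.star_eq_adjoint, ← map_star, star_stepFn]
  congr 2
  ext w
  simp only [Pi.star_apply, Pi.single_apply]
  split_ifs <;> simp

theorem cellProj_mul (v w : Fin (m + 1) → κ) :
    cellProj μ hg π v * cellProj μ hg π w = if v = w then cellProj μ hg π v else 0 := by
  refine (opTens_comp m H _ _).trans ?_
  have h : ∀ i, π i (stepFn (μ i) (hg i) (Pi.single (v i) 1)) ∘L
      π i (stepFn (μ i) (hg i) (Pi.single (w i) 1)) =
      π i (stepFn (μ i) (hg i) (Pi.single (v i) 1 * Pi.single (w i) 1)) := fun i => by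
    rw [← stepFn_mul, map_mul]
    rfl
  simp only [h]
  split_ifs with hvw
  · subst hvw
    rw [cellProj]
    congr 1
    ext1 i
    congr 2
    rw [← Pi.single_mul, one_mul]
  · obtain ⟨i, hi⟩ := Function.ne_iff.1 hvw
    refine (opTens m H).map_coord_zero i ?_
    have h0 : (Pi.single (v i) 1 * Pi.single (w i) 1 : κ → ℂ) = 0 := by
      ext x
      by_cases hx : x = v i
      · subst hx
        simp [hi]
      · simp [Pi.single_apply, hx]
    rw [h0]
    exact (congrArg (π i) (map_zero (stepFnₗ (μ i) (hg i)))).trans (map_zero _)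

theorem cellProj_eq_zero {v : Fin (m + 1) → κ} {i : Fin (m + 1)}
    (h : μ i (g i ⁻¹' {v i}) = 0) : cellProj μ hg π v = 0 := by
  refine (opTens m H).map_coord_zero i ?_
  rw [stepFn_single_eq_zero (μ i) (hg i) h, map_zero]

theorem algRep_stepTensor {N : ℕ} (φ : Fin N → Fin (m + 1) → κ → ℂ) :
    algRep π (stepTensor μ hg φ) = ∑ v, stepValue φ v • cellProj μ hg π v := by
  rw [stepTensor, map_sum]
  have h : ∀ r, algRep π (PiTensorProduct.tprod ℂ fun i => stepFn (μ i) (hg i) (φ r i)) =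
      ∑ v : Fin (m + 1) → κ, (∏ i, φ r i (v i)) • cellProj μ hg π v := fun r => by
    rw [algRep_tprod]
    have h1 : ∀ i, π i (stepFn (μ i) (hg i) (φ r i)) =
        ∑ v, φ r i v • π i (stepFn (μ i) (hg i) (Pi.single v 1)) := fun i => by
      conv_lhs => rw [stepFn_eq_sum, map_sum]
      simp only [map_smul]
    simp only [h1]
    rw [MultilinearMap.map_sum]
    exact Finset.sum_congr rfl fun v _ => (opTens m H).map_smul_univ _ _
  simp only [h]
  rw [Finset.sum_comm]
  simp only [stepValue, Finset.sum_smul]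

/-- In every representation, the norm of a step tensor is at most the supremum of its values on the
cells of positive measure: the projections of the other cells vanish. -/
theorem norm_algRep_stepTensor_le {N : ℕ} (φ : Fin N → Fin (m + 1) → κ → ℂ) {C : ℝ} (hC : 0 ≤ C)
    (h : ∀ v, (∀ i, μ i (g i ⁻¹' {v i}) ≠ 0) → ‖stepValue φ v‖ ≤ C) :
    ‖algRep π (stepTensor μ hg φ)‖ ≤ C := by
  classical
  rw [algRep_stepTensor]
  have h1 : ∑ v, stepValue φ v • cellProj μ hg π v =
      ∑ v, (if ∀ i, μ i (g i ⁻¹' {v i}) ≠ 0 then stepValue φ v else 0) • cellProj μ hg π v := by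
    refine Finset.sum_congr rfl fun v _ => ?_
    split_ifs with hv
    · rfl
    · push Not at hv
      obtain ⟨i, hi⟩ := hv
      rw [cellProj_eq_zero μ hg π hi, smul_zero, smul_zero]
  rw [h1]
  refine (norm_sum_smul_le_of_orthogonal _ (star_cellProj μ hg π) (cellProj_mul μ hg π) _).trans ?_
  refine (pi_norm_le_iff_of_nonneg hC).2 fun v => ?_
  split_ifs with hv
  · exact h v hv
  · rwa [norm_zero]

end

variable [∀ i, SigmaFinite (μ i)]

/-- In the representation on the spaces `L²(Xᵢ)`, the values of a step tensor on cells of positive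
measure are eigenvalues. -/
theorem norm_stepValue_le_norm_algRep {N : ℕ}
    (φ : Fin N → Fin (m + 1) → κ → ℂ) {v : Fin (m + 1) → κ}
    (hv : ∀ i, μ i (g i ⁻¹' {v i}) ≠ 0) :
    ‖stepValue φ v‖ ≤
      ‖algRep (H := fun i => l2Sp (μ i)) (fun i => mulRep (μ i)) (stepTensor μ hg φ)‖ := by
  choose ξ h0 hξ using fun i => exists_mulOp_stepFn_eq_smul (μ i) (hg i) (hv i)
  have h1 : algRep (H := fun i => l2Sp (μ i)) (fun i => mulRep (μ i)) (stepTensor μ hg φ)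
      (vecTens m (fun i => l2Sp (μ i)) ξ) =
      stepValue φ v • vecTens m (fun i => l2Sp (μ i)) ξ := by
    rw [stepTensor, map_sum, stepValue, Finset.sum_smul, sum_apply]
    refine Finset.sum_congr rfl fun r _ => ?_
    rw [algRep_tprod, opTens_vecTens, ← vecTens_smul]
    congr 1
    ext1 i
    exact hξ i (φ r i)
  have h2 : 0 < ‖vecTens m (fun i => l2Sp (μ i)) ξ‖ := by
    rw [norm_vecTens]
    exact Finset.prod_pos fun i _ => norm_pos_iff.2 (h0 i)
  have h3 := ContinuousLinearMap.le_opNorm (algRep (H := fun i => l2Sp (μ i))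
    (fun i => mulRep (μ i)) (stepTensor μ hg φ)) (vecTens m (fun i => l2Sp (μ i)) ξ)
  rw [h1, norm_smul] at h3
  exact le_of_mul_le_mul_right h3 h2

/-- The linear map `a₀ ⊗ ⋯ ⊗ aₘ ↦ ((x₀, …, xₘ) ↦ a₀(x₀) ⋯ aₘ(xₘ))`. -/
def prodLin : PiTensorProduct ℂ (fun i => Lp ℂ ∞ (μ i)) →ₗ[ℂ] Lp ℂ ∞ (Measure.pi μ) :=
  PiTensorProduct.lift (prodLinf μ)

theorem coeFn_prodLin_stepTensor {N : ℕ} (φ : Fin N → Fin (m + 1) → κ → ℂ) :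
    prodLin μ (stepTensor μ hg φ) =ᵐ[Measure.pi μ] fun x => stepValue φ fun i => g i (x i) := by
  have h : prodLin μ (stepTensor μ hg φ) =
      ∑ r, prodLinf μ fun i => stepFn (μ i) (hg i) (φ r i) := by
    rw [stepTensor, map_sum]
    exact Finset.sum_congr rfl fun r _ => PiTensorProduct.lift.tprod _
  rw [h]
  filter_upwards [Lp.coeFn_finsetSum Finset.univ
      fun r => prodLinf μ fun i => stepFn (μ i) (hg i) (φ r i),
    ae_all_iff.2 fun r => coeFn_prodLinf μ fun i => stepFn (μ i) (hg i) (φ r i),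
    ae_all_iff.2 fun r => ae_all_iff.2 fun i => ae_pi_of_ae μ (coeFn_stepFn (μ i) (hg i) (φ r i))]
    with x h1 h2 h3
  rw [h1, Finset.sum_apply, stepValue]
  refine Finset.sum_congr rfl fun r _ => (h2 r).trans ?_
  exact Finset.prod_congr rfl fun i _ => h3 r i

/-- A cell that is a product of sets of positive measure has positive measure, so the value on it
counts for the norm in `L^∞`. -/
theorem norm_stepValue_le_norm_prodLin {N : ℕ} (φ : Fin N → Fin (m + 1) → κ → ℂ)
    {v : Fin (m + 1) → κ} (hv : ∀ i, μ i (g i ⁻¹' {v i}) ≠ 0) :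
    ‖stepValue φ v‖ ≤ ‖prodLin μ (stepTensor μ hg φ)‖ := by
  by_contra hlt
  have h0 : Measure.pi μ (Set.univ.pi fun i => g i ⁻¹' {v i}) = 0 := by
    refine measure_eq_zero_iff_ae_notMem.2 ?_
    filter_upwards [coeFn_prodLin_stepTensor μ hg φ,
      ae_norm_coeFn_le (prodLin μ (stepTensor μ hg φ))] with x h1 h2 hx
    have h3 : (fun i => g i (x i)) = v := funext fun i => hx i (Set.mem_univ i)
    rw [h1, h3] at h2
    exact hlt h2
  rw [Measure.pi_pi, Finset.prod_eq_zero_iff] at h0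
  obtain ⟨i, -, hi⟩ := h0
  exact hv i hi

theorem norm_prodLin_stepTensor_le {N : ℕ} (φ : Fin N → Fin (m + 1) → κ → ℂ) {C : ℝ} (hC : 0 ≤ C)
    (h : ∀ v, (∀ i, μ i (g i ⁻¹' {v i}) ≠ 0) → ‖stepValue φ v‖ ≤ C) :
    ‖prodLin μ (stepTensor μ hg φ)‖ ≤ C := by
  refine norm_Linf_le hC ?_
  have h1 : ∀ i, ∀ᵐ y ∂μ i, μ i (g i ⁻¹' {g i y}) ≠ 0 := fun i => by
    have : ∀ᵐ y ∂μ i, ∀ w : κ, μ i (g i ⁻¹' {w}) = 0 → y ∉ g i ⁻¹' {w} :=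
      ae_all_iff.2 fun w => by
        by_cases hw : μ i (g i ⁻¹' {w}) = 0
        · exact (measure_eq_zero_iff_ae_notMem.1 hw).mono fun y hy _ => hy
        · exact Filter.Eventually.of_forall fun y hy => absurd hy hw
    exact this.mono fun y hy h0 => hy _ h0 rfl
  filter_upwards [coeFn_prodLin_stepTensor μ hg φ, ae_all_iff.2 fun i => ae_pi_of_ae μ (h1 i)]
    with x h2 h3
  rw [h2]
  exact h _ h3

end

/-! ### Density of step functions and the embedding of the minimal tensor product -/

/-- Functions `a₀, …, a_{N-1}` in `L^∞` are approximated by step functions with values in an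
`ε`-net of a ball of `ℂᴺ`. -/
theorem exists_norm_sub_stepFn_le {Y : Type*} [MeasurableSpace Y] {ν : Measure Y} {N K : ℕ}
    {ε M : ℝ} (hε : 0 ≤ ε) {e : ℕ → Fin N → ℂ}
    (he : ∀ z : Fin N → ℂ, ‖z‖ ≤ M → ∃ n ≤ K, ‖e n - z‖ ≤ ε) (hM : 0 ≤ M)
    (a : Fin N → Lp ℂ ∞ ν) (ha : ∀ r, ‖a r‖ ≤ M) :
    ∃ (g : Y → Fin (K + 1)) (hg : Measurable g),
      ∀ r, ‖a r - stepFn ν hg fun n => e n r‖ ≤ ε := by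
  have hm : Measurable fun y r => a r y :=
    measurable_pi_lambda _ fun r => (Lp.stronglyMeasurable (a r)).measurable
  -- `g y` is the index of the first point of the net that is nearest to `(a₀(y), …, a_{N-1}(y))`.
  let ind := SimpleFunc.nearestPtInd e K
  have hle : ∀ z, ind z < K + 1 := fun z => Nat.lt_succ_of_le (SimpleFunc.nearestPtInd_le e K z)
  have hg : Measurable fun y => (⟨ind fun r => a r y, hle _⟩ : Fin (K + 1)) := by
    refine measurable_to_countable' fun n => ?_
    convert (ind.measurable.comp hm) (measurableSet_singleton (n : ℕ)) using 1
    ext y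
    simp [Fin.ext_iff]
  refine ⟨_, hg, fun r => norm_Linf_le hε ?_⟩
  filter_upwards [Lp.coeFn_sub (a r) (stepFn ν hg fun n => e n r),
    coeFn_stepFn ν hg fun n => e n r, ae_all_iff.2 fun r => ae_norm_coeFn_le (a r)] with y h1 h2 h3
  rw [h1, Pi.sub_apply, h2]
  obtain ⟨n, hn, hz⟩ := he (fun r => a r y)
    ((pi_norm_le_iff_of_nonneg hM).2 fun r => (h3 r).trans (ha r))
  have h4 := SimpleFunc.edist_nearestPt_le e (fun r => a r y) hn
  rw [edist_dist, edist_dist, ENNReal.ofReal_le_ofReal_iff dist_nonneg, dist_eq_norm,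
    dist_eq_norm] at h4
  rw [norm_sub_rev]
  exact (norm_le_pi_norm (SimpleFunc.nearestPt e K (fun r => a r y) - fun r => a r y) r).trans
    (h4.trans hz)

/-- A ball of `ℂᴺ` has a finite `ε`-net. -/
theorem exists_finite_net {N : ℕ} (M : ℝ) {ε : ℝ} (hε : 0 < ε) :
    ∃ (K : ℕ) (e : ℕ → Fin N → ℂ), ∀ z : Fin N → ℂ, ‖z‖ ≤ M → ∃ n ≤ K, ‖e n - z‖ ≤ ε := by
  obtain ⟨t, ht, hc⟩ := Metric.totallyBounded_iff.1
    (isCompact_closedBall (0 : Fin N → ℂ) M).totallyBounded ε hε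
  refine ⟨ht.toFinset.card, fun n => ht.toFinset.toList.getD n 0, fun z hz => ?_⟩
  obtain ⟨w, hw, hd⟩ := Set.mem_iUnion₂.1 (hc (mem_closedBall_zero_iff.2 hz))
  obtain ⟨n, hn, rfl⟩ := List.getElem_of_mem
    (Finset.mem_toList.2 (ht.mem_toFinset.2 hw))
  refine ⟨n, (by simpa using hn.le), ?_⟩
  beta_reduce
  rw [List.getD_eq_getElem _ _ hn, ← dist_eq_norm, dist_comm]
  exact (Metric.mem_ball.1 hd).le

section

variable {m : ℕ} {X : Fin (m + 1) → Type u} [∀ i, MeasurableSpace (X i)] (μ : ∀ i, Measure (X i))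

/-- A closed property of `N`-tuples of elementary tensors holds everywhere if it holds for tuples
of step functions. -/
theorem stepFn_induction {N : ℕ} {p : (Fin N → ∀ i, Lp ℂ ∞ (μ i)) → Prop}
    (hc : IsClosed {a | p a})
    (h : ∀ (K : ℕ) (g : ∀ i, X i → Fin (K + 1)) (hg : ∀ i, Measurable (g i))
      (φ : Fin N → Fin (m + 1) → Fin (K + 1) → ℂ), p fun r i => stepFn (μ i) (hg i) (φ r i))
    (a : Fin N → ∀ i, Lp ℂ ∞ (μ i)) : p a := by
  refine hc.closure_subset (Metric.mem_closure_iff.2 fun ε hε => ?_)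
  -- One net serves all spaces, so that all step functions have the same index set of values.
  obtain ⟨K, e, he⟩ := exists_finite_net (N := N) ‖a‖ (half_pos hε)
  choose g hg hle using fun i => exists_norm_sub_stepFn_le (half_pos hε).le he (norm_nonneg a)
    (fun r => a r i) fun r => (norm_le_pi_norm (a r) i).trans (norm_le_pi_norm a r)
  refine ⟨_, h K g hg fun r i n => e n r, lt_of_le_of_lt ?_ (half_lt_self hε)⟩
  refine (dist_pi_le_iff (half_pos hε).le).2 fun r =>
    (dist_pi_le_iff (half_pos hε).le).2 fun i => ?_
  rw [dist_eq_norm]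
  exact hle i r

theorem exists_eq_sum_tprod {A : Fin (m + 1) → Type u} [∀ i, AddCommGroup (A i)]
    [∀ i, Module ℂ (A i)] (u : PiTensorProduct ℂ A) :
    ∃ (N : ℕ) (a : Fin N → ∀ i, A i), u = ∑ r, PiTensorProduct.tprod ℂ (a r) := by
  induction u using PiTensorProduct.induction_on with
  | smul_tprod c a =>
    refine ⟨1, fun _ => Function.update a 0 (c • a 0), ?_⟩
    rw [Fin.sum_univ_one, MultilinearMap.map_update_smul, Function.update_eq_self]
  | add x y hx hy =>
    obtain ⟨N, a, rfl⟩ := hx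
    obtain ⟨N', b, rfl⟩ := hy
    refine ⟨N + N', Fin.append a b, ?_⟩
    simp [Fin.sum_univ_add]

variable {μ} in
theorem continuous_algRep_sum_tprod {N : ℕ} {H : Fin (m + 1) → HilbSp.{u}}
    (π : ∀ i, Lp ℂ ∞ (μ i) →⋆ₙₐ[ℂ] (H i →L[ℂ] H i)) :
    Continuous fun a : Fin N → ∀ i, Lp ℂ ∞ (μ i) =>
      algRep π (∑ r, PiTensorProduct.tprod ℂ (a r)) := by
  simp only [map_sum, algRep_tprod]
  have hc : Continuous (opTens m H) := (opTens m H).continuous_of_bound 1 fun B => by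
    rw [one_mul]
    exact opTens_norm_le m H B
  refine continuous_finsetSum _ fun r _ => hc.comp (continuous_pi fun i => ?_)
  have h1 : Continuous (π i) :=
    AddMonoidHomClass.continuous_of_bound (π i) 1 fun a => by
      rw [one_mul]
      exact NonUnitalStarAlgHom.norm_apply_le (π i) a
  exact h1.comp ((continuous_apply i).comp (continuous_apply r))

variable [∀ i, SigmaFinite (μ i)]

theorem norm_prodLinf_le (a : ∀ i, Lp ℂ ∞ (μ i)) : ‖prodLinf μ a‖ ≤ ∏ i, ‖a i‖ := by
  refine norm_Linf_le (Finset.prod_nonneg fun i _ => norm_nonneg _) ?_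
  filter_upwards [coeFn_prodLinf μ a, ae_all_iff.2 fun i => ae_pi_of_ae μ (ae_norm_coeFn_le (a i))]
    with x h1 h2
  rw [h1, norm_prod]
  gcongr with i
  exact h2 i

theorem continuous_prodLin_sum_tprod {N : ℕ} :
    Continuous fun a : Fin N → ∀ i, Lp ℂ ∞ (μ i) =>
      prodLin μ (∑ r, PiTensorProduct.tprod ℂ (a r)) := by
  have h : ∀ a, prodLin μ (PiTensorProduct.tprod ℂ a) = prodLinf μ a := fun a =>
    PiTensorProduct.lift.tprod a
  simp only [map_sum, h]
  have hc : Continuous (prodLinf μ) := (prodLinf μ).continuous_of_bound 1 fun a => by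
    rw [one_mul]
    exact norm_prodLinf_le μ a
  exact continuous_finsetSum _ fun r _ => hc.comp (continuous_apply r)

theorem norm_algRep_le_norm_prodLin {H : Fin (m + 1) → HilbSp.{u}}
    (π : ∀ i, Lp ℂ ∞ (μ i) →⋆ₙₐ[ℂ] (H i →L[ℂ] H i))
    (u : PiTensorProduct ℂ fun i => Lp ℂ ∞ (μ i)) : ‖algRep π u‖ ≤ ‖prodLin μ u‖ := by
  obtain ⟨N, a, rfl⟩ := exists_eq_sum_tprod u
  induction a using stepFn_induction μ with
  | hc =>
    exact isClosed_le (continuous_algRep_sum_tprod π).norm (continuous_prodLin_sum_tprod μ).norm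
  | h K g hg φ =>
    exact norm_algRep_stepTensor_le μ hg π φ (norm_nonneg _) fun v hv =>
      norm_stepValue_le_norm_prodLin μ hg φ hv

theorem norm_prodLin_le_norm_algRep (u : PiTensorProduct ℂ fun i => Lp ℂ ∞ (μ i)) :
    ‖prodLin μ u‖ ≤ ‖algRep (H := fun i => l2Sp (μ i)) (fun i => mulRep (μ i)) u‖ := by
  obtain ⟨N, a, rfl⟩ := exists_eq_sum_tprod u
  induction a using stepFn_induction μ with
  | hc =>
    exact isClosed_le (continuous_prodLin_sum_tprod μ).norm
      (continuous_algRep_sum_tprod (H := fun i => l2Sp (μ i)) fun i => mulRep (μ i)).norm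
  | h K g hg φ =>
    exact norm_prodLin_stepTensor_le μ hg φ (norm_nonneg _) fun v hv =>
      norm_stepValue_le_norm_algRep μ hg φ hv

/-- The minimal norm is the norm of the associated function in `L^∞`. -/
theorem minNorm_eq_norm_prodLin (u : PiTensorProduct ℂ fun i => Lp ℂ ∞ (μ i)) :
    minNorm u = ‖prodLin μ u‖ :=
  le_antisymm (minNorm_le (norm_nonneg _) fun _ π => norm_algRep_le_norm_prodLin μ π u)
    ((norm_prodLin_le_norm_algRep μ u).trans (norm_algRep_le_minNorm _ u))

/-- `prodLin` as an isometry for the minimal norm. -/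
def algEmbed : AlgTensor (fun i => Lp ℂ ∞ (μ i)) →ₗᵢ[ℂ] Lp ℂ ∞ (Measure.pi μ) where
  toLinearMap := prodLin μ ∘ₗ (AlgTensor.of fun i => Lp ℂ ∞ (μ i)).symm.toLinearMap
  norm_map' u := (minNorm_eq_norm_prodLin μ ((AlgTensor.of fun i => Lp ℂ ∞ (μ i)).symm u)).symm

/-- The isometric embedding of the minimal tensor product of the spaces `L^∞(Xᵢ)` into
`L^∞(X₀ × ⋯ × Xₘ)`. -/
def minEmbed : MinTensor (fun i => Lp ℂ ∞ (μ i)) →ₗᵢ[ℂ] Lp ℂ ∞ (Measure.pi μ) where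
  toLinearMap := (algEmbed μ).toContinuousLinearMap.fromCompletion.toLinearMap
  norm_map' u := by
    induction u using Completion.induction_on with
    | hp => exact isClosed_eq (ContinuousLinearMap.continuous _).norm continuous_norm
    | ih u =>
      rw [Completion.norm_coe]
      refine Eq.trans (congrArg _ ?_) ((algEmbed μ).norm_map u)
      exact ContinuousLinearMap.fromCompletion_apply_coe _ _

theorem minEmbed_tprod (a : ∀ i, Lp ℂ ∞ (μ i)) :
    minEmbed μ (MinTensor.tprod a) = prodLinf μ a :=
  (ContinuousLinearMap.fromCompletion_apply_coe _ _).trans (PiTensorProduct.lift.tprod a)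

end

/-! ### Transport of the Haagerup norm -/

section

variable {D D' R R' : Type*} [NormedAddCommGroup D] [NormedSpace ℂ D] [NormedAddCommGroup D']
  [NormedSpace ℂ D'] [NormedAddCommGroup R] [NormedSpace ℂ R] [NormedAddCommGroup R']
  [NormedSpace ℂ R'] {p q : ℕ}

theorem norm_matrixOp_comp (a : Matrix (Fin p) (Fin q) (D →L[ℂ] R)) (e : D' ≃ₗᵢ[ℂ] D) :
    ‖matrixOp (Matrix.of fun i j => a i j ∘L (e : D' →L[ℂ] D))‖ = ‖matrixOp a‖ := by
  have h : matrixOp (Matrix.of fun i j => a i j ∘L (e : D' →L[ℂ] D)) =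
      matrixOp a ∘L (LinearIsometryEquiv.piLpCongrRight 2 fun _ : Fin q => e :
        PiLp 2 (fun _ : Fin q => D') →L[ℂ] PiLp 2 fun _ : Fin q => D) := by
    ext x i
    simp [matrixOp]
  rw [h, ContinuousLinearMap.opNorm_comp_linearIsometryEquiv]

theorem norm_matrixOp_comp_left (a : Matrix (Fin p) (Fin q) (D →L[ℂ] R)) (e : R ≃ₗᵢ[ℂ] R') :
    ‖matrixOp (Matrix.of fun i j => (e : R →L[ℂ] R') ∘L a i j)‖ = ‖matrixOp a‖ := by
  have h : matrixOp (Matrix.of fun i j => (e : R →L[ℂ] R') ∘L a i j) =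
      (LinearIsometryEquiv.piLpCongrRight 2
        fun _ : Fin p => e).toLinearIsometry.toContinuousLinearMap ∘L matrixOp a := by
    ext x i
    simp [matrixOp]
  rw [h, LinearIsometry.norm_toContinuousLinearMap_comp]

end

section

variable {m : ℕ} {E E' : Fin m → Type*} [∀ k, AddCommGroup (E k)] [∀ k, Module ℂ (E k)]
  [∀ k, AddCommGroup (E' k)] [∀ k, Module ℂ (E' k)]
  {nrm : ∀ k {p q : ℕ}, Matrix (Fin p) (Fin q) (E k) → ℝ}
  {nrm' : ∀ k {p q : ℕ}, Matrix (Fin p) (Fin q) (E' k) → ℝ}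

/-- The Haagerup norm is invariant under linear isomorphisms preserving the matrix norms. -/
theorem haagerupNorm_congr (e : ∀ k, E k ≃ₗ[ℂ] E' k)
    (h : ∀ k {p q : ℕ} (a : Matrix (Fin p) (Fin q) (E k)), nrm' k (a.map (e k)) = nrm k a)
    (u : PiTensorProduct ℂ E) :
    haagerupNorm E' nrm' (PiTensorProduct.congr e u) = haagerupNorm E nrm u := by
  unfold haagerupNorm
  congr 1
  ext r
  constructor
  · rintro ⟨p, a, h0, h1, hu, rfl⟩
    refine ⟨p, fun k => (a k).map (e k).symm, h0, h1, ?_, Finset.prod_congr rfl fun k _ => ?_⟩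
    · apply (PiTensorProduct.congr e).injective
      rw [hu, map_sum]
      simp [PiTensorProduct.congr_tprod]
    · rw [← h, Matrix.map_map]
      congr 1
      ext i j
      simp
  · rintro ⟨p, a, h0, h1, rfl, rfl⟩
    refine ⟨p, fun k => (a k).map (e k), h0, h1, ?_, Finset.prod_congr rfl fun k _ => (h k _).symm⟩
    rw [map_sum]
    simp [PiTensorProduct.congr_tprod]

theorem haagerupNorm_sum_tprod (e : ∀ k, E k ≃ₗ[ℂ] E' k)
    (h : ∀ k {p q : ℕ} (a : Matrix (Fin p) (Fin q) (E k)), nrm' k (a.map (e k)) = nrm k a)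
    {s : ℕ} (f : Fin s → ∀ k, E k) :
    haagerupNorm E' nrm' (∑ r, PiTensorProduct.tprod ℂ fun k => e k (f r k)) =
      haagerupNorm E nrm (∑ r, PiTensorProduct.tprod ℂ (f r)) := by
  rw [← haagerupNorm_congr e h, map_sum]
  simp only [PiTensorProduct.congr_tprod]

end

section

variable {X Y : Type u} [MeasurableSpace X] [MeasurableSpace Y] (μ : Measure X) (ν : Measure Y)
  [SigmaFinite μ] [SigmaFinite ν]

/-- The identification of `L²(X × Y)` with `L²(X) ⊗ L²(Y)`, respectively with its dual. -/
def legEquiv : ∀ b, Lp ℂ 2 (μ.prod ν) ≃ₗ[ℂ] Leg b (l2Sp μ) (l2Sp ν)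
  | true => (tensorL2 μ ν).symm.toLinearEquiv
  | false => legFn

theorem isVecOf_legEquiv {b : Bool} (hb : b = true) (f : Lp ℂ 2 (μ.prod ν)) :
    IsVecOf (legEquiv μ ν b f).vec f := by
  subst hb
  exact (tensorL2 μ ν).apply_symm_apply f

theorem isFnOf_legEquiv {b : Bool} (hb : b = false) (f : Lp ℂ 2 (μ.prod ν)) :
    IsFnOf (legEquiv μ ν b f).fn f := by
  subst hb
  rfl

/-- The matrix norms of `L²(X × Y)` are those of the tensor leg identified with it. -/
theorem matNorm_legEquiv (b : Bool) {p q : ℕ} (a : Matrix (Fin p) (Fin q) (Lp ℂ 2 (μ.prod ν))) :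
    Leg.matNorm (a.map (legEquiv μ ν b)) = ‖matrixOp (Matrix.of fun i j => kernelOp (a j i))‖ := by
  cases b with
  | true =>
    rw [← norm_matrixOp_comp _ (pairing μ).symm]
    have h : ∀ f : Lp ℂ 2 (μ.prod ν), theta (l2Sp μ) (l2Sp ν) ((tensorL2 μ ν).symm f) =
        kernelOp f ∘L ((pairing μ).symm : StrongDual ℂ (Lp ℂ 2 μ) →L[ℂ] Lp ℂ 2 μ) := fun f => by
      refine ContinuousLinearMap.ext fun η => ?_
      obtain ⟨ξ, rfl⟩ := (pairing μ).surjective η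
      rw [theta_pairing]
      simp
    exact congrArg (fun c => ‖matrixOp (Matrix.of c)‖) (funext₂ fun i j => h (a j i))
  | false =>
    rw [← norm_matrixOp_comp_left _ (pairing ν)]
    have h : ∀ f : Lp ℂ 2 (μ.prod ν), thetaDual (l2Sp μ) (l2Sp ν) (legFn f) =
        (pairing ν : Lp ℂ 2 ν →L[ℂ] StrongDual ℂ (Lp ℂ 2 ν)) ∘L kernelOp f := fun f =>
      ContinuousLinearMap.ext fun ξ => thetaDual_legFn f ξ
    exact congrArg (fun c => ‖matrixOp (Matrix.of c)‖) (funext₂ fun i j => h (a j i))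

end

/-! ### Comparison of the two multiplier maps -/

section

variable {m : ℕ} {A : Fin (m + 1) → Type u} [∀ i, NonUnitalCStarAlgebra (A i)]

/-- Continuous linear maps on the minimal tensor product agree if they agree on elementary
tensors. -/
theorem minTensor_ext {E : Type*} [NormedAddCommGroup E] [NormedSpace ℂ E]
    {S T : MinTensor A →L[ℂ] E} (h : ∀ a, S (MinTensor.tprod a) = T (MinTensor.tprod a)) :
    S = T := by
  refine ContinuousLinearMap.ext fun z => ?_
  induction z using Completion.induction_on with
  | hp => exact isClosed_eq S.continuous T.continuous
  | ih z =>
    have h1 : S.toLinearMap ∘ₗ Completion.toComplL.toLinearMap ∘ₗ (AlgTensor.of A).toLinearMap =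
        T.toLinearMap ∘ₗ Completion.toComplL.toLinearMap ∘ₗ (AlgTensor.of A).toLinearMap :=
      PiTensorProduct.ext (MultilinearMap.ext h)
    exact LinearMap.congr_fun h1 ((AlgTensor.of A).symm z)

theorem tensorRep_tprod {H : Fin (m + 1) → HilbSp.{u}} (π : ∀ i, A i →⋆ₙₐ[ℂ] (H i →L[ℂ] H i))
    (a : ∀ i, A i) : tensorRep π (MinTensor.tprod a) = opTens m H fun i => π i (a i) :=
  (ContinuousLinearMap.fromCompletion_apply_coe _ _).trans (algRep_tprod π a)

end

section

variable {k : ℕ} {H : Fin (k + 2) → HilbSp.{u}}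

/-- `schurOpEven φ ζ` as a continuous linear function of `φ`. -/
def schurEvenL (ζ : ∀ j, GammaLeg H j) : (tens (k + 1) H →L[ℂ] tens (k + 1) H) →L[ℂ]
    (StrongDual ℂ (H 0) →L[ℂ] H (Fin.last (k + 1))) :=
  theta (H 0) (H (Fin.last (k + 1))) ∘L
    (mapT (ContinuousLinearMap.id ℂ (H 0))
      (pairContract k (fun i => H i.succ) fun j => (ζ j.succ).fn)) ∘L
    ContinuousLinearMap.apply ℂ _ (pairVec (k + 1) H fun j => (ζ j).vec)

/-- `schurOpOdd φ ζ` as a continuous linear function of `φ`. -/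
def schurOddL (ζ : ∀ j, GammaLeg H j) : (tens (k + 1) H →L[ℂ] tens (k + 1) H) →L[ℂ]
    (H 0 →L[ℂ] H (Fin.last (k + 1))) :=
  (ContinuousLinearMap.compL ℂ (H 0) (tens (k + 1) H) (H (Fin.last (k + 1)))
      (pairContract (k + 1) H fun j => (ζ j).fn)) ∘L
    (ContinuousLinearMap.compL ℂ (H 0) (tens (k + 1) H) (tens (k + 1) H)).flip
      ((tmulL (H 0) (tens k fun i => H i.succ)).flip
        (pairVec k (fun i => H i.succ) fun j => (ζ j.succ).vec))

end

section

variable {k : ℕ} {X : Fin (k + 2) → Type u} [∀ i, MeasurableSpace (X i)]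
  (μ : ∀ i, Measure (X i)) [∀ i, SigmaFinite (μ i)]

/-- The tensor legs corresponding to the kernels `f₀, …, fₖ`. -/
def legs (f : ∀ j : Fin (k + 1), Lp ℂ 2 ((μ j.castSucc).prod (μ j.succ))) (j : Fin (k + 1)) :
    GammaLeg (fun i => l2Sp (μ i)) j :=
  legEquiv (μ j.castSucc) (μ j.succ) (legKind j) (f j)

theorem schurOpEven_legs_opTens (hk : Even k) (a : ∀ i, Lp ℂ ∞ (μ i))
    (f : ∀ j : Fin (k + 1), Lp ℂ 2 ((μ j.castSucc).prod (μ j.succ))) (ξ : Lp ℂ 2 (μ 0)) :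
    schurOpEven (opTens (k + 1) (fun i => l2Sp (μ i)) fun i => mulOp (a i)) (legs μ f)
      (pairing (μ 0) ξ) = compOp k μ a f ξ := by
  obtain ⟨n, hn⟩ := hk
  refine (schurOpEven_eq_evenE _ (legs μ f) (pairing (μ 0) ξ)).trans ?_
  refine evenE_mulOp n hn μ a f _ _ (fun j hj => isVecOf_legEquiv _ _ ?_ _)
    (fun j hj => isFnOf_legEquiv _ _ ?_ _) ξ
  -- `legKind` counts from the last leg; for even `k` the parities of `j` and `k - j` agree.
  · rw [legKind, decide_eq_true_eq, Fin.val_rev]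
    grind
  · rw [legKind, decide_eq_false_iff_not, Fin.val_rev]
    grind

theorem schurOpOdd_legs_opTens (hk : ¬ Even k) (a : ∀ i, Lp ℂ ∞ (μ i))
    (f : ∀ j : Fin (k + 1), Lp ℂ 2 ((μ j.castSucc).prod (μ j.succ))) (ξ : Lp ℂ 2 (μ 0)) :
    schurOpOdd (opTens (k + 1) (fun i => l2Sp (μ i)) fun i => mulOp (a i)) (legs μ f) ξ =
      compOp k μ a f ξ := by
  obtain _ | k := k
  · simp at hk
  refine (schurOpOdd_eq_oddE _ (legs μ f) ξ).trans ?_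
  refine oddE_mulOp (by grind) μ a f _ _ (fun j hj => isVecOf_legEquiv _ _ ?_ _)
    (fun j hj => isFnOf_legEquiv _ _ ?_ _) ξ
  -- `legKind` counts from the last leg; here the parities of `j` and of its reverse differ.
  · rw [legKind, decide_eq_true_eq, Fin.val_rev]
    grind
  · rw [legKind, decide_eq_false_iff_not, Fin.val_rev]
    grind

/-- The operator multiplier map of `φ ∈ L^∞(X₀) ⊗ ⋯ ⊗ L^∞(Xₖ₊₁)` at the legs given by kernels is
the operator with kernel `S_φ(f₀, …, fₖ)`, for an even number of spaces. -/
theorem schurOpEven_legs (hk : Even k) (φ : MinTensor fun i => Lp ℂ ∞ (μ i))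
    (f : ∀ j : Fin (k + 1), Lp ℂ 2 ((μ j.castSucc).prod (μ j.succ))) :
    schurOpEven (H := fun i => l2Sp (μ i)) (tensorRep (fun i => mulRep (μ i)) φ) (legs μ f) ∘L
        (pairing (μ 0) : Lp ℂ 2 (μ 0) →L[ℂ] StrongDual ℂ (Lp ℂ 2 (μ 0))) =
      kernelOp (schurLp μ f (minEmbed μ φ)) := by
  have h : (ContinuousLinearMap.compL ℂ (Lp ℂ 2 (μ 0)) (StrongDual ℂ (Lp ℂ 2 (μ 0)))
        (Lp ℂ 2 (μ (Fin.last (k + 1))))).flip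
      (pairing (μ 0) : Lp ℂ 2 (μ 0) →L[ℂ] StrongDual ℂ (Lp ℂ 2 (μ 0))) ∘L
        schurEvenL (legs μ f) ∘L tensorRep (H := fun i => l2Sp (μ i)) (fun i => mulRep (μ i)) =
      kernelOpL _ _ ∘L schurLp μ f ∘L (minEmbed μ).toContinuousLinearMap := by
    refine minTensor_ext fun a => ContinuousLinearMap.ext fun ξ => ?_
    change schurOpEven (tensorRep _ (MinTensor.tprod a)) (legs μ f) (pairing (μ 0) ξ) =
      kernelOp (schurLp μ f (minEmbed μ (MinTensor.tprod a))) ξ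
    rw [tensorRep_tprod, minEmbed_tprod, kernelOp_schurLp_prodLinf]
    exact schurOpEven_legs_opTens μ hk a f ξ
  exact congrArg (fun T => T φ) h

/-- The operator multiplier map of `φ ∈ L^∞(X₀) ⊗ ⋯ ⊗ L^∞(Xₖ₊₁)` at the legs given by kernels is
the operator with kernel `S_φ(f₀, …, fₖ)`, for an odd number of spaces. -/
theorem schurOpOdd_legs (hk : ¬ Even k) (φ : MinTensor fun i => Lp ℂ ∞ (μ i))
    (f : ∀ j : Fin (k + 1), Lp ℂ 2 ((μ j.castSucc).prod (μ j.succ))) :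
    schurOpOdd (H := fun i => l2Sp (μ i)) (tensorRep (fun i => mulRep (μ i)) φ) (legs μ f) =
      kernelOp (schurLp μ f (minEmbed μ φ)) := by
  have h : schurOddL (legs μ f) ∘L
      tensorRep (H := fun i => l2Sp (μ i)) (fun i => mulRep (μ i)) =
      kernelOpL _ _ ∘L schurLp μ f ∘L (minEmbed μ).toContinuousLinearMap := by
    refine minTensor_ext fun a => ContinuousLinearMap.ext fun ξ => ?_
    change schurOpOdd (tensorRep _ (MinTensor.tprod a)) (legs μ f) ξ =
      kernelOp (schurLp μ f (minEmbed μ (MinTensor.tprod a))) ξ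
    rw [tensorRep_tprod, minEmbed_tprod, kernelOp_schurLp_prodLinf]
    exact schurOpOdd_legs_opTens μ hk a f ξ
  exact congrArg (fun T => T φ) h

theorem kernelOp_sum {s : ℕ} (h : Fin s → Lp ℂ 2 ((μ 0).prod (μ (Fin.last (k + 1))))) :
    kernelOp (∑ r, h r) = ∑ r, kernelOp (h r) :=
  map_sum (kernelOpL _ _) h Finset.univ

/-- The operator multiplier map and the Schur multiplier map have the same operator norms. -/
theorem schurOpNorm_legs (φ : MinTensor fun i => Lp ℂ ∞ (μ i)) {s : ℕ}
    (f : Fin s → ∀ j : Fin (k + 1), Lp ℂ 2 ((μ j.castSucc).prod (μ j.succ))) :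
    schurOpNorm (H := fun i => l2Sp (μ i)) (tensorRep (fun i => mulRep (μ i)) φ)
      (fun r => legs μ (f r)) = ‖kernelOp (∑ r, schurLp μ (f r) (minEmbed μ φ))‖ := by
  rw [kernelOp_sum, schurOpNorm]
  by_cases hk : Even k
  · rw [if_pos (by grind)]
    rw [← ContinuousLinearMap.opNorm_comp_linearIsometryEquiv _ (pairing (μ 0))]
    refine congrArg norm ((ContinuousLinearMap.finsetSum_comp _ _).trans ?_)
    exact Finset.sum_congr rfl fun r _ => schurOpEven_legs μ hk φ (f r)
  · rw [if_neg (by grind)]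
    exact congrArg norm (Finset.sum_congr rfl fun r _ => schurOpOdd_legs μ hk φ (f r))

theorem haagerupNorm_legs {s : ℕ}
    (f : Fin s → ∀ j : Fin (k + 1), Lp ℂ 2 ((μ j.castSucc).prod (μ j.succ))) :
    haagerupNorm (GammaLeg fun i => l2Sp (μ i)) (fun _ => Leg.matNorm)
        (∑ r, PiTensorProduct.tprod ℂ (legs μ (f r))) =
      haagerupNorm (fun j : Fin (k + 1) => Lp ℂ 2 ((μ j.castSucc).prod (μ j.succ)))
        (fun _ _ _ a => ‖matrixOp (Matrix.of fun i j => kernelOp (a j i))‖)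
        (∑ r, PiTensorProduct.tprod ℂ (f r)) :=
  haagerupNorm_sum_tprod (fun j => legEquiv (μ j.castSucc) (μ j.succ) (legKind j))
    (fun j _ _ a => matNorm_legEquiv (μ j.castSucc) (μ j.succ) (legKind j) a) f

/-- In the definition of Schur multipliers, `S_φ(Φ)` can be taken to be the sum of the kernels
`schurLp`. -/
theorem isSchurMultiplier_iff (φ : Lp ℂ ∞ (Measure.pi μ)) :
    IsSchurMultiplier μ φ ↔ ∃ C : ℝ, 0 < C ∧
      ∀ (s : ℕ) (f : Fin s → ∀ j : Fin (k + 1), Lp ℂ 2 ((μ j.castSucc).prod (μ j.succ))),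
        ‖kernelOp (∑ r, schurLp μ (f r) φ)‖ ≤
          C * haagerupNorm (fun j : Fin (k + 1) => Lp ℂ 2 ((μ j.castSucc).prod (μ j.succ)))
            (fun _ _ _ a => ‖matrixOp (Matrix.of fun i j => kernelOp (a j i))‖)
            (∑ r, PiTensorProduct.tprod ℂ (f r)) := by
  refine exists_congr fun C => and_congr_right fun _ => forall_congr' fun s =>
    forall_congr' fun f => ?_
  have h : (∑ r, schurLp μ (f r) φ : Lp ℂ 2 ((μ 0).prod (μ (Fin.last (k + 1))))) =ᵐ[
      (μ 0).prod (μ (Fin.last (k + 1)))]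
      fun p => ∑ r, schurKernel μ φ (f r) p := by
    filter_upwards [Lp.coeFn_fun_finsetSum Finset.univ fun r => schurLp μ (f r) φ,
      ae_all_iff.2 fun r => coeFn_schurLp μ φ (f r)] with p h1 h2
    rw [h1]
    exact Finset.sum_congr rfl fun r _ => h2 r
  constructor
  · rintro ⟨h', he, hle⟩
    rwa [Lp.ext (he.trans h.symm)] at hle
  · exact fun hle => ⟨_, h, hle⟩

/-- In the definition of multipliers, the elements of `Γ` can be taken to be sums of legs given by
kernels. -/
theorem isMultiplier_iff (φ : MinTensor fun i => Lp ℂ ∞ (μ i)) :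
    IsMultiplier (H := fun i => l2Sp (μ i)) (fun i => mulRep (μ i)) φ ↔ ∃ C : ℝ, 0 < C ∧
      ∀ (s : ℕ) (f : Fin s → ∀ j : Fin (k + 1), Lp ℂ 2 ((μ j.castSucc).prod (μ j.succ))),
        schurOpNorm (H := fun i => l2Sp (μ i)) (tensorRep (fun i => mulRep (μ i)) φ)
            (fun r => legs μ (f r)) ≤
          C * haagerupNorm (GammaLeg fun i => l2Sp (μ i)) (fun _ => Leg.matNorm)
            (∑ r, PiTensorProduct.tprod ℂ (legs μ (f r))) := by
  refine exists_congr fun C => and_congr_right fun _ => forall_congr' fun s => ?_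
  refine ⟨fun h f => h _, fun h ζ => ?_⟩
  have hζ : ∀ r, legs μ (fun j =>
      (legEquiv (μ j.castSucc) (μ j.succ) (legKind j)).symm (ζ r j)) = ζ r :=
    fun r => funext fun j => LinearEquiv.apply_symm_apply _ _
  have h' := h fun r j => (legEquiv (μ j.castSucc) (μ j.succ) (legKind j)).symm (ζ r j)
  simp only [hζ] at h'
  exact h'

theorem isSchurMultiplier_minEmbed_iff (φ : MinTensor fun i => Lp ℂ ∞ (μ i)) :
    IsSchurMultiplier μ (minEmbed μ φ) ↔
      IsMultiplier (H := fun i => l2Sp (μ i)) (fun i => mulRep (μ i)) φ := by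
  rw [isSchurMultiplier_iff, isMultiplier_iff]
  simp only [schurOpNorm_legs, haagerupNorm_legs]

end

end OperatorMultiplier

end

theorem mainTheorem7 {k : ℕ} {X : Fin (k + 2) → Type*} [∀ i, MeasurableSpace (X i)]
    (μ : ∀ i, Measure (X i)) [∀ i, SigmaFinite (μ i)] :
    ∃ ι : MinTensor (fun i => Lp ℂ ∞ (μ i)) →ₗᵢ[ℂ] Lp ℂ ∞ (Measure.pi μ),
      (∀ a : ∀ i, Lp ℂ ∞ (μ i),
        ι (MinTensor.tprod a) =ᵐ[Measure.pi μ] fun x => ∏ i, a i (x i)) ∧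
      ∀ φ : MinTensor (fun i => Lp ℂ ∞ (μ i)),
        IsSchurMultiplier μ (ι φ) ↔
          IsMultiplier (H := fun i => l2Sp (μ i)) (fun i => mulRep (μ i)) φ :=
  ⟨minEmbed μ, fun a => (minEmbed_tprod μ a).symm ▸ coeFn_prodLinf μ a,
    isSchurMultiplier_minEmbed_iff μ⟩
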